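/- **Conventions.** $\mathbb N=\{1,2,\dots\}$. *Machines.* An algorithm is a program of a random access machine with registers and indirectly addressed memory holding natural numbers (operations: constants, addition, truncated subtraction, load, store, branching and looping on a register being nonzero, fair coin flip); the time of a run is the sum of the logarithmic costs of its operations. Approximation algorithms output a rational number. For a set $\mathcal K$ of inputs, $T_{\mathcal A}(\mathcal K)\in\mathbb N\cup\{\infty\}$ is the supremum of the running times of $\mathcal A$ over all inputs in $\mathcal K$ and all outcomes of the coin flips. A probabilistic algorithm $\mathcal A$ satisfies $|\mathcal A(\Phi)-\mathcal T(\Phi)|<\varepsilon$ if this holds with probability at least $2/3$. *Satisfiability.* For $k,n,C\in\mathbb N$ let $\mathcal S_k(n)$ be the set of formulas in conjunctive normal form (nonempty finite sets of nonempty clauses, a clause being a set of literals) in variables $x_1,\dots,x_n$ with at most $k$ literals per clause, and let $\widetilde{\mathcal S}_k(n)\subseteq\mathcal S_k(n)$ be the set of those with at most $Cn$ clauses. A decision algorithm for $k$SAT halts on all formulas in $\bigcup_n\mathcal S_k(n)$ (given as lists of clauses, which are lists of literals), decides satisfiability correctly with probability at least $2/3$, and accepts an input that is not such a formula with probability at most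 $1/3$. Let $$\widetilde s_k:=\inf\{s>0 : \text{there is a decision algorithm } \mathcal B \text{ for } k\text{SAT with } T_{\mathcal B}(\widetilde{\mathcal S}_k(n))=\mathcal O(2^{sn}) \text{ as } n\to\infty\}.$$ *Networks.* $\mathcal N(d,w,L,\theta)$ is the set of feed-forward networks with $d$ inputs, one output, at most $L$ layers (weight matrices), all layer widths (including input and output) between $1$ and $w$, and all weights and biases in $\theta\subseteq\mathbb R$. $\mathcal R_\Phi$ denotes the realization of $\Phi$ with activation $\sigma(x)=\max\{0,x\}$ in all layers but the last. A network with parameters in a fixed finite set $\theta$ is given to a machine by its depth, its widths, and the list of its parameters, each represented by its position in $\theta$. **Theorem (high-precision setting).** Let $d,k,C,w_r,L_r\in\mathbb N$, $0<\delta<1/2$, let $\theta_r\subset\mathbb R$ be finite, let $\Psi\in\mathcal N(1,w_r,L_r,\theta_r)$, and let $r:\mathbb R\to[0,1]$ be continuous with $r(x)=0$ for $x\le 1/2$, $r(x)=1$ for $x\ge 1-\delta$, and $\mathcal R_\Psi=r$. Let $\theta\subset\mathbb R$ be a finite set that contains $\theta_{\rm CV}=\{-1,0,1,-\delta^{-1},\delta^{-1},\delta,-(1-\delta)\}$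 and $\theta_{\rm CNF}$, the set of the numbers $-1,0,1$ and of all numbers $a$, $-a$, $a+b$, $ab$, $m\,ab+c$ and $a(b-1)$ with $a,b,c\in\theta_r$ and $m\in\{0,\dots,k\}$. For $n\ge d$ define $$\mathcal K(n):=\{\Phi\in\mathcal N(d,\max(2,Cw_rk)\,n,\;3L_r+(n-d)-1,\;\theta) : 0\le\mathcal R_\Phi(x)\le 1 \text{ for all } x\in\mathbb R^d\},$$ and $\mathcal K(n):=\mathcal K(d)$ for $0\le n<d$. Let $\mathcal A$ be a (probabilistic) approximation algorithm such that for all $n\in\mathbb N$ and all $\Phi\in\mathcal K(n)\setminus\mathcal K(n-1)$ $$\Big|\mathcal A(\Phi)-\int_{[0,1]^d}\mathcal R_\Phi(x)\,dx\Big|<\frac{\delta^n}{2}.$$ If $T_{\mathcal A}(\mathcal K(n))=\mathcal O(2^{tn})$ as $n\to\infty$ for some $t>0$, then $t\ge\widetilde s_k$. -/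

import Mathlib

open MeasureTheory
open scoped ENNReal Matrix

namespace QuadHard

/-! ## Model of computation: probabilistic random access machines, logarithmic cost

A machine has scalar registers `reg 0, reg 1, …` and memory banks `mem 0, mem 1, …`, all holding
natural numbers, and an infinite sequence of random bits. A program is a finite text and mentions
only finitely many registers and banks; the cells of a bank are addressed indirectly. -/

structure State where
  reg : ℕ → ℕ
  mem : ℕ → ℕ → ℕ
  coins : ℕ → Bool

/-- Write `v` into register `r`. -/
def State.setReg (s : State) (r v : ℕ) : State :=
  { s with reg := Function.update s.reg r v }

/-- Write `v` into cell `i` of bank `a`. -/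
def State.setMem (s : State) (a i v : ℕ) : State :=
  { s with mem := Function.update s.mem a (Function.update (s.mem a) i v) }

/-- Programs of the machine. -/
inductive Prog where
  | skip : Prog
  /-- `reg r := c` for a constant `c` -/
  | const (r c : ℕ) : Prog
  /-- `reg r := reg a + reg b` -/
  | add (r a b : ℕ) : Prog
  /-- `reg r := max (reg a - reg b) 0` -/
  | sub (r a b : ℕ) : Prog
  /-- `reg r := mem a [reg i]` -/
  | load (r a i : ℕ) : Prog
  /-- `mem a [reg i] := reg b` -/
  | store (a i b : ℕ) : Prog
  /-- `reg r := ` a fresh random bit -/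
  | flip (r : ℕ) : Prog
  /-- first `p`, then `q` -/
  | seq (p q : Prog) : Prog
  /-- if `reg r ≠ 0` then `p` else `q` -/
  | ite (r : ℕ) (p q : Prog) : Prog
  /-- while `reg r ≠ 0` do `p` -/
  | loop (r : ℕ) (p : Prog) : Prog

/-- The logarithmic cost of handling the number `x`: one plus its binary length. -/
def logCost (x : ℕ) : ℕ := Nat.size x + 1

/-- `Exec p s T s'`: started in state `s`, the program `p` halts in state `s'`, and the total cost of
the operations carried out is `T`. -/
inductive Exec : Prog → State → ℕ → State → Prop where
  | skip (s : State) : Exec .skip s 1 s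
  | const (s : State) (r c : ℕ) : Exec (.const r c) s (logCost c) (s.setReg r c)
  | add (s : State) (r a b : ℕ) :
      Exec (.add r a b) s (logCost (s.reg a) + logCost (s.reg b))
        (s.setReg r (s.reg a + s.reg b))
  | sub (s : State) (r a b : ℕ) :
      Exec (.sub r a b) s (logCost (s.reg a) + logCost (s.reg b))
        (s.setReg r (s.reg a - s.reg b))
  | load (s : State) (r a i : ℕ) :
      Exec (.load r a i) s (logCost (s.reg i) + logCost (s.mem a (s.reg i)))
        (s.setReg r (s.mem a (s.reg i)))
  | store (s : State) (a i b : ℕ) :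
      Exec (.store a i b) s (logCost (s.reg i) + logCost (s.reg b))
        (s.setMem a (s.reg i) (s.reg b))
  | flip (s : State) (r : ℕ) :
      Exec (.flip r) s 1
        { s.setReg r (s.coins 0).toNat with coins := fun i => s.coins (i + 1) }
  | seq {p q : Prog} {s s₁ s₂ : State} {T₁ T₂ : ℕ} (hp : Exec p s T₁ s₁) (hq : Exec q s₁ T₂ s₂) :
      Exec (.seq p q) s (T₁ + T₂) s₂
  | iteTrue {r : ℕ} {p q : Prog} {s s₁ : State} {T : ℕ} (h : s.reg r ≠ 0) (hp : Exec p s T s₁) :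
      Exec (.ite r p q) s (logCost (s.reg r) + T) s₁
  | iteFalse {r : ℕ} {p q : Prog} {s s₁ : State} {T : ℕ} (h : s.reg r = 0) (hq : Exec q s T s₁) :
      Exec (.ite r p q) s (logCost (s.reg r) + T) s₁
  | loopDone {r : ℕ} {p : Prog} {s : State} (h : s.reg r = 0) :
      Exec (.loop r p) s (logCost (s.reg r)) s
  | loopStep {r : ℕ} {p : Prog} {s s₁ s₂ : State} {T₁ T₂ : ℕ} (h : s.reg r ≠ 0)
      (hp : Exec p s T₁ s₁) (hq : Exec (.loop r p) s₁ T₂ s₂) :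
      Exec (.loop r p) s (logCost (s.reg r) + T₁ + T₂) s₂

/-- For a given sequence of random bits (part of the state), the run is deterministic: the final
state and the cost are unique. -/
theorem Exec.det {p : Prog} {s s₁ s₂ : State} {T₁ T₂ : ℕ}
    (h₁ : Exec p s T₁ s₁) (h₂ : Exec p s T₂ s₂) : T₁ = T₂ ∧ s₁ = s₂ := by
  induction h₁ generalizing T₂ s₂ with
  | skip | const | add | sub | load | store | flip => cases h₂; exact ⟨rfl, rfl⟩
  | seq _ _ ih₁ ih₂ =>
    cases h₂ with
    | seq hp hq =>
      obtain ⟨rfl, rfl⟩ := ih₁ hp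
      obtain ⟨rfl, rfl⟩ := ih₂ hq
      exact ⟨rfl, rfl⟩
  | iteTrue h _ ih =>
    cases h₂ with
    | iteTrue _ hp => obtain ⟨rfl, rfl⟩ := ih hp; exact ⟨rfl, rfl⟩
    | iteFalse h' _ => exact absurd h' h
  | iteFalse h _ ih =>
    cases h₂ with
    | iteTrue h' _ => exact absurd h h'
    | iteFalse _ hq => obtain ⟨rfl, rfl⟩ := ih hq; exact ⟨rfl, rfl⟩
  | loopDone h =>
    cases h₂ with
    | loopDone _ => exact ⟨rfl, rfl⟩
    | loopStep h' _ _ => exact absurd h h'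
  | loopStep h _ _ ih₁ ih₂ =>
    cases h₂ with
    | loopDone h' => exact absurd h' h
    | loopStep _ hp hq =>
      obtain ⟨rfl, rfl⟩ := ih₁ hp
      obtain ⟨rfl, rfl⟩ := ih₂ hq
      exact ⟨rfl, rfl⟩

/-- Initial state on input `x`: bank `0` holds the entries of `x`, register `0` its length, everything
else is zero; `ω` is the sequence of random bits. -/
def initState (x : List ℕ) (ω : ℕ → Bool) : State where
  reg r := if r = 0 then x.length else 0
  mem a i := if a = 0 then x.getD i 0 else 0
  coins := ω

/-- Fair coin tossing: the infinite product of the uniform distribution on `{0,1}`. -/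
noncomputable def coinMeasure : Measure (ℕ → Bool) :=
  Measure.infinitePi fun _ => (PMF.uniformOfFintype Bool).toMeasure

def Prog.Halts (p : Prog) (x : List ℕ) (ω : ℕ → Bool) : Prop :=
  ∃ T s, Exec p (initState x ω) T s

/-- The running time on input `x` with random bits `ω`; it is `⊤` if the program does not halt. -/
noncomputable def Prog.time (p : Prog) (x : List ℕ) (ω : ℕ → Bool) : ℕ∞ :=
  ⨅ (T : ℕ) (_ : ∃ s, Exec p (initState x ω) T s), (T : ℕ∞)

/-- The worst case running time over a set of inputs (and over all random bits). -/
noncomputable def Prog.worstTime (p : Prog) (I : Set (List ℕ)) : ℕ∞ :=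
  ⨆ x ∈ I, ⨆ ω, p.time x ω

/-- Natural-number output: the content of register `0` upon halting. -/
def Prog.OutputsNat (p : Prog) (x : List ℕ) (ω : ℕ → Bool) (v : ℕ) : Prop :=
  ∃ T s, Exec p (initState x ω) T s ∧ s.reg 0 = v

/-- Numerical output of an approximation algorithm: the rational number with numerator
`reg 0 - reg 1` and denominator `reg 2 + 1` upon halting. -/
def Prog.OutputsReal (p : Prog) (x : List ℕ) (ω : ℕ → Bool) (v : ℝ) : Prop :=
  ∃ T s, Exec p (initState x ω) T s ∧
    v = ((s.reg 0 : ℝ) - (s.reg 1 : ℝ)) / ((s.reg 2 : ℝ) + 1)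

/-- `T(n) = O(2^(t n))` as `n → ∞`. -/
def IsBigOExp (T : ℕ → ℕ∞) (t : ℝ) : Prop :=
  ∃ c : ℝ, ∃ n₀ : ℕ, ∀ n ≥ n₀, ((T n : ℕ∞) : ℝ≥0∞) ≤ ENNReal.ofReal (c * (2 : ℝ) ^ (t * n))

/-! ## Formulas in conjunctive normal form -/

/-- `(i, true)` is the variable `x_i`, `(i, false)` its negation. -/
abbrev Literal := ℕ × Bool

abbrev Clause := Finset Literal

abbrev CNF := Finset Clause

def CNF.Satisfiable (α : CNF) : Prop :=
  ∃ z : ℕ → Bool, ∀ c ∈ α, ∃ l ∈ c, z l.1 = l.2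

/-- Formulas in the variables `x_1, …, x_n` with at most `k` literals per clause; clauses and
formulas are nonempty. -/
def kCNF (k n : ℕ) : Set CNF :=
  {α | α.Nonempty ∧ ∀ c ∈ α, c.Nonempty ∧ c.card ≤ k ∧ ∀ l ∈ c, 1 ≤ l.1 ∧ l.1 ≤ n}

/-- Formulas in `kCNF k n` with at most `C * n` clauses. -/
def sparseCNF (C k n : ℕ) : Set CNF :=
  {α | α ∈ kCNF k n ∧ α.card ≤ C * n}

/-- `x_i` is coded by `2 i`, its negation by `2 i + 1`. -/
def Literal.code (l : Literal) : ℕ := 2 * l.1 + (if l.2 then 0 else 1)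

/-- The machine input `x` presents the formula `α`: it lists the clauses of `α` in some order, without
repetition, each clause as the list of the codes of its literals in some order, without repetition,
followed by the end mark `0`. -/
def Presents (x : List ℕ) (α : CNF) : Prop :=
  ∃ cs : List (List Literal),
    (∀ c ∈ cs, c.Nodup) ∧ (cs.map List.toFinset).Nodup ∧ (cs.map List.toFinset).toFinset = α ∧
    x = cs.flatMap fun c => c.map Literal.code ++ [0]

/-- `B` is a probabilistic decision algorithm for `k`SAT: it produces an output on every formula, the
output is correct with probability at least `2/3`, and an input that presents no formula with at most
`k` literals per clause is accepted with probability at most `1/3`. -/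
def DecidesKSAT (k : ℕ) (B : Prog) : Prop :=
  (∀ n, ∀ α ∈ kCNF k n, ∀ x, Presents x α → ∀ ω, B.Halts x ω) ∧
  (∀ n, ∀ α ∈ kCNF k n, ∀ x, Presents x α →
    (α.Satisfiable → 2 / 3 ≤ coinMeasure {ω | B.OutputsNat x ω 1}) ∧
    (¬ α.Satisfiable → 2 / 3 ≤ coinMeasure {ω | B.OutputsNat x ω 0})) ∧
  (∀ x, (∀ n, ∀ α ∈ kCNF k n, ¬ Presents x α) → coinMeasure {ω | B.OutputsNat x ω 1} ≤ 1 / 3)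

/-- The infimum of all `s > 0` such that some decision algorithm for `k`SAT has worst case running time
`O(2^(s n))` on the formulas in `n` variables with at most `C n` clauses. -/
noncomputable def sTilde (C k : ℕ) : ℝ :=
  sInf {s : ℝ | 0 < s ∧ ∃ B : Prog, DecidesKSAT k B ∧
    IsBigOExp (fun n => B.worstTime {x | ∃ α ∈ sparseCNF C k n, Presents x α}) s}

/-! ## ReLU networks -/

/-- Feed-forward networks with `d` inputs and `m` outputs: a list of layers, each given by a weight
matrix and a bias vector. -/
inductive Network : ℕ → ℕ → Type where
  | last {d m : ℕ} (W : Matrix (Fin m) (Fin d) ℝ) (b : Fin m → ℝ) : Network d m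
  | cons {d w m : ℕ} (W : Matrix (Fin w) (Fin d) ℝ) (b : Fin w → ℝ) (Φ : Network w m) : Network d m

namespace Network

/-- The realization with activation function `σ(x) = max{0, x}` in all layers but the last. -/
noncomputable def realize : {d m : ℕ} → Network d m → (Fin d → ℝ) → (Fin m → ℝ)
  | _, _, last W b, x => W *ᵥ x + b
  | _, _, cons W b Φ, x => Φ.realize fun i => max 0 ((W *ᵥ x + b) i)

/-- The number of layers (weight matrices). -/
def depth : {d m : ℕ} → Network d m → ℕ
  | _, _, last _ _ => 1
  | _, _, cons _ _ Φ => Φ.depth + 1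

/-- The list `w_0, w_1, …, w_L` of the layer widths, beginning with the input dimension. -/
def widths : {d m : ℕ} → Network d m → List ℕ
  | d, m, last _ _ => [d, m]
  | d, _, cons _ _ Φ => d :: Φ.widths

/-- The list of all weights and biases: layer by layer, first the matrix row by row, then the bias. -/
def params : {d m : ℕ} → Network d m → List ℝ
  | d, m, last W b =>
      ((List.finRange m).flatMap fun i => (List.finRange d).map fun j => W i j) ++
        (List.finRange m).map b
  | d, _, cons (w := w) W b Φ =>
      ((List.finRange w).flatMap fun i => (List.finRange d).map fun j => W i j) ++
        (List.finRange w).map b ++ Φ.params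

/-- Networks with `d` inputs, one output, widths in `[1, w]`, depth at most `L`, parameters in `θ`. -/
def netClass (d w L : ℕ) (θ : Finset ℝ) : Set (Network d 1) :=
  {Φ | Φ.depth ≤ L ∧ (∀ v ∈ Φ.widths, 1 ≤ v ∧ v ≤ w) ∧ ∀ a ∈ Φ.params, a ∈ θ}

/-- The machine input for a network with parameters in the finite set `θ`: the depth, the widths, and
the parameters, where `a ∈ θ` is represented by its position in the increasing enumeration of `θ`. -/
noncomputable def encode (θ : Finset ℝ) {d m : ℕ} (Φ : Network d m) : List ℕ :=
  Φ.depth :: (Φ.widths ++ Φ.params.map fun a => (θ.filter (· < a)).card)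

end Network

section Weights

open scoped Pointwise

/-- The weights and biases that arise when a formula with at most `k` literals per clause is turned
into a network by composing and adding copies of a network with parameters in `θr`, coordinate
projections, and the map `x ↦ 1 - x`: layers are merged by composing an output layer
`y ↦ v · y + b'` with a first layer `x ↦ w x + b`, possibly after summing at most `k` outputs or after
subtracting `1` from the output. -/
noncomputable def cnfWeights (θr : Finset ℝ) (k : ℕ) : Finset ℝ :=
  {-1, 0, 1} ∪ θr ∪ -θr ∪ (θr + θr) ∪ θr * θr ∪
    ((Finset.range (k + 1)).biUnion fun m => (θr * θr).image (fun a => (m : ℝ) * a) + θr) ∪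
    θr * (θr.image fun a => a - 1)

/-- The weights and biases of the networks that realize the curve `t ↦ (s(⋯s(t)), …, s(t), t)` with
`s(t) = 1 - δ⁻¹ σ(δ - t) - δ⁻¹ σ(t - (1 - δ))`. -/
noncomputable def curveWeights (δ : ℝ) : Finset ℝ :=
  {-1, 0, 1, -δ⁻¹, δ⁻¹, δ, -(1 - δ)}

end Weights

/-- The class `K(n)` for `n ≥ d`, and `K(d)` for `n < d`. -/
def inputClass (d k C wr Lr : ℕ) (θ : Finset ℝ) (n : ℕ) : Set (Network d 1) :=
  {Φ | Φ ∈ Network.netClass d (max 2 (C * wr * k) * max n d) (3 * Lr + (max n d - d) - 1) θ ∧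
    ∀ x : Fin d → ℝ, 0 ≤ Φ.realize x 0 ∧ Φ.realize x 0 ≤ 1}

end QuadHard

/-!
Deciding satisfiability reduces to integrating a network. With the trapezoid function `s`, whose
two outer branches map `[0, δ]` and `[1 - δ, 1]` onto `[0, 1]`, the curve `t ↦ (t, s t, s (s t),
…)` comes close to every vertex of the cube `[0, 1]^N`, on an interval of length about `δ ^ N`. A
network follows this curve in the first coordinate of its input, one iteration of `s` per layer. A
pair of gates turns each iterate into the truth values of two literals, which wait in a delay line
for the layer that evaluates the clauses; the delay line also amplifies them by `δ⁻¹` per layer, so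
that the true ones arrive with values at least `1`. The resulting function has values in `[0, 1]`.
It is `0` if the formula is not satisfiable, and `1` on a slab of width `δ ^ (N + 1)` otherwise.

For `N = M * g`, where `g` is about `1 / M` times the number of variables, the network belongs to
the input class of index `(M + 3) * g`. The error `δ ^ ((M + 3) * g) / 2` is so small that
comparing the output with a power of two decides satisfiability, and for large `M` the factor `(M +
3) / M` in the exponent of the running time is absorbed by replacing `t` with any `s > t`.

On the machine, arithmetic terms and descriptions of lists are compiled to programs of polynomial
running time. They validate the input, compute `g`, and write down the network for the given
algorithm, which then runs as a subroutine while the threshold waits in a register that the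
algorithm does not mention.
-/

namespace QuadHard

open Polynomial Set

/-! ## Running programs -/

theorem logCost_le (x : ℕ) : logCost x ≤ x + 1 :=
  Nat.succ_le_succ (Nat.size_le.2 Nat.lt_two_pow_self)

namespace State

variable (s : State) (r a i v : ℕ)

@[simp] theorem setReg_reg (j : ℕ) : (s.setReg r v).reg j = if j = r then v else s.reg j := by
  simp [setReg, Function.update_apply]

@[simp] theorem setReg_mem : (s.setReg r v).mem = s.mem := rfl

@[simp] theorem setMem_reg : (s.setMem a i v).reg = s.reg := rfl

@[simp] theorem setMem_mem (b : ℕ) :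
    (s.setMem a i v).mem b = if b = a then Function.update (s.mem a) i v else s.mem b := by
  simp [setMem, Function.update_apply]

end State

/-- The states `s` and `s'` have the same random bits, the same contents of the registers in `R`,
and the same contents of the memory banks in `M`. -/
structure AgreeOn (R M : Set ℕ) (s s' : State) : Prop where
  reg : ∀ r ∈ R, s'.reg r = s.reg r
  mem : ∀ a ∈ M, s'.mem a = s.mem a
  coins : s'.coins = s.coins

namespace AgreeOn

variable {R R' M M' : Set ℕ} {s s' s'' : State}

theorem refl (s : State) : AgreeOn R M s s := ⟨fun _ _ => rfl, fun _ _ => rfl, rfl⟩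

theorem trans (h₁ : AgreeOn R M s s') (h₂ : AgreeOn R M s' s'') : AgreeOn R M s s'' :=
  ⟨fun r hr => (h₂.reg r hr).trans (h₁.reg r hr), fun a ha => (h₂.mem a ha).trans (h₁.mem a ha),
    h₂.coins.trans h₁.coins⟩

theorem mono (h : AgreeOn R M s s') (hR : R' ⊆ R) (hM : M' ⊆ M) : AgreeOn R' M' s s' :=
  ⟨fun r hr => h.reg r (hR hr), fun a ha => h.mem a (hM ha), h.coins⟩

theorem setReg (h : AgreeOn R M s s') {r : ℕ} (hr : r ∉ R) (v : ℕ) :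
    AgreeOn R M s (s'.setReg r v) :=
  ⟨fun j hj => by rw [s'.setReg_reg, if_neg (ne_of_mem_of_not_mem hj hr), h.reg j hj], h.mem,
    h.coins⟩

theorem setMem (h : AgreeOn R M s s') {a : ℕ} (ha : a ∉ M) (i v : ℕ) :
    AgreeOn R M s (s'.setMem a i v) :=
  ⟨h.reg, fun b hb => by rw [s'.setMem_mem, if_neg (ne_of_mem_of_not_mem hb ha), h.mem b hb],
    h.coins⟩

end AgreeOn

/-- Started in `s`, the program `p` halts at cost at most `c` in a state with property `Q`. -/
def RunsTo (p : Prog) (s : State) (c : ℕ) (Q : State → Prop) : Prop :=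
  ∃ T s', Exec p s T s' ∧ T ≤ c ∧ Q s'

namespace RunsTo

variable {p q : Prog} {s : State} {c c' : ℕ} {Q Q' : State → Prop}

theorem mono (h : RunsTo p s c Q) (hc : c ≤ c') (hQ : ∀ s', Q s' → Q' s') : RunsTo p s c' Q' :=
  let ⟨T, s', hp, hT, hs'⟩ := h
  ⟨T, s', hp, hT.trans hc, hQ s' hs'⟩

theorem seq (hp : RunsTo p s c Q) (hq : ∀ s', Q s' → RunsTo q s' c' Q') :
    RunsTo (.seq p q) s (c + c') Q' :=
  let ⟨_, s', hp, hT, hs'⟩ := hp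
  let ⟨_, s'', hq, hT', hs''⟩ := hq s' hs'
  ⟨_, s'', .seq hp hq, add_le_add hT hT', hs''⟩

theorem const {r v : ℕ} : RunsTo (.const r v) s (v + 1) (· = s.setReg r v) :=
  ⟨_, _, .const s r v, logCost_le v, rfl⟩

theorem add_of_logCost_le {r a b : ℕ} (hc : logCost (s.reg a) + logCost (s.reg b) ≤ c) :
    RunsTo (.add r a b) s c (· = s.setReg r (s.reg a + s.reg b)) :=
  ⟨_, _, .add s r a b, hc, rfl⟩

theorem add {r a b : ℕ} (hc : s.reg a + s.reg b + 2 ≤ c) :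
    RunsTo (.add r a b) s c (· = s.setReg r (s.reg a + s.reg b)) :=
  add_of_logCost_le (by linarith [logCost_le (s.reg a), logCost_le (s.reg b)])

theorem sub_of_logCost_le {r a b : ℕ} (hc : logCost (s.reg a) + logCost (s.reg b) ≤ c) :
    RunsTo (.sub r a b) s c (· = s.setReg r (s.reg a - s.reg b)) :=
  ⟨_, _, .sub s r a b, hc, rfl⟩

theorem sub {r a b : ℕ} (hc : s.reg a + s.reg b + 2 ≤ c) :
    RunsTo (.sub r a b) s c (· = s.setReg r (s.reg a - s.reg b)) :=
  sub_of_logCost_le (by linarith [logCost_le (s.reg a), logCost_le (s.reg b)])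

theorem load {r a i : ℕ} (hc : s.reg i + s.mem a (s.reg i) + 2 ≤ c) :
    RunsTo (.load r a i) s c (· = s.setReg r (s.mem a (s.reg i))) :=
  ⟨_, _, .load s r a i, by
    linarith [logCost_le (s.reg i), logCost_le (s.mem a (s.reg i))], rfl⟩

theorem store {a i b : ℕ} (hc : s.reg i + s.reg b + 2 ≤ c) :
    RunsTo (.store a i b) s c (· = s.setMem a (s.reg i) (s.reg b)) :=
  ⟨_, _, .store s a i b, by linarith [logCost_le (s.reg i), logCost_le (s.reg b)], rfl⟩

theorem ite_of_logCost_le {r N : ℕ} (hr : logCost (s.reg r) ≤ N)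
    (hp : s.reg r ≠ 0 → RunsTo p s c Q) (hq : s.reg r = 0 → RunsTo q s c Q) :
    RunsTo (.ite r p q) s (N + c) Q := by
  by_cases h0 : s.reg r = 0
  · obtain ⟨T, s', hq, hT, hs'⟩ := hq h0
    exact ⟨_, s', .iteFalse h0 hq, add_le_add hr hT, hs'⟩
  · obtain ⟨T, s', hp, hT, hs'⟩ := hp h0
    exact ⟨_, s', .iteTrue h0 hp, add_le_add hr hT, hs'⟩

theorem ite {r : ℕ} (hp : s.reg r ≠ 0 → RunsTo p s c Q) (hq : s.reg r = 0 → RunsTo q s c Q) :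
    RunsTo (.ite r p q) s (s.reg r + 1 + c) Q :=
  ite_of_logCost_le (logCost_le _) hp hq

/-- Here `I j` is the invariant that holds when `j` rounds are left. -/
theorem loop_of_logCost_le {r n N : ℕ} (I : ℕ → State → Prop) (hr : ∀ j s, I j s → s.reg r = j)
    (hlog : ∀ j ≤ n, logCost j ≤ N)
    (hstep : ∀ j < n, ∀ s, I (j + 1) s → RunsTo p s c (I j)) (hI : I n s) :
    RunsTo (.loop r p) s ((n + 1) * N + n * c) (I 0) := by
  induction n generalizing s with
  | zero =>
    have h0 := hr 0 s hI
    exact ⟨_, s, .loopDone h0, by simpa [h0] using hlog 0 le_rfl, hI⟩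
  | succ n ih =>
    have hn := hr _ s hI
    obtain ⟨T, s', hp, hT, hI'⟩ := hstep n n.lt_succ_self s hI
    obtain ⟨T', s'', hloop, hT', hs''⟩ :=
      ih (fun j hj => hlog j (hj.trans n.le_succ))
        (fun j hj => hstep j (hj.trans n.lt_succ_self)) hI'
    refine ⟨_, s'', .loopStep (by omega) hp hloop, ?_, hs''⟩
    have := hlog _ le_rfl
    rw [hn]
    linarith

theorem loop {r n N : ℕ} (I : ℕ → State → Prop) (hr : ∀ j s, I j s → s.reg r = j) (hn : n ≤ N)
    (hstep : ∀ j < n, ∀ s, I (j + 1) s → RunsTo p s c (I j)) (hI : I n s) :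
    RunsTo (.loop r p) s ((N + 1) * (N + 1 + c)) (I 0) := by
  refine (loop_of_logCost_le I hr (N := N + 1)
    (fun j hj => (logCost_le j).trans (by omega)) hstep hI).mono ?_ fun _ => id
  calc (n + 1) * (N + 1) + n * c ≤ (N + 1) * (N + 1) + (N + 1) * c :=
        add_le_add (Nat.mul_le_mul_right _ (by omega)) (Nat.mul_le_mul_right _ (by omega))
    _ = (N + 1) * (N + 1 + c) := (mul_add ..).symm

end RunsTo

/-! ## Compiling arithmetic terms -/

/-- Started in `s`, the program `p` writes `v` into register `h` at cost at most `c`; the registers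
below `h`, the memory, and the random bits are left as they are. -/
def Writes (p : Prog) (h : ℕ) (s : State) (c v : ℕ) : Prop :=
  RunsTo p s c fun s' => AgreeOn (Iio h) univ s s' ∧ s'.reg h = v

/-- Adds the values computed by `q` with register `h + 2` running through `0, …, reg h - 1`. -/
def sumLoop (q : Prog) (h : ℕ) : Prog :=
  .seq (.const (h + 1) 0) <| .seq (.const (h + 2) 0) <| .seq (.const (h + 3) 1) <|
    .seq
      (.loop h <| .seq q <| .seq (.add (h + 1) (h + 1) (h + 4)) <|
        .seq (.add (h + 2) (h + 2) (h + 3)) (.sub h h (h + 3)))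
      (.add h h (h + 1))

namespace Writes

variable {p q : Prog} {s : State} {h c c' v : ℕ}

theorem mono (hp : Writes p h s c v) (hc : c ≤ c') : Writes p h s c' v :=
  RunsTo.mono hp hc fun _ => id

theorem const (s : State) (h v : ℕ) : Writes (.const h v) h s (v + 1) v :=
  RunsTo.const.mono le_rfl fun _ hs => hs ▸ ⟨(AgreeOn.refl s).setReg (by simp) _, by simp⟩

theorem copy {r : ℕ} (hr : r < h) :
    Writes (.seq (.const h 0) (.add h h r)) h s (s.reg r + 3) (s.reg r) := by
  refine (RunsTo.const.seq (c' := s.reg r + 2) ?_).mono (by omega) fun _ => id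
  rintro _ rfl
  refine (RunsTo.add (by simp [hr.ne])).mono le_rfl ?_
  rintro _ rfl
  exact ⟨((AgreeOn.refl s).setReg (by simp) _).setReg (by simp) _, by simp [hr.ne]⟩

theorem load {b : ℕ} (hp : Writes p h s c v) (hb : s.mem 0 v ≤ b) :
    Writes (.seq p (.load h 0 h)) h s (c + (v + b + 2)) (s.mem 0 v) := by
  refine RunsTo.seq hp ?_
  rintro s' ⟨hs', rfl⟩
  have hmem := hs'.mem 0 (mem_univ 0)
  refine (RunsTo.load (by rw [hmem]; omega)).mono le_rfl ?_
  rintro _ rfl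
  exact ⟨hs'.setReg (by simp) _, by simp [hmem]⟩

variable {a b : ℕ}

theorem operands (hp : Writes p h s c a)
    (hq : ∀ s', AgreeOn (Iio h) univ s s' → Writes q (h + 1) s' c' b) :
    RunsTo (.seq p q) s (c + c') fun s' =>
      AgreeOn (Iio h) univ s s' ∧ s'.reg h = a ∧ s'.reg (h + 1) = b := by
  refine RunsTo.seq hp fun s₁ ⟨h₁, ha⟩ => (hq s₁ h₁).imp fun T => ?_
  rintro ⟨s₂, hT, hc, h₂, hb⟩
  exact ⟨s₂, hT, hc, h₁.trans (h₂.mono (Iio_subset_Iio h.le_succ) subset_rfl),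
    (h₂.reg h (by simp)).trans ha, hb⟩

theorem add (hp : Writes p h s c a)
    (hq : ∀ s', AgreeOn (Iio h) univ s s' → Writes q (h + 1) s' c' b) :
    Writes (.seq (.seq p q) (.add h h (h + 1))) h s (c + c' + (a + b + 2)) (a + b) := by
  refine (hp.operands hq).seq ?_
  rintro s' ⟨hs', rfl, rfl⟩
  refine (RunsTo.add le_rfl).mono le_rfl ?_
  rintro _ rfl
  exact ⟨hs'.setReg (by simp) _, by simp⟩

theorem sub (hp : Writes p h s c a)
    (hq : ∀ s', AgreeOn (Iio h) univ s s' → Writes q (h + 1) s' c' b) :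
    Writes (.seq (.seq p q) (.sub h h (h + 1))) h s (c + c' + (a + b + 2)) (a - b) := by
  refine (hp.operands hq).seq ?_
  rintro s' ⟨hs', rfl, rfl⟩
  refine (RunsTo.sub le_rfl).mono le_rfl ?_
  rintro _ rfl
  exact ⟨hs'.setReg (by simp) _, by simp⟩

theorem ite {p' : Prog} (hp : Writes p h s c v)
    (hq : v ≠ 0 → ∀ s', AgreeOn (Iio h) univ s s' → Writes q h s' c' a)
    (hp' : v = 0 → ∀ s', AgreeOn (Iio h) univ s s' → Writes p' h s' c' b) :
    Writes (.seq p (.ite h q p')) h s (c + (v + 1 + c')) (if v ≠ 0 then a else b) := by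
  refine RunsTo.seq hp ?_
  rintro s' ⟨hs', rfl⟩
  refine RunsTo.ite (fun hv => ?_) fun hv => ?_
  · rw [if_pos hv]
    exact RunsTo.mono (hq hv s' hs') le_rfl fun s'' hs'' => ⟨hs'.trans hs''.1, hs''.2⟩
  · rw [if_neg (not_not.2 hv)]
    exact RunsTo.mono (hp' hv s' hs') le_rfl fun s'' hs'' => ⟨hs'.trans hs''.1, hs''.2⟩

end Writes

/-- The invariant of `sumLoop` after the values `f 0, …, f (i - 1)` have been added, with `j` rounds
left. -/
structure SumInvariant (h : ℕ) (f : ℕ → ℕ) (s : State) (i j : ℕ) (s' : State) : Prop where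
  agree : AgreeOn (Iio h) univ s s'
  counter : s'.reg h = j
  total : s'.reg (h + 1) = ∑ a ∈ Finset.range i, f a
  index : s'.reg (h + 2) = i
  one : s'.reg (h + 3) = 1

theorem SumInvariant.step {q : Prog} {h c i j N S V : ℕ} {f : ℕ → ℕ} {s s' : State}
    (hs' : SumInvariant h f s i (j + 1) s') (hq : Writes q (h + 4) s' c (f i))
    (hi : i ≤ N) (hj : j < N) (hS : ∑ a ∈ Finset.range i, f a ≤ S) (hV : f i ≤ V) :
    RunsTo (.seq q <| .seq (.add (h + 1) (h + 1) (h + 4)) <|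
        .seq (.add (h + 2) (h + 2) (h + 3)) (.sub h h (h + 3))) s'
      (c + (S + V + 2 + (N + 3 + (N + 3)))) (SumInvariant h f s (i + 1) j) := by
  refine RunsTo.seq hq fun s'' ⟨hs'', hv⟩ => ?_
  have hcounter := (hs''.reg h (by simp)).trans hs'.counter
  have htotal := (hs''.reg (h + 1) (by simp)).trans hs'.total
  have hindex := (hs''.reg (h + 2) (by simp)).trans hs'.index
  have hone := (hs''.reg (h + 3) (by simp)).trans hs'.one
  refine (RunsTo.add (by omega)).seq ?_
  rintro _ rfl
  refine (RunsTo.add (by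
    simp only [State.setReg_reg, Nat.add_left_cancel_iff, OfNat.ofNat_ne_one, ↓reduceIte]
    omega)).seq ?_
  rintro _ rfl
  refine (RunsTo.sub (by
    simp only [State.setReg_reg, Nat.add_left_cancel_iff, OfNat.ofNat_ne_one, ↓reduceIte,
      Nat.left_eq_add, OfNat.ofNat_ne_zero, one_ne_zero, Nat.succ_ne_self]
    omega)).mono le_rfl ?_
  rintro _ rfl
  refine ⟨?_, by simp [hcounter, hone], by simp [htotal, hv, Finset.sum_range_succ],
    by simp [hindex, hone], by simp [hone]⟩
  have hagree := hs'.agree.trans (hs''.mono (Iio_subset_Iio (by omega)) subset_rfl)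
  exact ((hagree.setReg (by simp) _).setReg (by simp) _).setReg (by simp) _

theorem Writes.sumLoop {p q : Prog} {h c c' n N V : ℕ} {f : ℕ → ℕ} {s : State}
    (hp : Writes p h s c n) (hn : n ≤ N) (hV : ∀ i < n, f i ≤ V)
    (hq : ∀ i < n, ∀ s', AgreeOn (Iio h) univ s s' → s'.reg (h + 2) = i →
      Writes q (h + 4) s' c' (f i)) :
    Writes (.seq p (QuadHard.sumLoop q h)) h s
      (c + (1 + (1 + (2 +
        ((N + 1) * (N + 1 + (c' + (N * V + V + 2 + (N + 3 + (N + 3))))) + (N * V + 2))))))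
      (∑ i ∈ Finset.range n, f i) := by
  have hsum : ∀ i ≤ n, ∑ a ∈ Finset.range i, f a ≤ N * V := fun i hi => by
    calc ∑ a ∈ Finset.range i, f a ≤ i * V := by
          simpa using Finset.sum_le_card_nsmul _ _ V fun a ha =>
            hV a ((Finset.mem_range.1 ha).trans_le hi)
      _ ≤ N * V := Nat.mul_le_mul_right V (hi.trans hn)
  refine RunsTo.seq hp fun s₁ ⟨h₁, hreg⟩ => ?_
  refine RunsTo.const.seq ?_
  rintro _ rfl
  refine RunsTo.const.seq ?_
  rintro _ rfl
  refine RunsTo.const.seq ?_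
  rintro _ rfl
  refine (RunsTo.loop (fun j s' => j ≤ n ∧ SumInvariant h f s (n - j) j s')
    (fun j s' hI => hI.2.counter) hn (fun j hj s' hI => ?_) ⟨le_rfl, ?_⟩).seq ?_
  · have hij : n - j = n - (j + 1) + 1 := by omega
    rw [hij]
    exact (hI.2.step (hq _ (by omega) s' hI.2.agree hI.2.index) (N := N) (by omega) (by omega)
      (hsum _ (by omega)) (hV _ (by omega))).mono le_rfl fun s'' hs'' => ⟨hj.le, hs''⟩
  · exact ⟨((h₁.setReg (by simp) _).setReg (by simp) _).setReg (by simp) _, by simp [hreg],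
      by simp, by simp, by simp⟩
  · rintro s' ⟨-, hs'⟩
    have htotal : s'.reg (h + 1) = ∑ i ∈ Finset.range n, f i := hs'.total
    refine (RunsTo.add ?_).mono le_rfl ?_
    · have := hsum n le_rfl
      have := hs'.counter
      omega
    · rintro _ rfl
      exact ⟨hs'.agree.setReg (by simp) _, by simp [hs'.counter, htotal]⟩

/-- The array `x` and the values `σ` of the variables are bounded by `B`. -/
def BoundedBy (B : ℕ) (x σ : ℕ → ℕ) : Prop :=
  (∀ i, x i ≤ B) ∧ ∀ v, σ v ≤ B

theorem BoundedBy.mono {B B' : ℕ} {x σ : ℕ → ℕ} (hB : BoundedBy B x σ) (h : B ≤ B') :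
    BoundedBy B' x σ :=
  ⟨fun i => (hB.1 i).trans h, fun v => (hB.2 v).trans h⟩

theorem BoundedBy.update {B b i : ℕ} {x σ : ℕ → ℕ} (hB : BoundedBy B x σ) (hi : i ≤ b) (v : ℕ) :
    BoundedBy (B + b) x (Function.update σ v i) := by
  refine ⟨(hB.mono (Nat.le_add_right B b)).1, fun w => ?_⟩
  have := hB.2 w
  rw [Function.update_apply]
  split_ifs <;> omega

/-- Bank `0` holds the array `x`, and register `ρ v` holds the value `σ v` of the variable `v`. -/
structure Loaded (x σ ρ : ℕ → ℕ) (s : State) : Prop where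
  reg : ∀ v, s.reg (ρ v) = σ v
  mem : s.mem 0 = x

theorem Loaded.of_agreeOn {x σ ρ : ℕ → ℕ} {R M : Set ℕ} {s s' : State} (hs : Loaded x σ ρ s)
    (h : AgreeOn R M s s') (hR : ∀ v, ρ v ∈ R) (hM : 0 ∈ M) : Loaded x σ ρ s' :=
  ⟨fun v => (h.reg _ (hR v)).trans (hs.reg v), (h.mem 0 hM).trans hs.mem⟩

theorem Loaded.update {x σ ρ : ℕ → ℕ} {s : State} {r i : ℕ} (hs : Loaded x σ ρ s)
    (hr : s.reg r = i) (v : ℕ) :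
    Loaded x (Function.update σ v i) (Function.update ρ v r) s := by
  refine ⟨fun w => ?_, hs.mem⟩
  simp only [Function.update_apply]
  split_ifs
  exacts [hr, hs.reg w]

theorem update_mem {ρ : ℕ → ℕ} {R R' : Set ℕ} {r : ℕ} (hρ : ∀ v, ρ v ∈ R) (hR : R ⊆ R')
    (hr : r ∈ R') (v w : ℕ) : Function.update ρ v r w ∈ R' := by
  rw [Function.update_apply]
  split_ifs
  exacts [hr, hR (hρ w)]

/-- Arithmetic terms over an input array. Every term has an evaluator of polynomial running time, so
that functions given by terms need no programming. -/
inductive ArithTerm where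
  | var (v : ℕ) : ArithTerm
  | const (c : ℕ) : ArithTerm
  /-- the entry of the array at the position given by `t` -/
  | get (t : ArithTerm) : ArithTerm
  | add (a b : ArithTerm) : ArithTerm
  /-- truncated subtraction -/
  | sub (a b : ArithTerm) : ArithTerm
  /-- `a` if `c ≠ 0`, and `b` otherwise -/
  | ite (c a b : ArithTerm) : ArithTerm
  /-- the sum of `t` over all values of the variable `v` below `b` -/
  | sum (v : ℕ) (b t : ArithTerm) : ArithTerm

namespace ArithTerm

/-- The value of a term for the array `x` and the values `σ` of the variables. -/
def eval (x : ℕ → ℕ) : ArithTerm → (ℕ → ℕ) → ℕ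
  | var v, σ => σ v
  | const c, _ => c
  | get t, σ => x (t.eval x σ)
  | add a b, σ => a.eval x σ + b.eval x σ
  | sub a b, σ => a.eval x σ - b.eval x σ
  | ite c a b, σ => if c.eval x σ ≠ 0 then a.eval x σ else b.eval x σ
  | sum v b t, σ => ∑ i ∈ Finset.range (b.eval x σ), t.eval x (Function.update σ v i)

/-- The program that writes the value of a term into register `h`. The variables are held by the
registers `ρ v < h`, the array by bank `0`; the registers from `h` on serve as scratch space. -/
def compile : ArithTerm → (ℕ → ℕ) → ℕ → Prog
  | var v, ρ, h => .seq (.const h 0) (.add h h (ρ v))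
  | const c, _, h => .const h c
  | get t, ρ, h => .seq (t.compile ρ h) (.load h 0 h)
  | add a b, ρ, h => .seq (.seq (a.compile ρ h) (b.compile ρ (h + 1))) (.add h h (h + 1))
  | sub a b, ρ, h => .seq (.seq (a.compile ρ h) (b.compile ρ (h + 1))) (.sub h h (h + 1))
  | ite c a b, ρ, h => .seq (c.compile ρ h) (.ite h (a.compile ρ h) (b.compile ρ h))
  | sum v b t, ρ, h =>
    .seq (b.compile ρ h) (sumLoop (t.compile (Function.update ρ v (h + 2)) (h + 4)) h)

theorem exists_eval_le (t : ArithTerm) :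
    ∃ V : ℕ[X], ∀ B x σ, BoundedBy B x σ → t.eval x σ ≤ V.eval B := by
  induction t with
  | var v => exact ⟨X, fun B x σ hB => by simpa [eval] using hB.2 v⟩
  | const c => exact ⟨C c, fun B x σ _ => by simp [eval]⟩
  | get t _ => exact ⟨X, fun B x σ hB => by simpa [eval] using hB.1 _⟩
  | add a b iha ihb =>
    obtain ⟨⟨V, hV⟩, ⟨W, hW⟩⟩ := And.intro iha ihb
    exact ⟨V + W, fun B x σ hB => by
      simpa [eval] using add_le_add (hV B x σ hB) (hW B x σ hB)⟩
  | sub a b iha _ =>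
    obtain ⟨V, hV⟩ := iha
    exact ⟨V, fun B x σ hB => (Nat.sub_le _ _).trans (hV B x σ hB)⟩
  | ite c a b _ iha ihb =>
    obtain ⟨⟨V, hV⟩, ⟨W, hW⟩⟩ := And.intro iha ihb
    refine ⟨V + W, fun B x σ hB => ?_⟩
    have := hV B x σ hB
    have := hW B x σ hB
    simp only [eval, eval_add]
    split_ifs <;> omega
  | sum v b t ihb iht =>
    obtain ⟨⟨V, hV⟩, ⟨W, hW⟩⟩ := And.intro ihb iht
    refine ⟨V * W.comp (X + V), fun B x σ hB => ?_⟩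
    have hn := hV B x σ hB
    calc (sum v b t).eval x σ ≤ b.eval x σ * W.eval (B + V.eval B) := by
          simpa [eval] using Finset.sum_le_card_nsmul _ _ _ fun i hi =>
            hW _ x _ (hB.update ((Finset.mem_range.1 hi).le.trans hn) v)
      _ ≤ V.eval B * W.eval (B + V.eval B) := Nat.mul_le_mul_right _ hn
      _ = (V * W.comp (X + V)).eval B := by simp

/-- The polynomial `P` bounds the cost of evaluating the term `t`. -/
def HasCost (t : ArithTerm) (P : ℕ[X]) : Prop :=
  ∀ ⦃B x σ⦄, BoundedBy B x σ → ∀ ⦃ρ h s⦄, (∀ v, ρ v ∈ Iio h) → Loaded x σ ρ s →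
    Writes (t.compile ρ h) h s (P.eval B) (t.eval x σ)

section HasCost

variable {a b c t : ArithTerm} {P Q R V W : ℕ[X]}

theorem HasCost.get (ht : t.HasCost P) (hV : ∀ B x σ, BoundedBy B x σ → t.eval x σ ≤ V.eval B) :
    (get t).HasCost (P + (V + X + 2)) := by
  intro B x σ hB ρ h s hρ hs
  have := (ht hB hρ hs).load (b := B) (by rw [hs.mem]; exact hB.1 _)
  rw [hs.mem] at this
  exact this.mono (by simpa using hV B x σ hB)

theorem HasCost.add (ha : a.HasCost P) (hb : b.HasCost Q)
    (hV : ∀ B x σ, BoundedBy B x σ → a.eval x σ ≤ V.eval B)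
    (hW : ∀ B x σ, BoundedBy B x σ → b.eval x σ ≤ W.eval B) :
    (add a b).HasCost (P + Q + (V + W + 2)) := by
  intro B x σ hB ρ h s hρ hs
  refine ((ha hB hρ hs).add fun s' hs' => hb hB (fun v => (hρ v).trans h.lt_succ_self)
    (hs.of_agreeOn hs' hρ (mem_univ 0))).mono ?_
  simpa using add_le_add (hV B x σ hB) (hW B x σ hB)

theorem HasCost.sub (ha : a.HasCost P) (hb : b.HasCost Q)
    (hV : ∀ B x σ, BoundedBy B x σ → a.eval x σ ≤ V.eval B)
    (hW : ∀ B x σ, BoundedBy B x σ → b.eval x σ ≤ W.eval B) :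
    (sub a b).HasCost (P + Q + (V + W + 2)) := by
  intro B x σ hB ρ h s hρ hs
  refine ((ha hB hρ hs).sub fun s' hs' => hb hB (fun v => (hρ v).trans h.lt_succ_self)
    (hs.of_agreeOn hs' hρ (mem_univ 0))).mono ?_
  simpa using add_le_add (hV B x σ hB) (hW B x σ hB)

theorem HasCost.ite (hc : c.HasCost P) (ha : a.HasCost Q) (hb : b.HasCost R)
    (hV : ∀ B x σ, BoundedBy B x σ → c.eval x σ ≤ V.eval B) :
    (ite c a b).HasCost (P + (V + 1 + (Q + R))) := by
  intro B x σ hB ρ h s hρ hs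
  refine (Writes.ite (c' := Q.eval B + R.eval B) (hc hB hρ hs) (fun _ s' hs' => ?_)
    fun _ s' hs' => ?_).mono (by simpa using hV B x σ hB)
  · exact (ha hB hρ (hs.of_agreeOn hs' hρ (mem_univ 0))).mono (Nat.le_add_right _ _)
  · exact (hb hB hρ (hs.of_agreeOn hs' hρ (mem_univ 0))).mono (Nat.le_add_left _ _)

theorem HasCost.sum (hb : b.HasCost P) (ht : t.HasCost Q)
    (hV : ∀ B x σ, BoundedBy B x σ → b.eval x σ ≤ V.eval B)
    (hW : ∀ B x σ, BoundedBy B x σ → t.eval x σ ≤ W.eval B) (v : ℕ) :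
    (sum v b t).HasCost (P + (1 + (1 + (2 +
      ((V + 1) * (V + 1 + (Q.comp (X + V) +
        (V * W.comp (X + V) + W.comp (X + V) + 2 + (V + 3 + (V + 3))))) +
        (V * W.comp (X + V) + 2)))))) := by
  intro B x σ hB ρ h s hρ hs
  have hn := hV B x σ hB
  have hB' : ∀ i < b.eval x σ, BoundedBy (B + V.eval B) x (Function.update σ v i) :=
    fun i hi => hB.update (hi.le.trans hn) v
  refine (Writes.sumLoop (c' := Q.eval (B + V.eval B)) (hb hB hρ hs) hn
    (fun i hi => hW _ x _ (hB' i hi)) fun i hi s' hs' hi' => ?_).mono (le_of_eq (by simp))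
  exact ht (hB' i hi) (update_mem hρ (Iio_subset_Iio (by omega)) (by simp) v)
    ((hs.of_agreeOn hs' hρ (mem_univ 0)).update hi' v)

end HasCost

theorem exists_hasCost (t : ArithTerm) : ∃ P : ℕ[X], t.HasCost P := by
  induction t with
  | var v =>
    refine ⟨X + 3, fun B x σ hB ρ h s hρ hs => ?_⟩
    have := (Writes.copy (s := s) (hρ v)).mono (c' := (X + 3 : ℕ[X]).eval B)
      (by simpa [hs.reg v] using hB.2 v)
    rwa [hs.reg v] at this
  | const c =>
    exact ⟨C (c + 1), fun B x σ _ ρ h s _ _ => (Writes.const s h c).mono (by simp)⟩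
  | get t ih =>
    obtain ⟨⟨P, hP⟩, ⟨V, hV⟩⟩ := And.intro ih t.exists_eval_le
    exact ⟨_, hP.get hV⟩
  | add a b iha ihb =>
    obtain ⟨⟨P, hP⟩, ⟨V, hV⟩⟩ := And.intro iha a.exists_eval_le
    obtain ⟨⟨Q, hQ⟩, ⟨W, hW⟩⟩ := And.intro ihb b.exists_eval_le
    exact ⟨_, hP.add hQ hV hW⟩
  | sub a b iha ihb =>
    obtain ⟨⟨P, hP⟩, ⟨V, hV⟩⟩ := And.intro iha a.exists_eval_le
    obtain ⟨⟨Q, hQ⟩, ⟨W, hW⟩⟩ := And.intro ihb b.exists_eval_le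
    exact ⟨_, hP.sub hQ hV hW⟩
  | ite c a b ihc iha ihb =>
    obtain ⟨⟨P, hP⟩, ⟨V, hV⟩⟩ := And.intro ihc c.exists_eval_le
    obtain ⟨⟨Q, hQ⟩, ⟨R, hR⟩⟩ := And.intro iha ihb
    exact ⟨_, hP.ite hQ hR hV⟩
  | sum v b t ihb iht =>
    obtain ⟨⟨P, hP⟩, ⟨V, hV⟩⟩ := And.intro ihb b.exists_eval_le
    obtain ⟨⟨Q, hQ⟩, ⟨W, hW⟩⟩ := And.intro iht t.exists_eval_le
    exact ⟨_, hP.sum hQ hV hW v⟩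

end ArithTerm

/-! ## Printing lists -/

/-- Bank `o` and register `q` hold the list `l` and its length. -/
def Holds (o q : ℕ) (l : List ℕ) (s : State) : Prop :=
  (∀ i, s.mem o i = l.getD i 0) ∧ s.reg q = l.length

theorem Holds.of_agreeOn {o q : ℕ} {l : List ℕ} {R M : Set ℕ} {s s' : State} (hs : Holds o q l s)
    (h : AgreeOn R M s s') (hq : q ∈ R) (ho : o ∈ M) : Holds o q l s' :=
  ⟨by rw [h.mem o ho]; exact hs.1, (h.reg q hq).trans hs.2⟩

theorem getD_append_singleton (l : List ℕ) (v i : ℕ) :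
    (l ++ [v]).getD i 0 = if i = l.length then v else l.getD i 0 := by
  rcases lt_trichotomy i l.length with h | h | h
  · rw [List.getD_append _ _ _ _ h, if_neg h.ne]
  · subst h; simp
  · rw [if_neg h.ne', List.getD_eq_default _ _ (by simp; omega), List.getD_eq_default _ _ h.le]

/-- Started in `s`, the program `p` turns the list `acc` in bank `o`, whose length is held by
register `q`, into `acc ++ l` at cost at most `c`; the other registers below `h`, the other banks,
and the random bits are left as they are. -/
def Appends (p : Prog) (o q h : ℕ) (s : State) (c : ℕ) (acc l : List ℕ) : Prop :=
  RunsTo p s c fun s' => AgreeOn (Iio h \ {q}) {o}ᶜ s s' ∧ Holds o q (acc ++ l) s'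

/-- Repeats `p` with register `h + 1` running through `0, …, reg h - 1`. -/
def repeatLoop (p : Prog) (h : ℕ) : Prog :=
  .seq (.const (h + 1) 0) <|
    .loop h <| .seq p <| .seq (.const (h + 2) 1) <|
      .seq (.add (h + 1) (h + 1) (h + 2)) (.sub h h (h + 2))

namespace Appends

variable {p p' : Prog} {o q h c c' : ℕ} {s : State} {acc l l' : List ℕ}

theorem mono (hp : Appends p o q h s c acc l) (hc : c ≤ c') : Appends p o q h s c' acc l :=
  RunsTo.mono hp hc fun _ => id

theorem emit {v : ℕ} (hp : Writes p h s c v) (hq : q < h) (hs : Holds o q acc s) :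
    Appends (.seq p <| .seq (.store o q h) <| .seq (.const h 1) (.add q q h)) o q h s
      (c + (acc.length + v + 2 + (2 + (acc.length + 3)))) acc [v] := by
  refine RunsTo.seq hp ?_
  rintro s₁ ⟨hs₁, rfl⟩
  obtain ⟨hmem, hlen⟩ := hs.of_agreeOn hs₁ hq (mem_univ o)
  refine (RunsTo.store (by omega)).seq ?_
  rintro _ rfl
  refine RunsTo.const.seq ?_
  rintro _ rfl
  refine (RunsTo.add (by simp [hq.ne, hlen])).mono le_rfl ?_
  rintro _ rfl
  have hagree := hs₁.mono (R' := Iio h \ {q}) (M' := {o}ᶜ) sdiff_subset (subset_univ _)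
  refine ⟨((hagree.setMem (by simp) _ _).setReg (by simp) _).setReg (by simp) _, fun i => ?_, ?_⟩
  · rw [getD_append_singleton]
    simp [Function.update_apply, hlen, hmem]
  · simp [hq.ne, hlen]

theorem seq (hp : Appends p o q h s c acc l)
    (hp' : ∀ s', AgreeOn (Iio h \ {q}) {o}ᶜ s s' → Holds o q (acc ++ l) s' →
      Appends p' o q h s' c' (acc ++ l) l') :
    Appends (.seq p p') o q h s (c + c') acc (l ++ l') := by
  refine RunsTo.seq hp fun s₁ ⟨h₁, hl⟩ => RunsTo.mono (hp' s₁ h₁ hl) le_rfl ?_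
  rintro s₂ ⟨h₂, hl'⟩
  exact ⟨h₁.trans h₂, by rwa [← List.append_assoc]⟩

end Appends

/-- The invariant of `repeatLoop` after the lists `f 0, …, f (i - 1)` have been printed, with `j`
rounds left. -/
structure RepeatInvariant (o q h : ℕ) (acc : List ℕ) (f : ℕ → List ℕ) (s : State) (i j : ℕ)
    (s' : State) : Prop where
  agree : AgreeOn (Iio h \ {q}) {o}ᶜ s s'
  counter : s'.reg h = j
  index : s'.reg (h + 1) = i
  holds : Holds o q (acc ++ (List.range i).flatMap f) s'

theorem RepeatInvariant.step {p : Prog} {o q h c i j N : ℕ} {acc : List ℕ} {f : ℕ → List ℕ}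
    {s s' : State} (hs' : RepeatInvariant o q h acc f s i (j + 1) s') (hq : q < h)
    (hp : Appends p o q (h + 2) s' c (acc ++ (List.range i).flatMap f) (f i))
    (hi : i ≤ N) (hj : j < N) :
    RunsTo (.seq p <| .seq (.const (h + 2) 1) <|
        .seq (.add (h + 1) (h + 1) (h + 2)) (.sub h h (h + 2))) s'
      (c + (2 + (N + 3 + (N + 3)))) (RepeatInvariant o q h acc f s (i + 1) j) := by
  refine RunsTo.seq hp fun s'' ⟨hs'', hl⟩ => ?_
  have hcounter := (hs''.reg h ⟨by simp, hq.ne'⟩).trans hs'.counter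
  have hindex := (hs''.reg (h + 1) ⟨by simp, (hq.trans h.lt_succ_self).ne'⟩).trans hs'.index
  refine RunsTo.const.seq ?_
  rintro _ rfl
  refine (RunsTo.add (by
    simp only [State.setReg_reg, Nat.add_left_cancel_iff, OfNat.one_ne_ofNat, ↓reduceIte]
    omega)).seq ?_
  rintro _ rfl
  refine (RunsTo.sub (by
    simp only [State.setReg_reg, Nat.add_left_cancel_iff, OfNat.one_ne_ofNat, ↓reduceIte,
      Nat.left_eq_add, one_ne_zero, OfNat.ofNat_ne_zero, OfNat.ofNat_ne_one]
    omega)).mono le_rfl ?_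
  rintro _ rfl
  have hagree := hs'.agree.trans (hs''.mono
    (sdiff_subset_sdiff_left (Iio_subset_Iio (by omega : h ≤ h + 2))) subset_rfl)
  refine ⟨((hagree.setReg (by simp) _).setReg (by simp) _).setReg (by simp) _, by simp [hcounter],
    by simp [hindex], ?_⟩
  have hq₁ : q ≠ h + 1 := by omega
  have hq₂ : q ≠ h + 2 := by omega
  rw [List.range_succ, List.flatMap_append, List.flatMap_singleton, ← List.append_assoc]
  exact ⟨hl.1, by simpa [hq.ne, hq₁, hq₂] using hl.2⟩

theorem Appends.repeatLoop {p p' : Prog} {o q h c c' n N : ℕ} {acc : List ℕ} {f : ℕ → List ℕ}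
    {s : State} (hp : Writes p h s c n) (hn : n ≤ N) (hq : q < h) (hs : Holds o q acc s)
    (hp' : ∀ i < n, ∀ s', AgreeOn (Iio h \ {q}) {o}ᶜ s s' → s'.reg (h + 1) = i →
      Holds o q (acc ++ (List.range i).flatMap f) s' →
      Appends p' o q (h + 2) s' c' (acc ++ (List.range i).flatMap f) (f i)) :
    Appends (.seq p (QuadHard.repeatLoop p' h)) o q h s
      (c + (1 + (N + 1) * (N + 1 + (c' + (2 + (N + 3 + (N + 3)))))))
      acc ((List.range n).flatMap f) := by
  refine RunsTo.seq hp fun s₁ ⟨h₁, hreg⟩ => ?_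
  refine RunsTo.const.seq ?_
  rintro _ rfl
  refine (RunsTo.loop (fun j s' => j ≤ n ∧ RepeatInvariant o q h acc f s (n - j) j s')
    (fun j s' hI => hI.2.counter) hn (fun j hj s' hI => ?_) ⟨le_rfl, ?_⟩).mono le_rfl
    fun s' hs' => ⟨hs'.2.agree, hs'.2.holds⟩
  · have hij : n - j = n - (j + 1) + 1 := by omega
    rw [hij]
    exact (hI.2.step hq (hp' _ (by omega) s' hI.2.agree hI.2.index hI.2.holds) (N := N)
      (by omega) (by omega)).mono le_rfl fun s'' hs'' => ⟨hj.le, hs''⟩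
  · have hagree := h₁.setReg (r := h + 1) (by simp) 0
    exact ⟨hagree.mono sdiff_subset (subset_univ _), by simp [hreg], by simp,
      by simpa using hs.of_agreeOn hagree hq (mem_univ o)⟩

/-- Descriptions of lists that are printed from a given array; like arithmetic terms, they are
executed in polynomial time. -/
inductive Printer where
  /-- the value of the term `t` -/
  | emit (t : ArithTerm) : Printer
  | seq (a b : Printer) : Printer
  /-- `e` for all values of the variable `v` below `b`, one after the other -/
  | rep (v : ℕ) (b : ArithTerm) (e : Printer) : Printer

namespace Printer

/-- The printed list for the array `x` and the values `σ` of the variables. -/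
def out (x : ℕ → ℕ) : Printer → (ℕ → ℕ) → List ℕ
  | emit t, σ => [t.eval x σ]
  | seq a b, σ => a.out x σ ++ b.out x σ
  | rep v b e, σ => (List.range (b.eval x σ)).flatMap fun i => e.out x (Function.update σ v i)

/-- The program that appends the printed list to the list in bank `o` whose length is held by
register `q`; the other conventions are those of `ArithTerm.compile`. -/
def compile (o q : ℕ) : Printer → (ℕ → ℕ) → ℕ → Prog
  | emit t, ρ, h =>
    .seq (t.compile ρ h) <| .seq (.store o q h) <| .seq (.const h 1) (.add q q h)
  | seq a b, ρ, h => .seq (a.compile o q ρ h) (b.compile o q ρ h)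
  | rep v b e, ρ, h =>
    .seq (b.compile ρ h) (repeatLoop (e.compile o q (Function.update ρ v (h + 1)) (h + 2)) h)

theorem exists_mem_out_le (e : Printer) :
    ∃ V : ℕ[X], ∀ B x σ, BoundedBy B x σ → ∀ y ∈ e.out x σ, y ≤ V.eval B := by
  induction e with
  | emit t =>
    obtain ⟨V, hV⟩ := t.exists_eval_le
    exact ⟨V, fun B x σ hB => by simpa [out] using hV B x σ hB⟩
  | seq a b iha ihb =>
    obtain ⟨⟨V, hV⟩, ⟨W, hW⟩⟩ := And.intro iha ihb
    refine ⟨V + W, fun B x σ hB y hy => ?_⟩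
    rw [eval_add]
    rcases List.mem_append.1 hy with hy | hy
    · exact (hV B x σ hB y hy).trans (Nat.le_add_right _ _)
    · exact (hW B x σ hB y hy).trans (Nat.le_add_left _ _)
  | rep v b e ih =>
    obtain ⟨⟨V, hV⟩, ⟨W, hW⟩⟩ := And.intro b.exists_eval_le ih
    refine ⟨W.comp (X + V), fun B x σ hB y hy => ?_⟩
    obtain ⟨i, hi, hy⟩ := List.mem_flatMap.1 hy
    simpa using hW _ x _ (hB.update ((List.mem_range.1 hi).le.trans (hV B x σ hB)) v) y hy

theorem length_flatMap_range_le {f : ℕ → List ℕ} {n N K : ℕ} (hn : n ≤ N)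
    (hf : ∀ i < n, (f i).length ≤ K) : ((List.range n).flatMap f).length ≤ N * K := by
  rw [List.length_flatMap]
  calc ((List.range n).map fun i => (f i).length).sum ≤ n * K := by
        simpa using List.sum_le_card_nsmul ((List.range n).map fun i => (f i).length) K
          (by simpa using hf)
    _ ≤ N * K := Nat.mul_le_mul_right K hn

theorem exists_length_out_le (e : Printer) :
    ∃ L : ℕ[X], ∀ B x σ, BoundedBy B x σ → (e.out x σ).length ≤ L.eval B := by
  induction e with
  | emit t => exact ⟨1, fun B x σ _ => by simp [out]⟩
  | seq a b iha ihb =>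
    obtain ⟨⟨K, hK⟩, ⟨L, hL⟩⟩ := And.intro iha ihb
    exact ⟨K + L, fun B x σ hB => by simpa [out] using add_le_add (hK B x σ hB) (hL B x σ hB)⟩
  | rep v b e ih =>
    obtain ⟨⟨V, hV⟩, ⟨L, hL⟩⟩ := And.intro b.exists_eval_le ih
    refine ⟨V * L.comp (X + V), fun B x σ hB => ?_⟩
    have hn := hV B x σ hB
    exact (length_flatMap_range_le hn fun i hi => hL _ x _ (hB.update (hi.le.trans hn) v)).trans
      (by simp)

/-- The polynomial `P` bounds the cost of executing the printer `e` in the values of the variables,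
the entries of the array, and the length of the list to which the printed list is appended. -/
def HasCost (e : Printer) (P : ℕ[X]) : Prop :=
  ∀ ⦃B x σ⦄, BoundedBy B x σ → ∀ ⦃o q ρ h s acc⦄, o ≠ 0 → q < h → (∀ v, ρ v ∈ Iio h \ {q}) →
    Loaded x σ ρ s → Holds o q acc s → acc.length ≤ B →
    Appends (e.compile o q ρ h) o q h s (P.eval B) acc (e.out x σ)

section HasCost

variable {t : ArithTerm} {a b e : Printer} {P Q L V : ℕ[X]}

theorem HasCost.emit (ht : t.HasCost P) (hV : ∀ B x σ, BoundedBy B x σ → t.eval x σ ≤ V.eval B) :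
    (emit t).HasCost (P + (X + V + 2 + (2 + (X + 3)))) := by
  intro B x σ hB o q ρ h s acc _ hq hρ hs hacc hlen
  refine (Appends.emit (ht hB (fun v => (hρ v).1) hs) hq hacc).mono ?_
  have := hV B x σ hB
  simp only [eval_add, eval_X, eval_ofNat]
  omega

theorem HasCost.seq (ha : a.HasCost P) (hb : b.HasCost Q)
    (hL : ∀ B x σ, BoundedBy B x σ → (a.out x σ).length ≤ L.eval B) :
    (seq a b).HasCost (P + Q.comp (X + L)) := by
  intro B x σ hB o q ρ h s acc ho hq hρ hs hacc hlen
  refine ((ha hB ho hq hρ hs hacc hlen).seq (c' := Q.eval (B + L.eval B))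
    fun s' hs' hacc' => ?_).mono (by simp)
  exact hb (hB.mono (Nat.le_add_right _ _)) ho hq hρ (hs.of_agreeOn hs' hρ ho.symm) hacc'
    (by simpa using add_le_add hlen (hL B x σ hB))

theorem HasCost.rep {b : ArithTerm} (hb : b.HasCost P) (he : e.HasCost Q)
    (hV : ∀ B x σ, BoundedBy B x σ → b.eval x σ ≤ V.eval B)
    (hL : ∀ B x σ, BoundedBy B x σ → (e.out x σ).length ≤ L.eval B) (v : ℕ) :
    (rep v b e).HasCost (P + (1 + (V + 1) * (V + 1 + (Q.comp (X + V + V * L.comp (X + V)) +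
      (2 + (V + 3 + (V + 3))))))) := by
  intro B x σ hB o q ρ h s acc ho hq hρ hs hacc hlen
  have hn := hV B x σ hB
  have hB' : ∀ i < b.eval x σ, BoundedBy (B + V.eval B) x (Function.update σ v i) :=
    fun i hi => hB.update (hi.le.trans hn) v
  refine (Appends.repeatLoop
    (c' := Q.eval (B + V.eval B + V.eval B * L.eval (B + V.eval B)))
    (hb hB (fun v => (hρ v).1) hs) hn hq hacc
    fun i hi s' hs' hi' hacc' => ?_).mono (le_of_eq (by simp))
  refine he ((hB' i hi).mono (Nat.le_add_right _ _)) ho (by omega) (update_mem hρ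
    (sdiff_subset_sdiff_left (Iio_subset_Iio (by omega))) ?_ v)
    ((hs.of_agreeOn hs' hρ ho.symm).update hi' v) hacc' ?_
  · exact ⟨by simp, by rw [mem_singleton_iff]; omega⟩
  · have := length_flatMap_range_le (hi.le.trans hn) fun j hj => hL _ x _ (hB' j (hj.trans hi))
    rw [List.length_append]
    omega

end HasCost

theorem exists_hasCost (e : Printer) : ∃ P : ℕ[X], e.HasCost P := by
  induction e with
  | emit t =>
    obtain ⟨⟨P, hP⟩, ⟨V, hV⟩⟩ := And.intro t.exists_hasCost t.exists_eval_le
    exact ⟨_, HasCost.emit hP hV⟩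
  | seq a b iha ihb =>
    obtain ⟨⟨P, hP⟩, ⟨Q, hQ⟩, ⟨L, hL⟩⟩ := And.intro iha (And.intro ihb a.exists_length_out_le)
    exact ⟨_, hP.seq hQ hL⟩
  | rep v b e ih =>
    obtain ⟨⟨P, hP⟩, ⟨V, hV⟩⟩ := And.intro b.exists_hasCost b.exists_eval_le
    obtain ⟨⟨Q, hQ⟩, ⟨L, hL⟩⟩ := And.intro ih e.exists_length_out_le
    exact ⟨_, HasCost.rep hP hQ hV hL v⟩

end Printer

/-! ## Running a given program as a subroutine -/

/-- The registers and banks that a program mentions are below this number. -/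
def Prog.bound : Prog → ℕ
  | .skip => 0
  | .const r _ => r + 1
  | .add r a b => r + a + b + 1
  | .sub r a b => r + a + b + 1
  | .load r a i => r + a + i + 1
  | .store a i b => a + i + b + 1
  | .flip r => r + 1
  | .seq p q => p.bound + q.bound
  | .ite r p q => r + 1 + p.bound + q.bound
  | .loop r p => r + 1 + p.bound

theorem State.setReg_reg_of_le {r R i : ℕ} (s : State) (v : ℕ) (hr : r < R) (hi : R ≤ i) :
    (s.setReg r v).reg i = s.reg i := by
  rw [setReg_reg, if_neg (by omega)]

theorem AgreeOn.setReg_setReg {R M : Set ℕ} {s s' : State} (h : AgreeOn R M s s') (r v : ℕ) :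
    AgreeOn R M (s.setReg r v) (s'.setReg r v) :=
  ⟨fun i hi => by simp [h.reg i hi], h.mem, h.coins⟩

theorem AgreeOn.setMem_setMem {R M : Set ℕ} {s s' : State} (h : AgreeOn R M s s') (a i v : ℕ) :
    AgreeOn R M (s.setMem a i v) (s'.setMem a i v) := by
  refine ⟨h.reg, fun b hb => ?_, h.coins⟩
  by_cases hba : b = a
  · subst hba
    simp [h.mem b hb]
  · simp [hba, h.mem b hb]

theorem Exec.exists_of_agreeOn {p : Prog} {s s₁ s' : State} {T R : ℕ} (h : Exec p s T s₁)
    (hR : p.bound ≤ R) (hs : AgreeOn (Iio R) (Iio R) s s') :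
    ∃ s₁', Exec p s' T s₁' ∧ AgreeOn (Iio R) (Iio R) s₁ s₁' ∧
      ∀ r, R ≤ r → s₁'.reg r = s'.reg r := by
  induction h generalizing s' with simp only [Prog.bound] at hR
  | skip s => exact ⟨s', .skip s', hs, fun _ _ => rfl⟩
  | const s r c =>
    exact ⟨_, .const s' r c, hs.setReg_setReg r c, fun _ => s'.setReg_reg_of_le _ (by omega)⟩
  | add s r a b =>
    rw [← hs.reg a (mem_Iio.2 (by omega)), ← hs.reg b (mem_Iio.2 (by omega))]
    exact ⟨_, .add s' r a b, hs.setReg_setReg r _, fun _ => s'.setReg_reg_of_le _ (by omega)⟩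
  | sub s r a b =>
    rw [← hs.reg a (mem_Iio.2 (by omega)), ← hs.reg b (mem_Iio.2 (by omega))]
    exact ⟨_, .sub s' r a b, hs.setReg_setReg r _, fun _ => s'.setReg_reg_of_le _ (by omega)⟩
  | load s r a i =>
    rw [← hs.reg i (mem_Iio.2 (by omega)), ← hs.mem a (mem_Iio.2 (by omega))]
    exact ⟨_, .load s' r a i, hs.setReg_setReg r _, fun _ => s'.setReg_reg_of_le _ (by omega)⟩
  | store s a i b =>
    rw [← hs.reg i (mem_Iio.2 (by omega)), ← hs.reg b (mem_Iio.2 (by omega))]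
    exact ⟨_, .store s' a i b, hs.setMem_setMem a _ _, fun _ _ => rfl⟩
  | flip s r =>
    rw [← hs.coins]
    exact ⟨_, .flip s' r, ⟨(hs.setReg_setReg r _).reg, hs.mem, rfl⟩,
      fun _ => s'.setReg_reg_of_le _ (by omega)⟩
  | seq _ _ ih₁ ih₂ =>
    obtain ⟨s₁', e₁, h₁, f₁⟩ := ih₁ (by omega) hs
    obtain ⟨s₂', e₂, h₂, f₂⟩ := ih₂ (by omega) h₁
    exact ⟨s₂', .seq e₁ e₂, h₂, fun r hr => (f₂ r hr).trans (f₁ r hr)⟩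
  | iteTrue h _ ih =>
    obtain ⟨s₁', e₁, h₁, f₁⟩ := ih (by omega) hs
    rw [← hs.reg _ (mem_Iio.2 (by omega))] at h ⊢
    exact ⟨s₁', .iteTrue h e₁, h₁, f₁⟩
  | iteFalse h _ ih =>
    obtain ⟨s₁', e₁, h₁, f₁⟩ := ih (by omega) hs
    rw [← hs.reg _ (mem_Iio.2 (by omega))] at h ⊢
    exact ⟨s₁', .iteFalse h e₁, h₁, f₁⟩
  | loopDone h =>
    rw [← hs.reg _ (mem_Iio.2 (by omega))] at h ⊢
    exact ⟨s', .loopDone h, hs, fun _ _ => rfl⟩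
  | loopStep h _ _ ih₁ ih₂ =>
    obtain ⟨s₁', e₁, h₁, f₁⟩ := ih₁ (by omega) hs
    obtain ⟨s₂', e₂, h₂, f₂⟩ := ih₂ hR h₁
    rw [← hs.reg _ (mem_Iio.2 (by omega))] at h ⊢
    exact ⟨s₂', .loopStep h e₁ e₂, h₂, fun r hr => (f₂ r hr).trans (f₁ r hr)⟩

/-- All numbers in the state have at most `b` binary digits. -/
structure SizeLE (b : ℕ) (s : State) : Prop where
  reg : ∀ r, (s.reg r).size ≤ b
  mem : ∀ a i, (s.mem a i).size ≤ b

theorem SizeLE.mono {b b' : ℕ} {s : State} (h : SizeLE b s) (hb : b ≤ b') : SizeLE b' s :=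
  ⟨fun r => (h.reg r).trans hb, fun a i => (h.mem a i).trans hb⟩

theorem SizeLE.setReg {b : ℕ} {s : State} (h : SizeLE b s) {r v : ℕ} (hv : v.size ≤ b) :
    SizeLE b (s.setReg r v) := by
  refine ⟨fun i => ?_, h.mem⟩
  rw [State.setReg_reg]
  split_ifs
  exacts [hv, h.reg i]

theorem SizeLE.setMem {b : ℕ} {s : State} (h : SizeLE b s) {a i v : ℕ} (hv : v.size ≤ b) :
    SizeLE b (s.setMem a i v) := by
  refine ⟨h.reg, fun c j => ?_⟩
  rw [State.setMem_mem]
  split_ifs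
  · rw [Function.update_apply]
    split_ifs
    exacts [hv, h.mem a j]
  · exact h.mem c j

theorem size_add_le {a c b : ℕ} (ha : a.size ≤ b) (hc : c.size ≤ b) : (a + c).size ≤ b + 1 := by
  rw [Nat.size_le] at *
  rw [pow_succ]
  omega

theorem Exec.sizeLE {p : Prog} {s s₁ : State} {T b : ℕ} (h : Exec p s T s₁) (hs : SizeLE b s) :
    SizeLE (b + T) s₁ := by
  induction h generalizing b with
  | skip | loopDone _ => exact hs.mono (Nat.le_add_right _ _)
  | const s r c => exact (hs.mono (Nat.le_add_right _ _)).setReg (by unfold logCost; omega)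
  | add s r a c =>
    exact (hs.mono (Nat.le_add_right _ _)).setReg
      ((size_add_le (hs.reg a) (hs.reg c)).trans (by unfold logCost; omega))
  | sub s r a c =>
    exact (hs.mono (Nat.le_add_right _ _)).setReg
      ((Nat.size_le_size (Nat.sub_le _ _)).trans ((hs.reg a).trans (Nat.le_add_right _ _)))
  | load s r a i =>
    exact (hs.mono (Nat.le_add_right _ _)).setReg ((hs.mem a _).trans (Nat.le_add_right _ _))
  | store s a i c =>
    exact (hs.mono (Nat.le_add_right _ _)).setMem ((hs.reg c).trans (Nat.le_add_right _ _))
  | flip s r =>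
    have hflip := (hs.mono (Nat.le_add_right b 1)).setReg (r := r) (v := (s.coins 0).toNat)
      (by cases s.coins 0 <;> simp)
    exact ⟨hflip.reg, hflip.mem⟩
  | seq _ _ ih₁ ih₂ => exact (ih₂ (ih₁ hs)).mono (by omega)
  | iteTrue _ _ ih | iteFalse _ _ ih => exact (ih hs).mono (by omega)
  | loopStep _ _ _ ih₁ ih₂ => exact (ih₂ (ih₁ hs)).mono (by omega)

/-! ## The sawtooth curve -/

/-- The trapezoid function `s`; it maps each of `[0, δ]` and `[1 - δ, 1]` onto `[0, 1]`. -/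
noncomputable def trapezoid (δ y : ℝ) : ℝ :=
  1 - δ⁻¹ * max 0 (δ - y) - δ⁻¹ * max 0 (y - (1 - δ))

/-- The two inverse branches of the trapezoid function. -/
def branch (δ : ℝ) (b : Bool) (t : ℝ) : ℝ := if b then 1 - δ * t else δ * t

/-- The number `y` is close to the truth value `b`. -/
def Near (δ : ℝ) (b : Bool) (y : ℝ) : Prop := if b then 1 - δ ≤ y else y ≤ δ

section Curve

variable {δ : ℝ}

theorem trapezoid_branch (h0 : 0 < δ) (h1 : δ < 1 / 2) (b : Bool) {t : ℝ} (ht : t ∈ Icc 0 1) :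
    trapezoid δ (branch δ b t) = t := by
  have ht1 : t ≤ 1 := ht.2
  cases b
  · have hleft : 0 ≤ δ - δ * t := by nlinarith
    have hright : δ * t - (1 - δ) ≤ 0 := by nlinarith
    simp only [branch, Bool.false_eq_true, if_false]
    rw [trapezoid, max_eq_right hleft, max_eq_left hright]
    field_simp
    ring
  · have hleft : δ - (1 - δ * t) ≤ 0 := by nlinarith
    have hright : 0 ≤ 1 - δ * t - (1 - δ) := by nlinarith
    simp only [branch, if_true]
    rw [trapezoid, max_eq_left hleft, max_eq_right hright]
    field_simp
    ring

theorem near_branch (h0 : 0 < δ) (b : Bool) {t : ℝ} (ht : t ≤ 1) : Near δ b (branch δ b t) := by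
  cases b <;> simp only [Near, branch, if_true, Bool.false_eq_true, if_false] <;> nlinarith

theorem exists_Icc_subset_image_branch (h0 : 0 < δ) (h1 : δ < 1) {a ε : ℝ} (ha : 0 ≤ a)
    (haε : a + ε ≤ 1) (b : Bool) :
    ∃ a', 0 ≤ a' ∧ a' + ε * δ ≤ 1 ∧ Icc a' (a' + ε * δ) ⊆ branch δ b '' Icc a (a + ε) := by
  cases b
  · refine ⟨δ * a, by positivity, by nlinarith, fun t ht => ⟨t / δ, ⟨?_, ?_⟩, ?_⟩⟩
    · rw [le_div_iff₀ h0]; linarith [ht.1]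
    · rw [div_le_iff₀ h0]; linarith [ht.2]
    · simp only [branch, Bool.false_eq_true, if_false]
      field_simp
  · refine ⟨1 - δ * (a + ε), by nlinarith, by nlinarith, fun t ht => ⟨(1 - t) / δ, ⟨?_, ?_⟩, ?_⟩⟩
    · rw [le_div_iff₀ h0]; linarith [ht.2]
    · rw [div_le_iff₀ h0]; linarith [ht.1]
    · simp only [branch, if_true]
      field_simp
      ring

theorem exists_Icc_forall_near (h0 : 0 < δ) (h1 : δ < 1 / 2) (N : ℕ) (z : ℕ → Bool) :
    ∃ a, 0 ≤ a ∧ a + δ ^ N ≤ 1 ∧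
      ∀ t ∈ Icc a (a + δ ^ N), ∀ i < N, Near δ (z i) ((trapezoid δ)^[i] t) := by
  induction N generalizing z with
  | zero => exact ⟨0, le_rfl, by simp, fun t _ i hi => absurd hi (Nat.not_lt_zero i)⟩
  | succ N ih =>
    obtain ⟨a, ha0, ha1, ha⟩ := ih fun i => z (i + 1)
    obtain ⟨a', ha0', ha1', hsub⟩ :=
      exists_Icc_subset_image_branch h0 (by linarith) ha0 ha1 (z 0)
    refine ⟨a', ha0', ha1', fun t ht i hi => ?_⟩
    obtain ⟨t', ht', rfl⟩ := hsub ht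
    rcases i with _ | i
    · exact near_branch h0 _ (ht'.2.trans ha1)
    · rw [Function.iterate_succ_apply,
        trapezoid_branch h0 h1 _ ⟨ha0.trans ht'.1, ht'.2.trans ha1⟩]
      exact ha t' ht' i (by omega)

end Curve

/-! ## The network of a formula -/

/-- The neuron of the clause layer's input that holds the literal `l`; the literals move along a
delay line of pairs of neurons, and `e₀` is the length of the part that all of them traverse. -/
def litNeuron (e₀ : ℕ) (l : Literal) : ℕ := l.code + (2 + 2 * e₀)

/-- Weights of the first layer: neurons `0` and `1` are the gates `σ(δ - y)` and `σ(y - (1 - δ))` of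
the trapezoid function, neurons `2` and `3` are copies of them. -/
noncomputable def firstWeight (i j : ℕ) : ℝ :=
  if j = 0 then if i = 0 ∨ i = 2 then -1 else if i = 1 ∨ i = 3 then 1 else 0 else 0

/-- Biases of the first layer. -/
noncomputable def firstBias (δ : ℝ) (i : ℕ) : ℝ :=
  if i = 0 ∨ i = 2 then δ else if i = 1 ∨ i = 3 then -(1 - δ) else 0

/-- Weights of the layers that iterate the trapezoid function `s`. Neurons `4` and `5` hold
`σ(2 s - 1)` and `σ(1 - 2 s)`; the coefficient `2 δ⁻¹` this takes is not among the admissible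
weights, whence the two copies of the gates. The other neurons are the delay line, which amplifies
by `δ⁻¹` in each layer. -/
noncomputable def curveWeight (δ : ℝ) (i j : ℕ) : ℝ :=
  if i = 0 ∨ i = 2 then if j < 2 then δ⁻¹ else 0
  else if i = 1 ∨ i = 3 then if j < 2 then -δ⁻¹ else 0
  else if i = 4 then if j < 4 then -δ⁻¹ else 0
  else if i = 5 then if j < 4 then δ⁻¹ else 0
  else if i = j + 2 then δ⁻¹ else 0

/-- Biases of the layers that iterate the trapezoid function. -/
noncomputable def curveBias (δ : ℝ) (i : ℕ) : ℝ :=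
  if i = 0 ∨ i = 2 then -(1 - δ) else if i = 1 ∨ i = 3 then δ
  else if i = 4 then 1 else if i = 5 then -1 else 0

/-- Weights of the layer that evaluates the clauses `cl 0, cl 1, …`. -/
noncomputable def clauseWeight (e₀ : ℕ) (cl : ℕ → Clause) (c j : ℕ) : ℝ :=
  if ∃ l ∈ cl c, litNeuron e₀ l = j then -1 else 0

/-- The last three layers: clauses, conjunction, output. The neuron of a clause is `0` if the clause
holds and `1` if all its literal neurons vanish. -/
noncomputable def clauseNet (W e₀ m : ℕ) (cl : ℕ → Clause) : Network W 1 :=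
  .cons (w := m) (Matrix.of fun c j => clauseWeight e₀ cl c j) (fun _ => 1) <|
    .cons (w := 1) (Matrix.of fun _ _ => -1) (fun _ => 1) <|
      .last (Matrix.of fun _ _ => 1) fun _ => 0

/-- `P` layers that iterate the trapezoid function, followed by `Φ`. -/
noncomputable def curveNet (δ : ℝ) {W : ℕ} (Φ : Network W 1) : ℕ → Network W 1
  | 0 => Φ
  | P + 1 => .cons (Matrix.of fun i j : Fin W => curveWeight δ i j)
      (fun i => curveBias δ i) (curveNet δ Φ P)

/-- The network of width `W` for the formula with the clauses `cl 0, …, cl (m - 1)` in the variables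
`x_1, …, x_N`. After `N + e₀` curve layers every literal has passed through at least `e₀` layers of
the delay line, so that a true literal has been amplified to at least `1`. -/
noncomputable def satNet (δ : ℝ) (d W N e₀ m : ℕ) (cl : ℕ → Clause) : Network d 1 :=
  .cons (Matrix.of fun (i : Fin W) (j : Fin d) => firstWeight i j) (fun i => firstBias δ i)
    (curveNet δ (clauseNet W e₀ m cl) (N + e₀))

/-- The input of neuron `i` of a curve layer, apart from the bias, when the neurons of the preceding
layer have the values `Z`. -/
noncomputable def curveInput (δ : ℝ) (Z : ℕ → ℝ) (i : ℕ) : ℝ :=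
  if i = 0 ∨ i = 2 then δ⁻¹ * (Z 0 + Z 1)
  else if i = 1 ∨ i = 3 then -δ⁻¹ * (Z 0 + Z 1)
  else if i = 4 then -δ⁻¹ * (Z 0 + Z 1 + Z 2 + Z 3)
  else if i = 5 then δ⁻¹ * (Z 0 + Z 1 + Z 2 + Z 3)
  else δ⁻¹ * Z (i - 2)

/-- The values of the neurons after the first layer and `ℓ` curve layers, if `x` is the first
coordinate of the input. -/
noncomputable def neuron (δ x : ℝ) : ℕ → ℕ → ℝ
  | 0, i => max 0 (firstWeight i 0 * x + firstBias δ i)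
  | ℓ + 1, i => max 0 (curveInput δ (neuron δ x ℓ) i + curveBias δ i)

/-- The function that the network of a formula realizes, as a function of the first coordinate, when
the neurons before the clause layer have the values `Z`. -/
noncomputable def clauseValue (W e₀ m : ℕ) (cl : ℕ → Clause) (Z : ℕ → ℝ) : ℝ :=
  max 0 (1 - ∑ c : Fin m, max 0 (1 + ∑ j : Fin W, clauseWeight e₀ cl c j * Z j))

section Realization

variable {δ : ℝ} {W e₀ m : ℕ} {cl : ℕ → Clause}

theorem neuron_nonneg (δ x : ℝ) (ℓ i : ℕ) : 0 ≤ neuron δ x ℓ i := by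
  cases ℓ <;> exact le_max_left _ _

theorem sum_fin_ite_lt_mul {a W : ℕ} (h : a ≤ W) (c : ℝ) (Z : ℕ → ℝ) :
    ∑ j : Fin W, (if (j : ℕ) < a then c else 0) * Z j = c * ∑ j ∈ Finset.range a, Z j := by
  rw [Fin.sum_univ_eq_sum_range (fun j => (if j < a then c else 0) * Z j),
    ← Finset.sum_subset (Finset.range_mono h), Finset.mul_sum]
  · exact Finset.sum_congr rfl fun j hj => by rw [if_pos (Finset.mem_range.1 hj)]
  · intro j _ hj
    rw [if_neg (by simpa using hj), zero_mul]

theorem sum_curveWeight_mul (δ : ℝ) (hW : 4 ≤ W) (Z : ℕ → ℝ) (i : Fin W) :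
    ∑ j : Fin W, curveWeight δ i j * Z j = curveInput δ Z i := by
  simp only [curveWeight, curveInput]
  split_ifs
  · rw [sum_fin_ite_lt_mul (by omega)]; simp [Finset.sum_range_succ]
  · rw [sum_fin_ite_lt_mul (by omega)]; simp [Finset.sum_range_succ]
  · rw [sum_fin_ite_lt_mul hW]; simp [Finset.sum_range_succ]
  · rw [sum_fin_ite_lt_mul hW]; simp [Finset.sum_range_succ]
  · rw [Finset.sum_eq_single ⟨i - 2, by omega⟩]
    · rw [if_pos (by dsimp only; omega)]
    · intro j _ hj
      rw [if_neg fun h => hj (Fin.ext (by dsimp only; omega)), zero_mul]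
    · exact fun h => absurd (Finset.mem_univ _) h

theorem realize_curveNet (hW : 4 ≤ W) (Φ : Network W 1) (x : ℝ) (P ℓ : ℕ) :
    (curveNet δ Φ P).realize (fun i => neuron δ x ℓ i) =
      Φ.realize fun i => neuron δ x (ℓ + P) i := by
  induction P generalizing ℓ with
  | zero => rfl
  | succ P ih =>
    have hlayer : (fun i : Fin W => max 0 (((Matrix.of fun i j : Fin W => curveWeight δ i j) *ᵥ
        (fun j : Fin W => neuron δ x ℓ j) + fun i : Fin W => curveBias δ i) i)) =
        fun i : Fin W => neuron δ x (ℓ + 1) i := by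
      funext i
      simp only [Pi.add_apply, Matrix.mulVec, dotProduct, Matrix.of_apply,
        sum_curveWeight_mul δ hW (neuron δ x ℓ), neuron]
    rw [curveNet, Network.realize, hlayer, ih, Nat.add_right_comm, Nat.add_assoc]

theorem realize_clauseNet (Z : ℕ → ℝ) :
    (clauseNet W e₀ m cl).realize (fun i => Z i) 0 = clauseValue W e₀ m cl Z := by
  simp only [clauseNet, Network.realize, clauseValue, Pi.add_apply, Matrix.mulVec, dotProduct,
    Matrix.of_apply, Finset.sum_neg_distrib, neg_mul, one_mul, add_zero, Finset.univ_unique,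
    Finset.sum_singleton, sub_eq_neg_add, add_comm (1 : ℝ)]

theorem realize_satNet {d N : ℕ} (hd : 0 < d) (hW : 4 ≤ W) (x : Fin d → ℝ) :
    (satNet δ d W N e₀ m cl).realize x 0 =
      clauseValue W e₀ m cl (neuron δ (x ⟨0, hd⟩) (N + e₀)) := by
  have hfirst : (fun i : Fin W => max 0 (((Matrix.of fun (i : Fin W) (j : Fin d) =>
      firstWeight i j) *ᵥ x + fun i : Fin W => firstBias δ i) i)) =
      fun i : Fin W => neuron δ (x ⟨0, hd⟩) 0 i := by
    funext i
    rw [Pi.add_apply, Matrix.mulVec, dotProduct, neuron, Finset.sum_eq_single ⟨0, hd⟩]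
    · rfl
    · intro j _ hj
      have hj0 : (j : ℕ) ≠ 0 := fun h => hj (Fin.ext h)
      simp [firstWeight, hj0]
    · exact fun h => absurd (Finset.mem_univ _) h
  rw [satNet, Network.realize, hfirst, realize_curveNet hW, zero_add, realize_clauseNet]

theorem clauseValue_mem_Icc (Z : ℕ → ℝ) : clauseValue W e₀ m cl Z ∈ Icc (0 : ℝ) 1 :=
  ⟨le_max_left _ _, max_le zero_le_one
    (sub_le_self _ (Finset.sum_nonneg fun _ _ => le_max_left _ _))⟩

theorem clauseValue_eq_zero {Z : ℕ → ℝ} {c : ℕ} (hc : c < m)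
    (hZ : ∀ l ∈ cl c, Z (litNeuron e₀ l) = 0) : clauseValue W e₀ m cl Z = 0 := by
  have hsum : ∑ j : Fin W, clauseWeight e₀ cl c j * Z j = 0 := by
    refine Finset.sum_eq_zero fun j _ => ?_
    rw [clauseWeight]
    split_ifs with h
    · obtain ⟨l, hl, hj⟩ := h
      rw [← hj, hZ l hl, mul_zero]
    · exact zero_mul _
  have hle := Finset.single_le_sum
    (f := fun c : Fin m => max 0 (1 + ∑ j : Fin W, clauseWeight e₀ cl c j * Z j))
    (fun _ _ => le_max_left _ _) (Finset.mem_univ ⟨c, hc⟩)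
  have hone : (1 : ℝ) ≤ max 0 (1 + ∑ j : Fin W, clauseWeight e₀ cl c j * Z j) :=
    le_max_of_le_right (by rw [hsum, add_zero])
  exact max_eq_left (sub_nonpos.2 (hone.trans hle))

theorem clauseValue_eq_one {Z : ℕ → ℝ} (h0 : ∀ j, 0 ≤ Z j)
    (hZ : ∀ c < m, ∃ l ∈ cl c, litNeuron e₀ l < W ∧ 1 ≤ Z (litNeuron e₀ l)) :
    clauseValue W e₀ m cl Z = 1 := by
  rw [clauseValue, Finset.sum_eq_zero, sub_zero, max_eq_right zero_le_one]
  intro c _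
  obtain ⟨l, hl, hlW, hone⟩ := hZ c c.2
  have hnonpos : ∀ j ∈ Finset.univ.erase (⟨litNeuron e₀ l, hlW⟩ : Fin W),
      clauseWeight e₀ cl c j * Z j ≤ 0 := by
    intro j _
    rw [clauseWeight]
    split_ifs
    · linarith [h0 j]
    · rw [zero_mul]
  have hweight : clauseWeight e₀ cl c (litNeuron e₀ l) = -1 := if_pos ⟨l, hl, rfl⟩
  rw [← Finset.add_sum_erase _ _ (Finset.mem_univ (⟨litNeuron e₀ l, hlW⟩ : Fin W)), hweight]
  exact max_eq_left (by linarith [Finset.sum_nonpos hnonpos])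

end Realization

/-! ## The values of the neurons -/

/-- The output of the gate for a literal with sign `b` of a variable with value `y`. -/
noncomputable def literalGate (b : Bool) (y : ℝ) : ℝ := max 0 (if b then 2 * y - 1 else 1 - 2 * y)

section Neurons

variable {δ x : ℝ} {W N e₀ m : ℕ} {cl : ℕ → Clause}

theorem literalGate_eq_zero {b : Bool} {y : ℝ} (h : decide (1 / 2 < y) ≠ b) :
    literalGate b y = 0 := by
  refine max_eq_left ?_
  cases b
  · have hy : 1 / 2 < y := by simpa using h
    simp only [Bool.false_eq_true, if_false]
    linarith
  · have hy : y ≤ 1 / 2 := by simpa using h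
    simp only [if_true]
    linarith

theorem Near.le_literalGate {b : Bool} {y : ℝ} (h : Near δ b y) : 1 - 2 * δ ≤ literalGate b y := by
  refine le_max_of_le_right ?_
  cases b <;> simp only [Near, if_true, Bool.false_eq_true, if_false] at h ⊢ <;> linarith

theorem neuron_two (δ x : ℝ) (ℓ : ℕ) : neuron δ x ℓ 2 = neuron δ x ℓ 0 := by cases ℓ <;> rfl

theorem neuron_three (δ x : ℝ) (ℓ : ℕ) : neuron δ x ℓ 3 = neuron δ x ℓ 1 := by cases ℓ <;> rfl

theorem neuron_zero_and_one (δ x : ℝ) (ℓ : ℕ) :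
    neuron δ x ℓ 0 = max 0 (δ - (trapezoid δ)^[ℓ] x) ∧
      neuron δ x ℓ 1 = max 0 ((trapezoid δ)^[ℓ] x - (1 - δ)) := by
  induction ℓ with
  | zero =>
    constructor
    · simp [neuron, firstWeight, firstBias, sub_eq_neg_add]
    · simp [neuron, firstWeight, firstBias, sub_eq_add_neg]
  | succ ℓ ih =>
    rw [Function.iterate_succ_apply']
    constructor
    · simp only [neuron, curveInput, curveBias, true_or, if_true, ih.1, ih.2, trapezoid]
      congr 1
      ring
    · simp only [neuron, curveInput, curveBias, true_or, if_true, ih.1, ih.2, trapezoid,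
        one_ne_zero, OfNat.one_ne_ofNat, or_self, if_false]
      congr 1
      ring

theorem neuron_succ_four_and_five (δ x : ℝ) (ℓ : ℕ) :
    neuron δ x (ℓ + 1) 4 = literalGate true ((trapezoid δ)^[ℓ + 1] x) ∧
      neuron δ x (ℓ + 1) 5 = literalGate false ((trapezoid δ)^[ℓ + 1] x) := by
  obtain ⟨h0, h1⟩ := neuron_zero_and_one δ x ℓ
  rw [Function.iterate_succ_apply', trapezoid, ← h0, ← h1]
  constructor
  · simp only [neuron, curveInput, curveBias, literalGate, neuron_two, neuron_three,
      OfNat.ofNat_ne_zero, OfNat.ofNat_ne_one, Nat.reduceEqDiff, or_self, if_false, if_true]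
    congr 1
    ring
  · simp only [neuron, curveInput, curveBias, literalGate, neuron_two, neuron_three,
      OfNat.ofNat_ne_zero, OfNat.ofNat_ne_one, Nat.reduceEqDiff, or_self, if_false, if_true,
      Bool.false_eq_true]
    congr 1
    ring

theorem neuron_succ_add_two (h0 : 0 ≤ δ) (x : ℝ) (ℓ : ℕ) {i : ℕ} (hi : 4 ≤ i) :
    neuron δ x (ℓ + 1) (i + 2) = δ⁻¹ * neuron δ x ℓ i := by
  rw [neuron, curveInput, curveBias, if_neg (by omega), if_neg (by omega), if_neg (by omega),
    if_neg (by omega), if_neg (by omega), if_neg (by omega), if_neg (by omega), if_neg (by omega),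
    add_zero, Nat.add_sub_cancel]
  exact max_eq_right (mul_nonneg (inv_nonneg.2 h0) (neuron_nonneg _ _ _ _))

theorem neuron_add_delay (h0 : 0 ≤ δ) (x : ℝ) (ℓ : ℕ) {i : ℕ} (hi : 4 ≤ i) (a : ℕ) :
    neuron δ x (ℓ + a) (i + 2 * a) = δ⁻¹ ^ a * neuron δ x ℓ i := by
  induction a with
  | zero => simp
  | succ a ih =>
    rw [← add_assoc, Nat.mul_succ, ← add_assoc, neuron_succ_add_two h0 x _ (by omega), ih]
    ring

theorem neuron_litNeuron (h0 : 0 ≤ δ) (x : ℝ) {l : Literal} (hl : l.1 ∈ Icc 1 N) :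
    neuron δ x (N + e₀) (litNeuron e₀ l) =
      δ⁻¹ ^ (l.1 - 1 + e₀) * literalGate l.2 ((trapezoid δ)^[N + 1 - l.1] x) := by
  obtain ⟨v, b⟩ := l
  obtain ⟨hv1, hvN⟩ : 1 ≤ v ∧ v ≤ N := hl
  have hdelay : ∀ i, 4 ≤ i → neuron δ x (N + e₀) (i + 2 * (v - 1 + e₀)) =
      δ⁻¹ ^ (v - 1 + e₀) * neuron δ x (N - v + 1) i := fun i hi => by
    rw [← neuron_add_delay h0 x _ hi]
    congr 1
    omega
  rw [show N + 1 - v = N - v + 1 by omega]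
  cases b
  · have : litNeuron e₀ (v, false) = 5 + 2 * (v - 1 + e₀) := by
      simp only [litNeuron, Literal.code, Bool.false_eq_true, if_false]
      omega
    rw [this, hdelay 5 (by norm_num), (neuron_succ_four_and_five δ x _).2]
  · have : litNeuron e₀ (v, true) = 4 + 2 * (v - 1 + e₀) := by
      simp only [litNeuron, Literal.code, if_true]
      omega
    rw [this, hdelay 4 le_rfl, (neuron_succ_four_and_five δ x _).1]

theorem one_le_neuron_litNeuron (h0 : 0 < δ) (h1 : δ < 1 / 2) (he : 1 ≤ δ⁻¹ ^ e₀ * (1 - 2 * δ))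
    {l : Literal} (hl : l.1 ∈ Icc 1 N) (hx : Near δ l.2 ((trapezoid δ)^[N + 1 - l.1] x)) :
    1 ≤ neuron δ x (N + e₀) (litNeuron e₀ l) := by
  rw [neuron_litNeuron h0.le x hl]
  have hpow : δ⁻¹ ^ e₀ ≤ δ⁻¹ ^ (l.1 - 1 + e₀) :=
    pow_le_pow_right₀ ((one_le_inv₀ h0).2 (by linarith)) (Nat.le_add_left _ _)
  exact he.trans (mul_le_mul hpow hx.le_literalGate (by linarith) (by positivity))

theorem clauseValue_neuron_of_not_satisfiable (h0 : 0 ≤ δ)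
    (hcl : ∀ c < m, ∀ l ∈ cl c, l.1 ∈ Icc 1 N)
    (hun : ¬ CNF.Satisfiable ((Finset.range m).image cl)) (x : ℝ) :
    clauseValue W e₀ m cl (neuron δ x (N + e₀)) = 0 := by
  simp only [CNF.Satisfiable, Finset.mem_image, Finset.mem_range] at hun
  push Not at hun
  obtain ⟨_, ⟨c, hc, rfl⟩, hfalse⟩ := hun fun v => decide (1 / 2 < (trapezoid δ)^[N + 1 - v] x)
  refine clauseValue_eq_zero hc fun l hl => ?_
  rw [neuron_litNeuron h0 x (hcl c hc l hl), literalGate_eq_zero (hfalse l hl), mul_zero]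

theorem clauseValue_neuron_of_near (h0 : 0 < δ) (h1 : δ < 1 / 2) (he : 1 ≤ δ⁻¹ ^ e₀ * (1 - 2 * δ))
    (hcl : ∀ c < m, ∀ l ∈ cl c, l.1 ∈ Icc 1 N) (hW : ∀ c < m, ∀ l ∈ cl c, litNeuron e₀ l < W)
    {z : ℕ → Bool} (hz : ∀ c < m, ∃ l ∈ cl c, z l.1 = l.2)
    (hx : ∀ v ∈ Icc 1 N, Near δ (z v) ((trapezoid δ)^[N + 1 - v] x)) :
    clauseValue W e₀ m cl (neuron δ x (N + e₀)) = 1 := by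
  refine clauseValue_eq_one (neuron_nonneg δ x _) fun c hc => ?_
  obtain ⟨l, hl, hzl⟩ := hz c hc
  exact ⟨l, hl, hW c hc l hl,
    one_le_neuron_litNeuron h0 h1 he (hcl c hc l hl) (hzl ▸ hx l.1 (hcl c hc l hl))⟩

end Neurons

/-! ## The integral of the network of a formula -/

theorem Network.continuous_realize {d m : ℕ} (Φ : Network d m) : Continuous Φ.realize := by
  induction Φ with
  | last W b =>
    exact (Continuous.matrix_mulVec continuous_const continuous_id).add continuous_const
  | cons W b Φ ih =>
    refine ih.comp (continuous_pi fun i => continuous_const.max ?_)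
    exact (continuous_apply i).comp
      ((Continuous.matrix_mulVec continuous_const continuous_id).add continuous_const)

section Slab

variable {ι : Type*} {i₀ : ι} {a b : ℝ}

theorem Icc_update_subset_Icc [DecidableEq ι] (ha : 0 ≤ a) (hb : b ≤ 1) :
    Icc (Function.update (0 : ι → ℝ) i₀ a) (Function.update (1 : ι → ℝ) i₀ b) ⊆ Icc 0 1 :=
  Icc_subset_Icc (le_update_iff.2 ⟨ha, fun _ _ => le_rfl⟩) (update_le_iff.2 ⟨hb, fun _ _ => le_rfl⟩)

theorem volume_Icc_update [Fintype ι] [DecidableEq ι] (hab : a ≤ b) :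
    (volume (Icc (Function.update (0 : ι → ℝ) i₀ a) (Function.update (1 : ι → ℝ) i₀ b))).toReal =
      b - a := by
  have hle : Function.update (0 : ι → ℝ) i₀ a ≤ Function.update (1 : ι → ℝ) i₀ b :=
    update_le_update_iff.2 ⟨hab, fun _ _ => zero_le_one⟩
  rw [Real.volume_Icc_pi_toReal hle,
    Finset.prod_eq_single i₀ (fun i _ hi => by simp [hi]) (by simp)]
  simp

theorem sub_le_setIntegral_Icc_of_eq_one [Fintype ι] {F : (ι → ℝ) → ℝ} (hF : Continuous F)
    (hF0 : ∀ x, 0 ≤ F x) (ha : 0 ≤ a) (hab : a ≤ b) (hb : b ≤ 1)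
    (h1 : ∀ x, x i₀ ∈ Icc a b → F x = 1) :
    b - a ≤ ∫ x in Icc (0 : ι → ℝ) 1, F x := by
  classical
  have hint : IntegrableOn F (Icc (0 : ι → ℝ) 1) :=
    hF.continuousOn.integrableOn_compact isCompact_Icc
  let slab := Icc (Function.update (0 : ι → ℝ) i₀ a) (Function.update (1 : ι → ℝ) i₀ b)
  calc b - a = ∫ _ in slab, (1 : ℝ) := by simp [slab, Measure.real, volume_Icc_update hab]
    _ = ∫ x in slab, F x := setIntegral_congr_fun measurableSet_Icc fun x hx =>
        (h1 x ⟨by simpa using hx.1 i₀, by simpa using hx.2 i₀⟩).symm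
    _ ≤ ∫ x in Icc (0 : ι → ℝ) 1, F x :=
        setIntegral_mono_set hint (.of_forall hF0) (Icc_update_subset_Icc ha hb).eventuallyLE

end Slab

section Integral

variable {δ : ℝ} {d W N e₀ m : ℕ} {cl : ℕ → Clause}

theorem integral_satNet_eq_zero (hd : 0 < d) (hW : 4 ≤ W) (h0 : 0 ≤ δ)
    (hcl : ∀ c < m, ∀ l ∈ cl c, l.1 ∈ Icc 1 N)
    (hun : ¬ CNF.Satisfiable ((Finset.range m).image cl)) :
    ∫ x in Icc (0 : Fin d → ℝ) 1, (satNet δ d W N e₀ m cl).realize x 0 = 0 := by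
  simp only [realize_satNet hd hW, clauseValue_neuron_of_not_satisfiable h0 hcl hun,
    integral_zero]

theorem le_integral_satNet (hd : 0 < d) (hW : 4 ≤ W) (h0 : 0 < δ) (h1 : δ < 1 / 2)
    (he : 1 ≤ δ⁻¹ ^ e₀ * (1 - 2 * δ)) (hcl : ∀ c < m, ∀ l ∈ cl c, l.1 ∈ Icc 1 N)
    (hclW : ∀ c < m, ∀ l ∈ cl c, litNeuron e₀ l < W)
    (hsat : CNF.Satisfiable ((Finset.range m).image cl)) :
    δ ^ (N + 1) ≤ ∫ x in Icc (0 : Fin d → ℝ) 1, (satNet δ d W N e₀ m cl).realize x 0 := by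
  obtain ⟨z, hz⟩ := hsat
  simp only [Finset.mem_image, Finset.mem_range, forall_exists_index, and_imp,
    forall_apply_eq_imp_iff₂] at hz
  obtain ⟨a, ha0, ha1, hnear⟩ := exists_Icc_forall_near h0 h1 (N + 1) fun i => z (N + 1 - i)
  have hslab : ∀ x : Fin d → ℝ, x ⟨0, hd⟩ ∈ Icc a (a + δ ^ (N + 1)) →
      (satNet δ d W N e₀ m cl).realize x 0 = 1 := fun x hx => by
    rw [realize_satNet hd hW]
    refine clauseValue_neuron_of_near h0 h1 he hcl hclW hz fun v hv => ?_
    have := hnear _ hx (N + 1 - v) (by have := hv.1; omega)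
    rwa [show N + 1 - (N + 1 - v) = v by have := hv.2; omega] at this
  calc δ ^ (N + 1) = a + δ ^ (N + 1) - a := by ring
    _ ≤ _ := sub_le_setIntegral_Icc_of_eq_one
      ((continuous_apply 0).comp (satNet δ d W N e₀ m cl).continuous_realize)
      (fun x => by rw [Function.comp_apply, realize_satNet hd hW]; exact (clauseValue_mem_Icc ..).1)
      ha0 (by linarith [pow_pos h0 (N + 1)]) ha1 hslab

end Integral

/-! ## The shape of the network of a formula -/

/-- The parameters of a layer with `r` rows, `c` columns, weights `w` and biases `b`, in the order
of `Network.params`. -/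
def layerParams {α : Type*} (r c : ℕ) (w : ℕ → ℕ → α) (b : ℕ → α) : List α :=
  ((List.range r).flatMap fun i => (List.range c).map fun j => w i j) ++ (List.range r).map b

section Shape

variable {α β : Type*} {δ : ℝ} {d W N e₀ m r c : ℕ} {cl : ℕ → Clause}

theorem layerParams_finRange (r c : ℕ) (w : ℕ → ℕ → α) (b : ℕ → α) :
    (((List.finRange r).flatMap fun i : Fin r => (List.finRange c).map fun j : Fin c => w i j) ++
      (List.finRange r).map fun i : Fin r => b i) = layerParams r c w b := by
  simp only [layerParams, ← List.map_coe_finRange_eq_range, List.map_map, List.flatMap_map]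
  rfl

theorem map_layerParams (f : α → β) (r c : ℕ) (w : ℕ → ℕ → α) (b : ℕ → α) :
    (layerParams r c w b).map f = layerParams r c (fun i j => f (w i j)) fun i => f (b i) := by
  simp [layerParams, List.map_flatMap, Function.comp_def]

theorem forall_mem_layerParams {p : α → Prop} {w : ℕ → ℕ → α} {b : ℕ → α}
    (hw : ∀ i j, p (w i j)) (hb : ∀ i, p (b i)) : ∀ a ∈ layerParams r c w b, p a := by
  simp only [layerParams, List.mem_append, List.mem_flatMap, List.mem_map]
  rintro _ (⟨i, -, j, -, rfl⟩ | ⟨i, -, rfl⟩)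
  exacts [hw i j, hb i]

theorem widths_curveNet (Φ : Network W 1) (P : ℕ) :
    (curveNet δ Φ P).widths = List.replicate P W ++ Φ.widths := by
  induction P with
  | zero => rfl
  | succ P ih => rw [curveNet, Network.widths, ih]; rfl

theorem depth_curveNet (Φ : Network W 1) (P : ℕ) : (curveNet δ Φ P).depth = P + Φ.depth := by
  induction P with
  | zero => simp [curveNet]
  | succ P ih => rw [curveNet, Network.depth, ih]; omega

theorem params_curveNet (Φ : Network W 1) (P : ℕ) :
    (curveNet δ Φ P).params =
      ((List.range P).flatMap fun _ => layerParams W W (curveWeight δ) (curveBias δ)) ++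
        Φ.params := by
  induction P with
  | zero => rfl
  | succ P ih =>
    rw [curveNet, Network.params, ih, List.range_succ_eq_map, List.flatMap_cons,
      List.flatMap_map, List.append_assoc, ← layerParams_finRange W W (curveWeight δ) (curveBias δ),
      List.append_assoc]
    simp only [Matrix.of_apply, List.append_assoc]

theorem depth_satNet : (satNet δ d W N e₀ m cl).depth = N + e₀ + 4 := by
  rw [satNet, Network.depth, depth_curveNet]
  rfl

theorem widths_satNet :
    (satNet δ d W N e₀ m cl).widths = d :: (List.replicate (N + e₀ + 1) W ++ [m, 1, 1]) := by
  rw [satNet, Network.widths, widths_curveNet, List.replicate_succ']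
  simp [clauseNet, Network.widths]

theorem params_satNet :
    (satNet δ d W N e₀ m cl).params = layerParams W d firstWeight (firstBias δ) ++
      (((List.range (N + e₀)).flatMap fun _ => layerParams W W (curveWeight δ) (curveBias δ)) ++
        (layerParams m W (clauseWeight e₀ cl) (fun _ => 1) ++
          (layerParams 1 m (fun _ _ => -1) (fun _ => 1) ++
            layerParams 1 1 (fun _ _ => 1) fun _ => 0))) := by
  rw [satNet, Network.params, params_curveNet]
  congr 1
  · exact layerParams_finRange W d firstWeight (firstBias δ)
  congr 1
  simp only [clauseNet, Network.params, Matrix.of_apply, List.append_assoc]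
  rw [← layerParams_finRange m W, ← layerParams_finRange 1 m, ← layerParams_finRange 1 1]
  simp

theorem mem_curveWeights {x : ℝ} : x ∈ curveWeights δ ↔
    x = -1 ∨ x = 0 ∨ x = 1 ∨ x = -δ⁻¹ ∨ x = δ⁻¹ ∨ x = δ ∨ x = -(1 - δ) := by
  simp [curveWeights]

theorem mem_curveWeights_of_mem_params_satNet :
    ∀ a ∈ (satNet δ d W N e₀ m cl).params, a ∈ curveWeights δ := by
  intro a ha
  simp only [params_satNet, List.mem_append, List.mem_flatMap] at ha
  rcases ha with h | ⟨_, _, h⟩ | h | h | h <;>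
    refine forall_mem_layerParams (fun i j => ?_) (fun i => ?_) a h <;> rw [mem_curveWeights]
  · rw [firstWeight]; split_ifs <;> simp
  · rw [firstBias]; split_ifs <;> simp
  · rw [curveWeight]; split_ifs <;> simp
  · rw [curveBias]; split_ifs <;> simp
  · rw [clauseWeight]; split_ifs <;> simp
  all_goals simp

theorem satNet_mem_inputClass {k C wr Lr n : ℕ} {θ : Finset ℝ} (hθ : curveWeights δ ⊆ θ)
    (hd : 0 < d) (hdn : d < n) (hW : W = max 2 (C * wr * k) * n) (hW4 : 4 ≤ W)
    (hm : 1 ≤ m) (hmW : m ≤ W) (hdepth : N + e₀ + 4 ≤ 3 * Lr + (n - d) - 1) :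
    satNet δ d W N e₀ m cl ∈
      inputClass d k C wr Lr θ n \ inputClass d k C wr Lr θ (n - 1) := by
  have hpos : 0 < max 2 (C * wr * k) := by positivity
  have hmax : max n d = n := max_eq_left hdn.le
  have hnW : n ≤ W := hW ▸ Nat.le_mul_of_pos_left n hpos
  refine ⟨⟨⟨?_, ?_, fun a ha => hθ (mem_curveWeights_of_mem_params_satNet a ha)⟩, fun x => ?_⟩, ?_⟩
  · rwa [depth_satNet, hmax]
  · rw [widths_satNet, hmax, ← hW]
    simp only [List.mem_cons, List.mem_append, List.mem_replicate, List.not_mem_nil, or_false]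
    omega
  · rw [realize_satNet hd hW4]
    exact clauseValue_mem_Icc ..
  · rintro ⟨⟨-, hwidths, -⟩, -⟩
    have hle := (hwidths W (by simp [widths_satNet])).2
    rw [hW, show max (n - 1) d = n - 1 by omega] at hle
    have := Nat.le_of_mul_le_mul_left hle hpos
    omega

end Shape

theorem Network.one_le_depth {d m : ℕ} (Φ : Network d m) : 1 ≤ Φ.depth := by
  cases Φ <;> simp [Network.depth]

theorem Network.mem_widths {d m : ℕ} (Φ : Network d m) : d ∈ Φ.widths := by
  cases Φ <;> simp [Network.widths]

theorem monotone_inputClass {d k C wr Lr : ℕ} {θ : Finset ℝ} :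
    Monotone (inputClass d k C wr Lr θ) := by
  rintro a b hab Φ ⟨⟨hdepth, hwidths, hparams⟩, hrange⟩
  have h : max a d ≤ max b d := max_le_max_right d hab
  exact ⟨⟨hdepth.trans (by omega), fun v hv => ⟨(hwidths v hv).1,
    (hwidths v hv).2.trans (Nat.mul_le_mul_left _ h)⟩, hparams⟩, hrange⟩

/-! ## Reading formulas from lists -/

/-- The list that presents the clauses `cs` to a machine. -/
def encodeClauses (cs : List (List Literal)) : List ℕ :=
  cs.flatMap fun c => c.map Literal.code ++ [0]

/-- The literal with a given code. -/
def decodeLit (a : ℕ) : Literal := (a / 2, a % 2 == 0)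

/-- The number of end marks before position `i`: the number of the clause of this position. -/
def clauseNo (x : List ℕ) (i : ℕ) : ℕ := (x.take i).count 0

/-- The literals of clause number `c`. -/
def clauseList (x : List ℕ) (c : ℕ) : List Literal :=
  ((List.range x.length).filter fun i => x.getD i 0 ≠ 0 ∧ clauseNo x i = c).map
    fun i => decodeLit (x.getD i 0)

/-- The formula that is listed by `x`. -/
def formula (x : List ℕ) : CNF :=
  (Finset.range (x.count 0)).image fun c => (clauseList x c).toFinset

/-- The list `x` presents a formula with at most `k` literals per clause; see
`valid_iff_exists_presents`. -/
structure Valid (k : ℕ) (x : List ℕ) : Prop where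
  getLast : x.getLast? = some 0
  one_not_mem : 1 ∉ x
  clause : ∀ c < x.count 0,
    clauseList x c ≠ [] ∧ (clauseList x c).length ≤ k ∧ (clauseList x c).Nodup
  injOn : InjOn (fun c => (clauseList x c).toFinset) (Iio (x.count 0))

section Reading

variable {x : List ℕ} {α : CNF} {cs : List (List Literal)} {k n : ℕ}

theorem decodeLit_code (l : Literal) : decodeLit l.code = l := by
  obtain ⟨i, _ | _⟩ := l
  · simp [decodeLit, Literal.code]; omega
  · simp [decodeLit, Literal.code]

theorem code_decodeLit (a : ℕ) : (decodeLit a).code = a := by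
  simp only [decodeLit, Literal.code, beq_iff_eq]
  split_ifs <;> omega

theorem decodeLit_injective : Function.Injective decodeLit :=
  Function.LeftInverse.injective code_decodeLit

theorem mem_clauseList {l : Literal} {c : ℕ} : l ∈ clauseList x c ↔
    ∃ i < x.length, x.getD i 0 ≠ 0 ∧ clauseNo x i = c ∧ decodeLit (x.getD i 0) = l := by
  simp [clauseList, and_assoc]

theorem clauseList_cons (a : ℕ) (x : List ℕ) (c : ℕ) : clauseList (a :: x) c =
    if a = 0 then if c = 0 then [] else clauseList x (c - 1)
    else if c = 0 then decodeLit a :: clauseList x 0 else clauseList x c := by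
  rw [clauseList, List.length_cons, List.range_succ_eq_map, List.filter_cons, List.filter_map]
  rcases a with _ | a <;> rcases c with _ | c <;>
    simp [clauseList, clauseNo, Function.comp_def]

theorem clauseList_append_zero {c : List Literal} (hc : ∀ l ∈ c, l.code ≠ 0) (y : List ℕ) (j : ℕ) :
    clauseList (c.map Literal.code ++ 0 :: y) j = if j = 0 then c else clauseList y (j - 1) := by
  induction c with
  | nil => simp [clauseList_cons]
  | cons l c ih =>
    have ih := ih fun b hb => hc b (List.mem_cons_of_mem _ hb)
    rw [List.map_cons, List.cons_append, clauseList_cons, if_neg (hc l List.mem_cons_self), ih,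
      decodeLit_code]
    split_ifs with hj
    · simpa [hj] using ih
    · rfl

theorem clauseList_encodeClauses (hcs : ∀ c ∈ cs, ∀ l ∈ c, l.code ≠ 0) (j : ℕ) :
    clauseList (encodeClauses cs) j = cs.getD j [] := by
  induction cs generalizing j with
  | nil => simp [encodeClauses, clauseList]
  | cons c cs ih =>
    rw [encodeClauses, List.flatMap_cons, List.append_assoc, List.singleton_append,
      clauseList_append_zero (hcs c List.mem_cons_self), ← encodeClauses,
      ih fun c hc => hcs c (List.mem_cons_of_mem _ hc)]
    cases j <;> simp

theorem count_zero_encodeClauses (hcs : ∀ c ∈ cs, ∀ l ∈ c, l.code ≠ 0) :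
    (encodeClauses cs).count 0 = cs.length := by
  induction cs with
  | nil => rfl
  | cons c cs ih =>
    have hc : (c.map Literal.code).count 0 = 0 :=
      List.count_eq_zero.2 (by simpa using hcs c List.mem_cons_self)
    rw [encodeClauses, List.flatMap_cons, List.count_append, List.count_append, hc,
      ← encodeClauses, ih fun c hc => hcs c (List.mem_cons_of_mem _ hc)]
    simp [add_comm]

theorem getLast?_encodeClauses (hcs : cs ≠ []) : (encodeClauses cs).getLast? = some 0 := by
  rw [encodeClauses, ← List.dropLast_append_getLast hcs]
  simp

theorem exists_eq_encodeClauses (hx : x.getLast? = some 0) :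
    ∃ cs ≠ [], (∀ c ∈ cs, ∀ l ∈ c, l.code ≠ 0) ∧ x = encodeClauses cs := by
  induction x with
  | nil => simp at hx
  | cons a x ih =>
    rcases eq_or_ne x [] with rfl | hne
    · obtain rfl : a = 0 := by simpa using hx
      exact ⟨[[]], by simp [encodeClauses]⟩
    · obtain ⟨_ | ⟨c, cs⟩, h, hcs, rfl⟩ := ih (by rwa [List.getLast?_cons_of_ne_nil hne] at hx)
      · exact absurd rfl h
      rcases eq_or_ne a 0 with rfl | ha
      · exact ⟨[] :: c :: cs, by simp, by simpa using hcs, by simp [encodeClauses]⟩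
      · refine ⟨(decodeLit a :: c) :: cs, by simp, ?_, by simp [encodeClauses, code_decodeLit]⟩
        obtain ⟨hc, hcs⟩ := List.forall_mem_cons.1 hcs
        exact List.forall_mem_cons.2
          ⟨List.forall_mem_cons.2 ⟨by rwa [code_decodeLit], hc⟩, hcs⟩

theorem mem_encodeClauses {a : ℕ} :
    a ∈ encodeClauses cs ↔ ∃ c ∈ cs, (∃ l ∈ c, l.code = a) ∨ a = 0 := by
  simp [encodeClauses]

theorem code_ne_zero_and_ne_one_iff {l : Literal} : l.code ≠ 0 ∧ l.code ≠ 1 ↔ 1 ≤ l.1 := by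
  simp only [Literal.code]
  split_ifs <;> omega

theorem map_getD_range {β : Type*} (l : List β) (d : β) :
    (List.range l.length).map (l.getD · d) = l :=
  List.ext_getElem (by simp) fun i _ hi => by simp [hi]

theorem forall_mem_iff_getD {β : Type*} {l : List β} (d : β) {p : β → Prop} :
    (∀ a ∈ l, p a) ↔ ∀ j < l.length, p (l.getD j d) := by
  conv_lhs => rw [← map_getD_range l d]
  simp

theorem nodup_map_iff_injOn_getD {β γ : Type*} {l : List β} (d : β) {f : β → γ} :
    (l.map f).Nodup ↔ InjOn (fun j => f (l.getD j d)) (Iio l.length) := by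
  conv_lhs => rw [← map_getD_range l d]
  rw [List.map_map, List.nodup_map_iff_inj_on List.nodup_range]
  simp only [List.mem_range, InjOn, mem_Iio, Function.comp_apply]

theorem formula_encodeClauses (hcs : ∀ c ∈ cs, ∀ l ∈ c, l.code ≠ 0) :
    formula (encodeClauses cs) = (cs.map List.toFinset).toFinset := by
  conv_rhs => rw [← map_getD_range cs []]
  ext c
  simp only [formula, count_zero_encodeClauses hcs, clauseList_encodeClauses hcs]
  simp

theorem valid_encodeClauses_iff (hcs : ∀ c ∈ cs, ∀ l ∈ c, l.code ≠ 0) :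
    Valid k (encodeClauses cs) ↔ cs ≠ [] ∧ (∀ c ∈ cs, ∀ l ∈ c, 1 ≤ l.1) ∧
      (∀ c ∈ cs, c ≠ [] ∧ c.length ≤ k ∧ c.Nodup) ∧ (cs.map List.toFinset).Nodup := by
  rw [forall_mem_iff_getD (l := cs) [] (p := fun c => c ≠ [] ∧ c.length ≤ k ∧ c.Nodup),
    nodup_map_iff_injOn_getD []]
  simp only [← clauseList_encodeClauses hcs]
  rw [← count_zero_encodeClauses hcs]
  constructor
  · refine fun h => ⟨?_, fun c hc l hl => ?_, h.clause, h.injOn⟩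
    · rintro rfl
      simpa [encodeClauses] using h.getLast
    · exact code_ne_zero_and_ne_one_iff.1 ⟨hcs c hc l hl,
        fun h1 => h.one_not_mem (mem_encodeClauses.2 ⟨c, hc, .inl ⟨l, hl, h1⟩⟩)⟩
  · refine fun ⟨hne, hpos, hclause, hinj⟩ =>
      ⟨getLast?_encodeClauses hne, fun h1 => ?_, hclause, hinj⟩
    obtain ⟨c, hc, ⟨l, hl, h1⟩ | h1⟩ := mem_encodeClauses.1 h1
    · exact (code_ne_zero_and_ne_one_iff.2 (hpos c hc l hl)).2 h1
    · exact one_ne_zero h1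

theorem mem_kCNF_iff (hnd : ∀ c ∈ cs, c.Nodup) : (cs.map List.toFinset).toFinset ∈ kCNF k n ↔
    cs ≠ [] ∧ ∀ c ∈ cs, c ≠ [] ∧ c.length ≤ k ∧ ∀ l ∈ c, 1 ≤ l.1 ∧ l.1 ≤ n := by
  simp only [kCNF, mem_ofPred_eq, List.toFinset_nonempty_iff, ne_eq, List.map_eq_nil_iff,
    List.mem_toFinset, List.forall_mem_map]
  exact and_congr_right fun _ => forall₂_congr fun c hc => by
    rw [List.toFinset_card_of_nodup (hnd c hc)]

theorem le_sum_of_mem_encodeClauses {c : List Literal} (hc : c ∈ cs) {l : Literal} (hl : l ∈ c) :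
    l.1 ≤ (encodeClauses cs).sum :=
  calc l.1 ≤ l.code := by rw [Literal.code]; omega
    _ ≤ (encodeClauses cs).sum :=
      List.single_le_sum (by simp) _ (mem_encodeClauses.2 ⟨c, hc, .inl ⟨l, hl, rfl⟩⟩)

theorem valid_iff_exists_presents : Valid k x ↔ ∃ n, ∃ α ∈ kCNF k n, Presents x α := by
  constructor
  · intro h
    obtain ⟨cs, -, hcs, rfl⟩ := exists_eq_encodeClauses h.getLast
    obtain ⟨hne, hpos, hclause, hinj⟩ := (valid_encodeClauses_iff hcs).1 h
    refine ⟨(encodeClauses cs).sum, _,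
      (mem_kCNF_iff fun c hc => (hclause c hc).2.2).2 ⟨hne, fun c hc => ?_⟩, cs,
      fun c hc => (hclause c hc).2.2, hinj, rfl, rfl⟩
    exact ⟨(hclause c hc).1, (hclause c hc).2.1, fun l hl =>
      ⟨hpos c hc l hl, le_sum_of_mem_encodeClauses hc hl⟩⟩
  · rintro ⟨n, α, hα, cs, hnd, hinj, rfl, rfl⟩
    obtain ⟨hne, hclause⟩ := (mem_kCNF_iff hnd).1 hα
    exact (valid_encodeClauses_iff fun c hc l hl =>
      (code_ne_zero_and_ne_one_iff.2 ((hclause c hc).2.2 l hl).1).1).2 ⟨hne,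
        fun c hc l hl => ((hclause c hc).2.2 l hl).1,
        fun c hc => ⟨(hclause c hc).1, (hclause c hc).2.1, hnd c hc⟩, hinj⟩

section Presents

variable (hα : α ∈ kCNF k n) (hx : Presents x α)
include hα hx

theorem Presents.exists_eq_encodeClauses : ∃ cs : List (List Literal),
    (∀ c ∈ cs, c.length ≤ k ∧ ∀ l ∈ c, l.code ≠ 0 ∧ l.1 ≤ n) ∧ cs.length = α.card ∧
      (cs.map List.toFinset).toFinset = α ∧ x = encodeClauses cs := by
  obtain ⟨cs, hnd, hinj, rfl, rfl⟩ := hx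
  obtain ⟨-, hclause⟩ := (mem_kCNF_iff hnd).1 hα
  refine ⟨cs, fun c hc => ⟨(hclause c hc).2.1, fun l hl => ?_⟩, ?_, rfl, rfl⟩
  · obtain ⟨hl1, hln⟩ := (hclause c hc).2.2 l hl
    exact ⟨(code_ne_zero_and_ne_one_iff.2 hl1).1, hln⟩
  · rw [List.toFinset_card_of_nodup hinj, List.length_map]

theorem Presents.formula_eq : formula x = α := by
  obtain ⟨cs, hcs, -, rfl, rfl⟩ := hx.exists_eq_encodeClauses hα
  exact formula_encodeClauses fun c hc l hl => ((hcs c hc).2 l hl).1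

theorem Presents.count_zero : x.count 0 = α.card := by
  obtain ⟨cs, hcs, hcard, -, rfl⟩ := hx.exists_eq_encodeClauses hα
  rw [count_zero_encodeClauses fun c hc l hl => ((hcs c hc).2 l hl).1, hcard]

theorem Presents.le_of_mem {a : ℕ} (ha : a ∈ x) : a ≤ 2 * n + 1 := by
  obtain ⟨cs, hcs, -, -, rfl⟩ := hx.exists_eq_encodeClauses hα
  obtain ⟨c, hc, ⟨l, hl, rfl⟩ | rfl⟩ := mem_encodeClauses.1 ha
  · have hln := ((hcs c hc).2 l hl).2
    simp only [Literal.code]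
    split_ifs <;> omega
  · exact Nat.zero_le _

theorem Presents.length_le : x.length ≤ α.card * (k + 1) := by
  obtain ⟨cs, hcs, hcard, -, rfl⟩ := hx.exists_eq_encodeClauses hα
  rw [← hcard, encodeClauses, List.length_flatMap]
  refine (List.sum_le_card_nsmul _ (k + 1) ?_).trans (by simp)
  simpa using fun c hc => (hcs c hc).1

end Presents

end Reading

/-! ## Terms for reading formulas -/

namespace ArithTerm

/-- Negation of truth values; a term is true if its value is not `0`. -/
def tnot (a : ArithTerm) : ArithTerm := ite a (const 0) (const 1)

/-- Conjunction of truth values. -/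
def tand (a b : ArithTerm) : ArithTerm := ite a b (const 0)

/-- Disjunction of truth values. -/
def tor (a b : ArithTerm) : ArithTerm := ite a (const 1) b

/-- Implication of truth values. -/
def timp (a b : ArithTerm) : ArithTerm := ite a b (const 1)

/-- Equality as a truth value. -/
def teq (a b : ArithTerm) : ArithTerm := tnot (add (sub a b) (sub b a))

/-- The relation `≤` as a truth value. -/
def tle (a b : ArithTerm) : ArithTerm := tnot (sub a b)

/-- The relation `<` as a truth value. -/
def tlt (a b : ArithTerm) : ArithTerm := sub b a

/-- Bounded universal quantification over the variable `v`. -/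
def tall (v : ℕ) (b p : ArithTerm) : ArithTerm := tnot (sum v b (tnot p))

/-- Multiplication by a constant. -/
def smul : ℕ → ArithTerm → ArithTerm
  | 0, _ => const 0
  | c + 1, t => add (smul c t) t

section Connectives

variable {x σ : ℕ → ℕ} {a b p : ArithTerm}

theorem tnot_holds : (tnot a).eval x σ ≠ 0 ↔ a.eval x σ = 0 := by
  simp [tnot, eval]

theorem tand_holds : (tand a b).eval x σ ≠ 0 ↔ a.eval x σ ≠ 0 ∧ b.eval x σ ≠ 0 := by
  simp [tand, eval]

theorem tor_holds : (tor a b).eval x σ ≠ 0 ↔ a.eval x σ ≠ 0 ∨ b.eval x σ ≠ 0 := by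
  simp only [tor, eval]
  split_ifs <;> simp_all

theorem timp_holds : (timp a b).eval x σ ≠ 0 ↔ (a.eval x σ ≠ 0 → b.eval x σ ≠ 0) := by
  simp only [timp, eval]
  split_ifs <;> simp_all

theorem teq_holds : (teq a b).eval x σ ≠ 0 ↔ a.eval x σ = b.eval x σ := by
  rw [teq, tnot_holds, eval, eval, eval]
  omega

theorem teq_eq_zero : (teq a b).eval x σ = 0 ↔ a.eval x σ ≠ b.eval x σ :=
  not_iff_not.1 (teq_holds.trans not_not.symm)

theorem tle_holds : (tle a b).eval x σ ≠ 0 ↔ a.eval x σ ≤ b.eval x σ := by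
  rw [tle, tnot_holds, eval, Nat.sub_eq_zero_iff_le]

theorem tlt_holds : (tlt a b).eval x σ ≠ 0 ↔ a.eval x σ < b.eval x σ := by
  rw [tlt, eval, Nat.sub_ne_zero_iff_lt]

theorem sum_holds {v : ℕ} : (sum v b p).eval x σ ≠ 0 ↔
    ∃ i < b.eval x σ, p.eval x (Function.update σ v i) ≠ 0 := by
  simp [eval]

theorem tall_holds {v : ℕ} : (tall v b p).eval x σ ≠ 0 ↔
    ∀ i < b.eval x σ, p.eval x (Function.update σ v i) ≠ 0 := by
  simp [tall, tnot, eval]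

theorem eval_smul (c : ℕ) : (smul c a).eval x σ = c * a.eval x σ := by
  induction c with
  | zero => simp [smul, eval]
  | succ c ih => rw [smul, eval, ih, Nat.succ_mul]

end Connectives

/-- Computes `clauseNo` at the position given by `t`. In all terms for formulas, variable `0` holds
the length of the array. -/
def clauseNoTerm (t : ArithTerm) : ArithTerm :=
  sum 20 t (ite (tand (tlt (var 20) (var 0)) (tnot (get (var 20)))) (const 1) (const 0))

/-- Checks whether position `i` holds a literal of clause number `c`, where both are variables. -/
def inClauseTerm (i c : ℕ) : ArithTerm :=
  tand (get (var i)) (teq (clauseNoTerm (var i)) (var c))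

/-- The number of literals, with repetitions, of the clause whose number is held by variable `c`. -/
def clauseLengthTerm (c : ℕ) : ArithTerm :=
  sum 21 (var 0) (ite (inClauseTerm 21 c) (const 1) (const 0))

/-- Checks that no literal is repeated in the clause whose number is held by variable `c`. -/
def clauseNodupTerm (c : ℕ) : ArithTerm :=
  tall 21 (var 0) <| timp (inClauseTerm 21 c) <| tall 22 (var 0) <| timp (inClauseTerm 22 c) <|
    timp (teq (get (var 21)) (get (var 22))) (teq (var 21) (var 22))

/-- Checks whether one clause is contained in another, as sets of literals. -/
def clauseSubsetTerm (c c' : ℕ) : ArithTerm :=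
  tall 21 (var 0) <| timp (inClauseTerm 21 c) <|
    sum 22 (var 0) (tand (inClauseTerm 22 c') (teq (get (var 22)) (get (var 21))))

/-- Checks whether the array presents a formula with at most `k` literals per clause. -/
def checkTerm (k : ℕ) : ArithTerm :=
  tand (tand (var 0) (tnot (get (sub (var 0) (const 1))))) <|
  tand (tall 1 (var 0) (tnot (teq (get (var 1)) (const 1)))) <|
  tand (tall 1 (clauseNoTerm (var 0)) (tand (clauseLengthTerm 1)
    (tand (tle (clauseLengthTerm 1) (const k)) (clauseNodupTerm 1)))) <|
  tall 1 (clauseNoTerm (var 0)) <| tall 2 (clauseNoTerm (var 0)) <|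
    timp (tand (clauseSubsetTerm 1 2) (clauseSubsetTerm 2 1)) (teq (var 1) (var 2))

end ArithTerm

theorem clauseNo_eq_sum (x : List ℕ) (i : ℕ) :
    clauseNo x i = ∑ a ∈ Finset.range i, if a < x.length ∧ x.getD a 0 = 0 then 1 else 0 := by
  induction i with
  | zero => simp [clauseNo]
  | succ i ih =>
    rw [Finset.sum_range_succ, ← ih, clauseNo, List.take_add_one, List.count_append, clauseNo]
    rcases lt_or_ge i x.length with hi | hi
    · simp [hi, List.count_singleton]
    · simp [hi.not_gt]

theorem clauseNo_length (x : List ℕ) : clauseNo x x.length = x.count 0 := by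
  rw [clauseNo, List.take_length]

theorem length_clauseList (x : List ℕ) (c : ℕ) : (clauseList x c).length =
    ∑ i ∈ Finset.range x.length, if x.getD i 0 ≠ 0 ∧ clauseNo x i = c then 1 else 0 := by
  rw [← Finset.card_filter, clauseList, List.length_map, ← List.toFinset_card_of_nodup
    (List.nodup_range.filter _), List.toFinset_filter, List.toFinset_range]
  simp only [decide_eq_true_eq]

theorem nodup_clauseList_iff {x : List ℕ} {c : ℕ} : (clauseList x c).Nodup ↔
    ∀ i < x.length, x.getD i 0 ≠ 0 ∧ clauseNo x i = c →
      ∀ j < x.length, x.getD j 0 ≠ 0 ∧ clauseNo x j = c → x.getD i 0 = x.getD j 0 → i = j := by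
  rw [clauseList, List.nodup_map_iff_inj_on (List.nodup_range.filter _)]
  simp only [List.mem_filter, List.mem_range, decide_eq_true_eq, decodeLit_injective.eq_iff,
    and_imp]

theorem clauseList_subset_iff {x : List ℕ} {c c' : ℕ} : clauseList x c ⊆ clauseList x c' ↔
    ∀ i < x.length, x.getD i 0 ≠ 0 ∧ clauseNo x i = c →
      ∃ j < x.length, (x.getD j 0 ≠ 0 ∧ clauseNo x j = c') ∧ x.getD j 0 = x.getD i 0 := by
  simp only [List.subset_def, mem_clauseList, forall_exists_index, and_imp,
    and_assoc]
  exact ⟨fun h i hi h0 hc => by simpa only [decodeLit_injective.eq_iff] using h i hi h0 hc rfl,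
    fun h l i hi h0 hc hl => by simpa only [← hl, decodeLit_injective.eq_iff] using h i hi h0 hc⟩

theorem toFinset_eq_iff_subset {α : Type*} [DecidableEq α] {l l' : List α} :
    l.toFinset = l'.toFinset ↔ l ⊆ l' ∧ l' ⊆ l := by
  simp [Finset.ext_iff, List.subset_def, iff_def, forall_and]

theorem getLast?_eq_some_zero_iff {x : List ℕ} :
    x.getLast? = some 0 ↔ x.length ≠ 0 ∧ x.getD (x.length - 1) 0 = 0 := by
  rcases x.eq_nil_or_concat with rfl | ⟨y, a, rfl⟩ <;> simp

namespace ArithTerm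

section Formula

variable {x : List ℕ} {σ : ℕ → ℕ}

theorem eval_clauseNoTerm (hσ : σ 0 = x.length) (t : ArithTerm) :
    (clauseNoTerm t).eval (x.getD · 0) σ = clauseNo x (t.eval (x.getD · 0) σ) := by
  simp only [clauseNoTerm, eval, tand_holds, tlt_holds, tnot_holds, Function.update_self,
    Function.update_of_ne (show 0 ≠ 20 by decide), hσ, clauseNo_eq_sum]

theorem inClauseTerm_holds (hσ : σ 0 = x.length) {i c : ℕ} :
    (inClauseTerm i c).eval (x.getD · 0) σ ≠ 0 ↔
      x.getD (σ i) 0 ≠ 0 ∧ clauseNo x (σ i) = σ c := by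
  rw [inClauseTerm, tand_holds, teq_holds, eval_clauseNoTerm hσ]
  rfl

theorem eval_clauseLengthTerm (hσ : σ 0 = x.length) {c : ℕ} (hc : c ≠ 21) :
    (clauseLengthTerm c).eval (x.getD · 0) σ = (clauseList x (σ c)).length := by
  have hσ' (i : ℕ) : Function.update σ 21 i 0 = x.length := by simpa using hσ
  simp only [clauseLengthTerm, eval, inClauseTerm_holds (hσ' _), Function.update_self,
    Function.update_of_ne hc, hσ, length_clauseList]

theorem clauseNodupTerm_holds (hσ : σ 0 = x.length) {c : ℕ} (hc : c ≠ 21) (hc' : c ≠ 22) :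
    (clauseNodupTerm c).eval (x.getD · 0) σ ≠ 0 ↔ (clauseList x (σ c)).Nodup := by
  have hσ₁ (i : ℕ) : Function.update σ 21 i 0 = x.length := by simpa using hσ
  have hσ₂ (i j : ℕ) : Function.update (Function.update σ 21 i) 22 j 0 = x.length := by
    simpa using hσ
  simp only [clauseNodupTerm, tall_holds, timp_holds, teq_holds, inClauseTerm_holds (hσ₁ _),
    inClauseTerm_holds (hσ₂ _ _), eval, Function.update_apply, hc, hc', hσ, reduceIte,
    Nat.reduceEqDiff, OfNat.zero_ne_ofNat, nodup_clauseList_iff]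

theorem clauseSubsetTerm_holds (hσ : σ 0 = x.length) {c c' : ℕ} (hc : c ≠ 21) (hc' : c' ≠ 21)
    (hc'' : c' ≠ 22) : (clauseSubsetTerm c c').eval (x.getD · 0) σ ≠ 0 ↔
      clauseList x (σ c) ⊆ clauseList x (σ c') := by
  have hσ₁ (i : ℕ) : Function.update σ 21 i 0 = x.length := by simpa using hσ
  have hσ₂ (i j : ℕ) : Function.update (Function.update σ 21 i) 22 j 0 = x.length := by
    simpa using hσ
  simp only [clauseSubsetTerm, tall_holds, timp_holds, sum_holds, tand_holds, teq_holds,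
    inClauseTerm_holds (hσ₁ _), inClauseTerm_holds (hσ₂ _ _)]
  simp only [eval, Function.update_apply, hc, hc', hc'', hσ, reduceIte, Nat.reduceEqDiff,
    clauseList_subset_iff]

theorem checkTerm_holds (hσ : σ 0 = x.length) (k : ℕ) :
    (checkTerm k).eval (x.getD · 0) σ ≠ 0 ↔ Valid k x := by
  have hσ₁ (i : ℕ) : Function.update σ 1 i 0 = x.length := by simpa using hσ
  have hσ₂ (i j : ℕ) : Function.update (Function.update σ 1 i) 2 j 0 = x.length := by
    simpa using hσ
  have hone : 1 ∉ x ↔ ∀ i < x.length, x.getD i 0 ≠ 1 := by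
    rw [← forall_mem_iff_getD 0 (p := (· ≠ 1)), List.forall_mem_ne']
  have hvalid : Valid k x ↔ x.getLast? = some 0 ∧ 1 ∉ x ∧ (∀ c < x.count 0,
      clauseList x c ≠ [] ∧ (clauseList x c).length ≤ k ∧ (clauseList x c).Nodup) ∧
        InjOn (fun c => (clauseList x c).toFinset) (Iio (x.count 0)) :=
    ⟨fun ⟨h₁, h₂, h₃, h₄⟩ => ⟨h₁, h₂, h₃, h₄⟩, fun ⟨h₁, h₂, h₃, h₄⟩ => ⟨h₁, h₂, h₃, h₄⟩⟩
  simp only [hvalid, getLast?_eq_some_zero_iff, hone, InjOn, mem_Iio, toFinset_eq_iff_subset,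
    checkTerm, tand_holds, tnot_holds, tall_holds, timp_holds, tle_holds, teq_holds, teq_eq_zero,
    eval_clauseNoTerm hσ, eval_clauseNoTerm (hσ₁ _),
    eval_clauseLengthTerm (hσ₁ _) (show 1 ≠ 21 by decide),
    clauseNodupTerm_holds (hσ₁ _) (show 1 ≠ 21 by decide) (show 1 ≠ 22 by decide),
    clauseSubsetTerm_holds (hσ₂ _ _) (show 1 ≠ 21 by decide) (show 2 ≠ 21 by decide)
      (show 2 ≠ 22 by decide),
    clauseSubsetTerm_holds (hσ₂ _ _) (show 2 ≠ 21 by decide) (show 1 ≠ 21 by decide)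
      (show 1 ≠ 22 by decide)]
  simp only [eval, Function.update_apply, hσ, clauseNo_length, reduceIte, zero_ne_one,
    Nat.reduceEqDiff, List.length_eq_zero_iff, ne_eq]

end Formula

end ArithTerm

/-! ## Printing the network of a formula -/

/-- The number `v` is large enough for the formula listed by `x`: the network of this formula for
`M * v` variables belongs to the input class of index about `(M + 3) * v`. -/
structure Admissible (g₀ C M : ℕ) (x : List ℕ) (v : ℕ) : Prop where
  le : g₀ ≤ v
  count_le : x.count 0 ≤ C * M * v
  entry_le : ∀ a ∈ x, a ≤ 2 * M * v + 1

/-- The least admissible number. -/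
noncomputable def scale (g₀ C M : ℕ) (x : List ℕ) : ℕ := sInf {v | Admissible g₀ C M x v}

section Scale

variable {g₀ C M : ℕ} {x : List ℕ}

theorem Admissible.mono {v w : ℕ} (hv : Admissible g₀ C M x v) (h : v ≤ w) :
    Admissible g₀ C M x w where
  le := hv.le.trans h
  count_le := hv.count_le.trans (by gcongr)
  entry_le a ha := (hv.entry_le a ha).trans (by gcongr)

theorem admissible_length_add_sum (hC : 1 ≤ C) (hM : 1 ≤ M) (g₀ : ℕ) (x : List ℕ) :
    Admissible g₀ C M x (x.length + x.sum + g₀) where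
  le := Nat.le_add_left _ _
  count_le := by
    have : x.count 0 ≤ x.length := List.count_le_length
    have : 1 * (x.length + x.sum + g₀) ≤ C * M * (x.length + x.sum + g₀) :=
      Nat.mul_le_mul_right _ (Nat.mul_pos hC hM)
    omega
  entry_le a ha := by
    have : a ≤ x.sum := List.single_le_sum (by simp) a ha
    have : 1 * (x.length + x.sum + g₀) ≤ 2 * M * (x.length + x.sum + g₀) :=
      Nat.mul_le_mul_right _ (by omega)
    omega

theorem admissible_scale (hC : 1 ≤ C) (hM : 1 ≤ M) (g₀ : ℕ) (x : List ℕ) :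
    Admissible g₀ C M x (scale g₀ C M x) :=
  Nat.sInf_mem ⟨_, admissible_length_add_sum hC hM g₀ x⟩

theorem sum_range_ite_eq_sInf {p : ℕ → Prop} [DecidablePred p] (hp : ∀ ⦃a b⦄, a ≤ b → p a → p b)
    {B : ℕ} (hB : p B) : ∑ v ∈ Finset.range B, (if ¬ p v then 1 else 0) = sInf {v | p v} := by
  rw [← Finset.card_filter, ← Finset.card_range (sInf {v | p v})]
  congr 1
  ext v
  have : p v ↔ sInf {v | p v} ≤ v := ⟨Nat.sInf_le (s := {v | p v}),
    fun h => hp h (Nat.sInf_mem (s := {v | p v}) ⟨B, hB⟩)⟩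
  have hle : sInf {v | p v} ≤ B := Nat.sInf_le (s := {v | p v}) hB
  rw [Finset.mem_filter, Finset.mem_range, Finset.mem_range, this]
  omega

end Scale

namespace ArithTerm

/-- Checks whether the value of `v` is admissible; variable `12` must not occur in `v`. -/
def admissibleTerm (g₀ C M : ℕ) (v : ArithTerm) : ArithTerm :=
  tand (tle (const g₀) v) <| tand (tle (clauseNoTerm (var 0)) (smul (C * M) v)) <|
    tall 12 (var 0) (tle (get (var 12)) (add (smul (2 * M) v) (const 1)))

/-- Computes `scale`, as the number of smaller numbers, none of which is admissible. -/
def scaleTerm (g₀ C M : ℕ) : ArithTerm :=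
  sum 11 (add (add (var 0) (sum 12 (var 0) (get (var 12)))) (const g₀))
    (ite (tnot (admissibleTerm g₀ C M (var 11))) (const 1) (const 0))

theorem admissibleTerm_holds {g₀ C M : ℕ} {x : List ℕ} {σ : ℕ → ℕ} (hσ : σ 0 = x.length) {v : ℕ}
    (hv : v ≠ 12) : (admissibleTerm g₀ C M (var v)).eval (x.getD · 0) σ ≠ 0 ↔
      Admissible g₀ C M x (σ v) := by
  have : Admissible g₀ C M x (σ v) ↔ g₀ ≤ σ v ∧ x.count 0 ≤ C * M * σ v ∧
      ∀ i < x.length, x.getD i 0 ≤ 2 * M * σ v + 1 :=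
    ⟨fun ⟨h₁, h₂, h₃⟩ => ⟨h₁, h₂, (forall_mem_iff_getD 0).1 h₃⟩,
      fun ⟨h₁, h₂, h₃⟩ => ⟨h₁, h₂, (forall_mem_iff_getD 0).2 h₃⟩⟩
  simp only [this, admissibleTerm, tand_holds, tle_holds, tall_holds, eval_clauseNoTerm hσ]
  simp only [eval, eval_smul, Function.update_self, Function.update_of_ne hv, hσ, clauseNo_length]

theorem eval_scaleTerm {g₀ C M : ℕ} (hC : 1 ≤ C) (hM : 1 ≤ M) {x : List ℕ} {σ : ℕ → ℕ}
    (hσ : σ 0 = x.length) : (scaleTerm g₀ C M).eval (x.getD · 0) σ = scale g₀ C M x := by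
  classical
  have hσ' (i : ℕ) : Function.update σ 11 i 0 = x.length := by simpa using hσ
  have hsum : ∑ i ∈ Finset.range x.length, x.getD i 0 = x.sum := by
    rw [Finset.sum_range, ← Fin.sum_univ_getElem]
    simp
  rw [scale, ← sum_range_ite_eq_sInf (fun _ _ h hv => hv.mono h)
    (admissible_length_add_sum hC hM g₀ x), scaleTerm]
  simp only [eval, tnot_holds, ← not_ne_iff (b := 0),
    admissibleTerm_holds (hσ' _) (show 11 ≠ 12 by decide), Function.update_self, hσ, hsum]

end ArithTerm

/-- The position of a parameter in the increasing enumeration of `θ`. -/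
noncomputable def pos (θ : Finset ℝ) (a : ℝ) : ℕ := (θ.filter (· < a)).card

namespace ArithTerm

/-- The position in `θ` of a weight of the first layer. In this term and the following ones,
variable `2` stands for the row and variable `3` for the column. -/
noncomputable def firstWeightTerm (θ : Finset ℝ) : ArithTerm :=
  ite (teq (var 3) (const 0))
    (ite (tor (teq (var 2) (const 0)) (teq (var 2) (const 2))) (const (pos θ (-1)))
      (ite (tor (teq (var 2) (const 1)) (teq (var 2) (const 3))) (const (pos θ 1))
        (const (pos θ 0))))
    (const (pos θ 0))

/-- The position in `θ` of a bias of the first layer. -/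
noncomputable def firstBiasTerm (θ : Finset ℝ) (δ : ℝ) : ArithTerm :=
  ite (tor (teq (var 2) (const 0)) (teq (var 2) (const 2))) (const (pos θ δ))
    (ite (tor (teq (var 2) (const 1)) (teq (var 2) (const 3))) (const (pos θ (-(1 - δ))))
      (const (pos θ 0)))

/-- The position in `θ` of a weight of the layers that iterate the trapezoid function. -/
noncomputable def curveWeightTerm (θ : Finset ℝ) (δ : ℝ) : ArithTerm :=
  ite (tor (teq (var 2) (const 0)) (teq (var 2) (const 2)))
    (ite (tlt (var 3) (const 2)) (const (pos θ δ⁻¹)) (const (pos θ 0)))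
  (ite (tor (teq (var 2) (const 1)) (teq (var 2) (const 3)))
    (ite (tlt (var 3) (const 2)) (const (pos θ (-δ⁻¹))) (const (pos θ 0)))
  (ite (teq (var 2) (const 4))
    (ite (tlt (var 3) (const 4)) (const (pos θ (-δ⁻¹))) (const (pos θ 0)))
  (ite (teq (var 2) (const 5))
    (ite (tlt (var 3) (const 4)) (const (pos θ δ⁻¹)) (const (pos θ 0)))
  (ite (teq (var 2) (add (var 3) (const 2))) (const (pos θ δ⁻¹)) (const (pos θ 0))))))

/-- The position in `θ` of a bias of the layers that iterate the trapezoid function. -/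
noncomputable def curveBiasTerm (θ : Finset ℝ) (δ : ℝ) : ArithTerm :=
  ite (tor (teq (var 2) (const 0)) (teq (var 2) (const 2))) (const (pos θ (-(1 - δ))))
  (ite (tor (teq (var 2) (const 1)) (teq (var 2) (const 3))) (const (pos θ δ))
  (ite (teq (var 2) (const 4)) (const (pos θ 1))
  (ite (teq (var 2) (const 5)) (const (pos θ (-1))) (const (pos θ 0)))))

/-- The position in `θ` of a weight of the layer that evaluates the clauses. -/
noncomputable def clauseWeightTerm (θ : Finset ℝ) (e₀ : ℕ) : ArithTerm :=
  ite (sum 4 (var 0) (tand (inClauseTerm 4 2)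
      (teq (add (get (var 4)) (const (2 + 2 * e₀))) (var 3))))
    (const (pos θ (-1))) (const (pos θ 0))

section Weights

variable {θ : Finset ℝ} {δ : ℝ}

theorem eval_firstWeightTerm {x σ : ℕ → ℕ} :
    (firstWeightTerm θ).eval x σ = pos θ (firstWeight (σ 2) (σ 3)) := by
  simp only [firstWeightTerm, eval, teq_holds, tor_holds, firstWeight, apply_ite (pos θ)]

theorem eval_firstBiasTerm {x σ : ℕ → ℕ} :
    (firstBiasTerm θ δ).eval x σ = pos θ (firstBias δ (σ 2)) := by
  simp only [firstBiasTerm, eval, teq_holds, tor_holds, firstBias, apply_ite (pos θ)]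

theorem eval_curveWeightTerm {x σ : ℕ → ℕ} :
    (curveWeightTerm θ δ).eval x σ = pos θ (curveWeight δ (σ 2) (σ 3)) := by
  simp only [curveWeightTerm, eval, teq_holds, tor_holds, tlt_holds, curveWeight,
    apply_ite (pos θ)]

theorem eval_curveBiasTerm {x σ : ℕ → ℕ} :
    (curveBiasTerm θ δ).eval x σ = pos θ (curveBias δ (σ 2)) := by
  simp only [curveBiasTerm, eval, teq_holds, tor_holds, curveBias, apply_ite (pos θ)]

theorem exists_litNeuron_eq_iff {x : List ℕ} {e₀ c j : ℕ} :
    (∃ l ∈ (clauseList x c).toFinset, litNeuron e₀ l = j) ↔ ∃ i < x.length,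
      (x.getD i 0 ≠ 0 ∧ clauseNo x i = c) ∧ x.getD i 0 + (2 + 2 * e₀) = j := by
  simp only [List.mem_toFinset, mem_clauseList]
  constructor
  · rintro ⟨_, ⟨i, hi, h0, hc, rfl⟩, hj⟩
    exact ⟨i, hi, ⟨h0, hc⟩, by rwa [litNeuron, code_decodeLit] at hj⟩
  · rintro ⟨i, hi, ⟨h0, hc⟩, hj⟩
    exact ⟨_, ⟨i, hi, h0, hc, rfl⟩, by rwa [litNeuron, code_decodeLit]⟩

theorem eval_clauseWeightTerm {x : List ℕ} {σ : ℕ → ℕ} (hσ : σ 0 = x.length) (e₀ : ℕ) :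
    (clauseWeightTerm θ e₀).eval (x.getD · 0) σ =
      pos θ (clauseWeight e₀ (fun c => (clauseList x c).toFinset) (σ 2) (σ 3)) := by
  have hσ' (i : ℕ) : Function.update σ 4 i 0 = x.length := by simpa using hσ
  rw [clauseWeightTerm, eval, clauseWeight, apply_ite (pos θ)]
  simp only [sum_holds, tand_holds, teq_holds, inClauseTerm_holds (hσ' _)]
  simp only [eval, Function.update_apply, reduceIte, Nat.reduceEqDiff, hσ, exists_litNeuron_eq_iff]

end Weights

end ArithTerm

theorem encode_satNet {δ : ℝ} {d W N e₀ m : ℕ} {cl : ℕ → Clause} (θ : Finset ℝ) :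
    (satNet δ d W N e₀ m cl).encode θ =
      (N + e₀ + 4) :: d :: (List.replicate (N + e₀ + 1) W ++ [m, 1, 1] ++
        (layerParams W d (fun i j => pos θ (firstWeight i j)) (fun i => pos θ (firstBias δ i)) ++
        ((List.range (N + e₀)).flatMap fun _ => layerParams W W
          (fun i j => pos θ (curveWeight δ i j)) fun i => pos θ (curveBias δ i)) ++
        layerParams m W (fun i j => pos θ (clauseWeight e₀ cl i j)) (fun _ => pos θ 1) ++
        layerParams 1 m (fun _ _ => pos θ (-1)) (fun _ => pos θ 1) ++
        layerParams 1 1 (fun _ _ => pos θ 1) fun _ => pos θ 0)) := by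
  simp only [Network.encode, depth_satNet, widths_satNet, params_satNet, ← pos.eq_def,
    List.map_append, List.map_flatMap, map_layerParams, List.cons_append, List.append_assoc]

namespace Printer

open ArithTerm

/-- Prints the parameters of a layer with `r` rows, `c` columns, weights `w` and biases `b`;
variable `2` stands for the row and variable `3` for the column. -/
def layer (r c w b : ArithTerm) : Printer := seq (rep 2 r (rep 3 c (emit w))) (rep 2 r (emit b))

theorem out_layer {x σ : ℕ → ℕ} {L m n : ℕ} {r c w b : ArithTerm} {f : ℕ → ℕ → ℕ} {g : ℕ → ℕ}
    (hr : ∀ σ, σ 0 = L → r.eval x σ = m) (hc : ∀ σ, σ 0 = L → c.eval x σ = n)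
    (hw : ∀ σ, σ 0 = L → w.eval x σ = f (σ 2) (σ 3)) (hb : ∀ σ, σ 0 = L → b.eval x σ = g (σ 2))
    (hσ : σ 0 = L) : (layer r c w b).out x σ = layerParams m n f g := by
  have hσ₂ (i : ℕ) : Function.update σ 2 i 0 = L := by simpa using hσ
  have hσ₃ (i j : ℕ) : Function.update (Function.update σ 2 i) 3 j 0 = L := by simpa using hσ
  simp only [layer, out, hr σ hσ, hc _ (hσ₂ _), hw _ (hσ₃ _ _), hb _ (hσ₂ _), layerParams,
    ← List.map_eq_flatMap]
  simp

/-- Prints the encoding of the network of the formula listed by the array, for `M * g` variables and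
of width `K * g`. -/
noncomputable def network (θ : Finset ℝ) (δ : ℝ) (d e₀ M K : ℕ) (g : ArithTerm) : Printer :=
  .seq (.emit (add (smul M g) (const (e₀ + 4)))) <| .seq (.emit (const d)) <|
  .seq (.rep 1 (add (smul M g) (const (e₀ + 1))) (.emit (smul K g))) <|
  .seq (.emit (clauseNoTerm (var 0))) <| .seq (.emit (const 1)) <| .seq (.emit (const 1)) <|
  .seq (.layer (smul K g) (const d) (firstWeightTerm θ) (firstBiasTerm θ δ)) <|
  .seq (.rep 1 (add (smul M g) (const e₀))
    (.layer (smul K g) (smul K g) (curveWeightTerm θ δ) (curveBiasTerm θ δ))) <|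
  .seq (.layer (clauseNoTerm (var 0)) (smul K g) (clauseWeightTerm θ e₀) (const (pos θ 1))) <|
  .seq (.layer (const 1) (clauseNoTerm (var 0)) (const (pos θ (-1))) (const (pos θ 1))) <|
    .layer (const 1) (const 1) (const (pos θ 1)) (const (pos θ 0))

theorem out_network {θ : Finset ℝ} {δ : ℝ} {d e₀ M K v : ℕ} {g : ArithTerm} {x : List ℕ}
    {σ : ℕ → ℕ} (hg : ∀ σ, σ 0 = x.length → g.eval (x.getD · 0) σ = v) (hσ : σ 0 = x.length) :
    (network θ δ d e₀ M K g).out (x.getD · 0) σ = (satNet δ d (K * v) (M * v) e₀ (x.count 0)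
      fun c => (clauseList x c).toFinset).encode θ := by
  have hσ₁ (i : ℕ) : Function.update σ 1 i 0 = x.length := by simpa using hσ
  have hsmul (a : ℕ) : ∀ σ, σ 0 = x.length → (smul a g).eval (x.getD · 0) σ = a * v :=
    fun σ hσ => by rw [eval_smul, hg σ hσ]
  have hno : ∀ σ, σ 0 = x.length → (clauseNoTerm (var 0)).eval (x.getD · 0) σ = x.count 0 :=
    fun σ hσ => by rw [eval_clauseNoTerm hσ, ArithTerm.eval, hσ, clauseNo_length]
  have hconst (a : ℕ) : ∀ σ, σ 0 = x.length → (const a).eval (x.getD · 0) σ = a := fun _ _ => rfl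
  have hfirst := out_layer (f := fun i j => pos θ (firstWeight i j))
    (g := fun i => pos θ (firstBias δ i)) (hsmul K) (hconst d)
    (fun _ _ => eval_firstWeightTerm) (fun _ _ => eval_firstBiasTerm) hσ
  have hcurve (i : ℕ) := out_layer (f := fun i j => pos θ (curveWeight δ i j))
    (g := fun i => pos θ (curveBias δ i)) (hsmul K) (hsmul K)
    (fun _ _ => eval_curveWeightTerm) (fun _ _ => eval_curveBiasTerm) (hσ₁ i)
  have hclause := out_layer
    (f := fun i j => pos θ (clauseWeight e₀ (fun c => (clauseList x c).toFinset) i j))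
    (g := fun _ => pos θ 1) hno (hsmul K)
    (fun _ hσ => eval_clauseWeightTerm hσ e₀) (hconst (pos θ 1)) hσ
  have hand := out_layer (f := fun _ _ => pos θ (-1)) (g := fun _ => pos θ 1) (hconst 1) hno
    (hconst (pos θ (-1))) (hconst (pos θ 1)) hσ
  have hlast := out_layer (f := fun _ _ => pos θ 1) (g := fun _ => pos θ 0) (hconst 1) (hconst 1)
    (hconst (pos θ 1)) (hconst (pos θ 0)) hσ
  simp only [network, out, encode_satNet, hfirst, hcurve, hclause, hand, hlast, ArithTerm.eval,
    hsmul _ σ hσ, hsmul _ _ (hσ₁ _), hno σ hσ, ← List.map_eq_flatMap, List.map_const',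
    List.length_range, List.cons_append, List.nil_append, List.append_assoc, add_assoc]

end Printer

/-! ## The decision program -/

theorem initState_mem_zero (x : List ℕ) (ω : ℕ → Bool) : (initState x ω).mem 0 = (x.getD · 0) := by
  simp [initState]

theorem initState_mem_of_ne {a : ℕ} (ha : a ≠ 0) (x : List ℕ) (ω : ℕ → Bool) :
    (initState x ω).mem a = 0 := by
  ext i
  simp [initState, ha]

theorem loaded_initState (x : List ℕ) (ω : ℕ → Bool) :
    Loaded (x.getD · 0) (fun _ => x.length) (fun _ => 0) (initState x ω) :=
  ⟨fun _ => by simp [initState], initState_mem_zero x ω⟩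

theorem getD_zero_le {l : List ℕ} {V : ℕ} (hV : ∀ y ∈ l, y ≤ V) (i : ℕ) : l.getD i 0 ≤ V := by
  rcases lt_or_ge i l.length with hi | hi
  · rw [List.getD_eq_getElem _ _ hi]
    exact hV _ (List.getElem_mem hi)
  · rw [List.getD_eq_default _ _ hi]
    exact Nat.zero_le V

/-- Copies the list held by bank `R` and register `R` to bank `0` and register `0`. The cells of the
old input are overwritten because bank `R` is zero beyond its list. -/
def replaceInput (R : ℕ) : Prog :=
  .seq (.add (R + 2) 0 R) <| .seq (.const (R + 3) 1) <|
    .seq (.loop (R + 2) <| .seq (.sub (R + 2) (R + 2) (R + 3)) <|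
      .seq (.load (R + 4) R (R + 2)) (.store 0 (R + 2) (R + 4))) <|
    .seq (.const 0 0) (.add 0 0 R)

/-- The invariant of the loop of `replaceInput` when the first `j` cells are not yet copied. -/
structure ReplaceInvariant (R : ℕ) (l : List ℕ) (s : State) (j : ℕ) (s' : State) : Prop where
  counter : s'.reg (R + 2) = j
  one : s'.reg (R + 3) = 1
  agree : AgreeOn (Iio (R + 2)) {0}ᶜ s s'
  mem : ∀ i, j ≤ i → s'.mem 0 i = l.getD i 0

theorem ReplaceInvariant.step {R V N j : ℕ} {l : List ℕ} {s s' : State} (hR : R ≠ 0)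
    (hl : ∀ i, s.mem R i = l.getD i 0) (hV : ∀ y ∈ l, y ≤ V) (hj : j < N)
    (hs : ReplaceInvariant R l s (j + 1) s') :
    RunsTo (.seq (.sub (R + 2) (R + 2) (R + 3)) <|
      .seq (.load (R + 4) R (R + 2)) (.store 0 (R + 2) (R + 4))) s' (3 * (N + V + 3))
      (ReplaceInvariant R l s j) := by
  have hVj := getD_zero_le hV j
  have hmem : s'.mem R j = l.getD j 0 := by rw [hs.agree.mem R hR, hl]
  refine ((RunsTo.sub (c := N + V + 3) (by rw [hs.counter, hs.one]; omega)).seq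
    (c' := (N + V + 3) + (N + V + 3)) ?_).mono (by omega) fun _ => id
  rintro _ rfl
  refine (RunsTo.load (by simp [hs.counter, hs.one, hmem, -List.getD_eq_getElem?_getD]; omega)).seq
    ?_
  rintro _ rfl
  refine (RunsTo.store
    (by simp [hs.counter, hs.one, hmem, -List.getD_eq_getElem?_getD]; omega)).mono le_rfl ?_
  rintro _ rfl
  refine ⟨by simp [hs.counter, hs.one], by simp [hs.one],
    ((hs.agree.setReg (by simp) _).setReg (by simp) _).setMem (by simp) _ _, fun i hi => ?_⟩
  rcases hi.eq_or_lt with rfl | hi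
  · simpa [hs.counter, hs.one] using hmem
  · simpa [hs.counter, hs.one, hi.ne'] using hs.mem i hi

theorem replaceInput_runsTo {R V N : ℕ} (hR : R ≠ 0) {x l : List ℕ} {ω : ℕ → Bool} {s : State}
    (hs : AgreeOn (Iio R) (Iio R) (initState x ω) s) (hl : Holds R R l s) (hV : ∀ y ∈ l, y ≤ V)
    (hN : x.length + l.length ≤ N) :
    RunsTo (replaceInput R) s
      (N + 2 + (2 + ((N + 1) * (N + 1 + 3 * (N + V + 3)) + (1 + (N + 2))))) fun s' =>
        AgreeOn (Iio R) (Iio R) (initState l ω) s' ∧ s'.reg (R + 1) = s.reg (R + 1) := by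
  have : R ∈ ({0}ᶜ : Set ℕ) := hR
  have hreg : s.reg 0 = x.length := by
    rw [hs.reg 0 (mem_Iio.2 hR.bot_lt)]
    simp [initState]
  refine (RunsTo.add (by rw [hreg, hl.2]; omega)).seq ?_
  rintro _ rfl
  refine RunsTo.const.seq ?_
  rintro _ rfl
  refine (RunsTo.loop (ReplaceInvariant R l s) (fun j _ hI => hI.counter) hN
    (fun j hj s' hI => hI.step hR hl.1 hV (hj.trans_le hN))
    ⟨by simp [hreg, hl.2], by simp,
      ((AgreeOn.refl s).setReg (by simp) _).setReg (by simp) _, fun i hi => ?_⟩).seq ?_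
  · rw [List.getD_eq_default _ _ (by omega)]
    simp only [State.setReg_mem, hs.mem 0 (mem_Iio.2 hR.bot_lt), initState_mem_zero]
    exact List.getD_eq_default _ _ (by omega)
  intro s₁ h₁
  have hlen : s₁.reg R = l.length := (h₁.agree.reg R (by simp)).trans hl.2
  refine RunsTo.const.seq ?_
  rintro _ rfl
  refine (RunsTo.add (by simp [hR, hlen]; omega)).mono le_rfl ?_
  rintro _ rfl
  refine ⟨⟨fun r hr => ?_, fun a ha => ?_, h₁.agree.coins.trans hs.coins⟩, ?_⟩
  · rcases eq_or_ne r 0 with rfl | h0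
    · simp [hR, hlen, initState]
    · have := hs.reg r hr
      simp only [initState, h0, if_false] at this
      simp [h0, initState, h₁.agree.reg r (Iio_subset_Iio (by omega) hr), this]
  · rcases eq_or_ne a 0 with rfl | h0
    · ext i
      simp [h₁.mem i (Nat.zero_le i), initState_mem_zero]
    · simp [h₁.agree.mem a h0, hs.mem a ha, initState_mem_of_ne h0]
  · simp [h₁.agree.reg (R + 1) (by simp)]

/-- Sets register `R + 1` to the value of `t` and replaces the input by the list printed by `e`. -/
def transformInput (R : ℕ) (t : ArithTerm) (e : Printer) : Prog :=
  .seq (t.compile (fun _ => 0) (R + 1)) <| .seq (.const R 0) <|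
    .seq (e.compile R R (fun _ => 0) (R + 2)) (replaceInput R)

theorem exists_transformInput_runsTo {R : ℕ} (hR : R ≠ 0) (t : ArithTerm) (e : Printer) :
    ∃ P : ℕ[X], ∀ B x ω s, BoundedBy B (x.getD · 0) (fun _ => x.length) →
      AgreeOn (Iio R) univ (initState x ω) s →
      RunsTo (transformInput R t e) s (P.eval B) fun s' =>
        AgreeOn (Iio R) (Iio R) (initState (e.out (x.getD · 0) fun _ => x.length) ω) s' ∧
          s'.reg (R + 1) = t.eval (x.getD · 0) fun _ => x.length := by
  obtain ⟨⟨P, hP⟩, ⟨Q, hQ⟩⟩ := And.intro t.exists_hasCost e.exists_hasCost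
  obtain ⟨⟨L, hL⟩, ⟨V, hV⟩⟩ := And.intro e.exists_length_out_le e.exists_mem_out_le
  refine ⟨P + (1 + (Q + (X + L + 2 + (2 + ((X + L + 1) * (X + L + 1 + 3 * (X + L + V + 3)) +
    (1 + (X + L + 2))))))), fun B x ω s hB hs => ?_⟩
  simp only [eval_add, eval_mul, eval_X, eval_one, eval_ofNat]
  have hload := (loaded_initState x ω).of_agreeOn hs (fun _ => mem_Iio.2 hR.bot_lt) (mem_univ 0)
  refine RunsTo.seq (hP hB (fun _ => by simp) hload) ?_
  rintro s₁ ⟨h₁, ht⟩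
  have hload₁ := hload.of_agreeOn h₁ (fun _ => by simp) (mem_univ 0)
  refine RunsTo.const.seq ?_
  rintro _ rfl
  have hload₂ : Loaded (x.getD · 0) (fun _ => x.length) (fun _ => 0) (s₁.setReg R 0) :=
    ⟨fun v => by simpa [hR.symm] using hload₁.reg v, hload₁.mem⟩
  have hempty : Holds R R [] (s₁.setReg R 0) := by
    refine ⟨fun i => ?_, by simp⟩
    simp [h₁.mem R (mem_univ R), hs.mem R (mem_univ R), initState_mem_of_ne hR]
  refine RunsTo.seq (hQ hB hR (Nat.lt_add_of_pos_right two_pos) (fun _ => by simp [hR.symm]) hload₂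
    hempty (Nat.zero_le B)) ?_
  rintro s₂ ⟨h₂, hl⟩
  have hag : AgreeOn (Iio R) (Iio R) (initState x ω) s₂ :=
    (hs.trans ((h₁.mono (Iio_subset_Iio (by omega)) subset_rfl))).mono subset_rfl (subset_univ _)
      |>.setReg (by simp) 0 |>.trans (h₂.mono
        (fun r hr => ⟨Iio_subset_Iio (by omega) hr, (mem_Iio.1 hr).ne⟩)
        fun a ha => (mem_Iio.1 ha).ne)
  refine (replaceInput_runsTo hR hag hl (hV B _ _ hB) (add_le_add (hB.2 0) (hL B _ _ hB))).mono
    le_rfl ?_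
  rintro s₃ ⟨h₃, hreg⟩
  exact ⟨h₃, by simpa [hreg, h₂.reg (R + 1) (by simp)] using ht⟩

/-- Decides whether the number held by register `R + 3` is at most the one held by register `R`. -/
def compareRegisters (R : ℕ) : Prog :=
  .seq (.sub (R + 3) (R + 3) R) (.ite (R + 3) (.const 0 0) (.const 0 1))

theorem compareRegisters_runsTo {R a b C D : ℕ} {s : State} (ha : s.reg (R + 3) = a)
    (hb : s.reg R = b) (hC : logCost a ≤ C) (hD : logCost b ≤ D) :
    RunsTo (compareRegisters R) s (C + D + (C + 2)) fun s' =>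
      s'.reg 0 = if a ≤ b then 1 else 0 := by
  refine (RunsTo.sub_of_logCost_le (by rw [ha, hb]; exact add_le_add hC hD)).seq ?_
  rintro _ rfl
  refine RunsTo.ite_of_logCost_le ?_ (fun h => ?_) fun h => ?_
  · simp only [State.setReg_reg, reduceIte, ha, hb]
    exact (Nat.succ_le_succ (Nat.size_le_size (Nat.sub_le _ _))).trans hC
  all_goals
    simp only [State.setReg_reg, reduceIte, ha, hb] at h
    refine RunsTo.const.mono (by omega) ?_
    rintro _ rfl
  · simp [show ¬ a ≤ b by omega]
  · simp [show a ≤ b by omega]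

/-- Decides whether the rational number with numerator `reg 0 - reg 1` and denominator `reg 2 + 1`
is at least `2⁻ᴱ`, where `E` is held by register `R + 1`. -/
def compareOutput (R : ℕ) : Prog :=
  .seq (.sub R 0 1) <| .seq (.const (R + 2) 1) <| .seq (.add (R + 3) 2 (R + 2)) <|
    .seq (.loop (R + 1) (.seq (.add R R R) (.sub (R + 1) (R + 1) (R + 2)))) <|
      compareRegisters R

/-- The invariant of the loop of `compareOutput` when `j` rounds are left: `w` is the final content
of register `R`, to be compared with `y`. -/
structure CompareInvariant (R y w j : ℕ) (s : State) : Prop where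
  counter : s.reg (R + 1) = j
  one : s.reg (R + 2) = 1
  other : s.reg (R + 3) = y
  doubled : s.reg R * 2 ^ j = w

theorem logCost_le_of_dvd_pow {a w j S : ℕ} (h : a * 2 ^ j = w) (hw : w.size ≤ S) :
    logCost a ≤ S + 1 :=
  Nat.succ_le_succ ((Nat.size_le_size
    (h ▸ Nat.le_mul_of_pos_right a (by positivity))).trans hw)

theorem size_mul_two_pow_le {a S : ℕ} (i : ℕ) (h : a.size ≤ S) : (a * 2 ^ i).size ≤ S + i := by
  rw [Nat.size_le] at *
  rw [pow_add]
  exact Nat.mul_lt_mul_of_pos_right h (by positivity)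

theorem CompareInvariant.step {R y w j E S : ℕ} {s : State} (hw : w.size ≤ S + E) (hj : j < E)
    (hs : CompareInvariant R y w (j + 1) s) :
    RunsTo (.seq (.add R R R) (.sub (R + 1) (R + 1) (R + 2))) s (2 * (S + E + 1) + (E + 3))
      (CompareInvariant R y w j) := by
  have hlog := logCost_le_of_dvd_pow hs.doubled hw
  refine (RunsTo.add_of_logCost_le (by omega)).seq ?_
  rintro _ rfl
  refine (RunsTo.sub (by simp [hs.counter, hs.one]; omega)).mono le_rfl ?_
  rintro _ rfl
  refine ⟨by simp [hs.counter, hs.one], by simp [hs.one], by simp [hs.other], ?_⟩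
  have := hs.doubled
  simp only [State.setReg_reg, Nat.add_eq_left, one_ne_zero, ↓reduceIte, OfNat.ofNat_ne_zero,
    Nat.left_eq_add]
  linear_combination this

theorem compareOutput_runsTo {R E S : ℕ} (hR : 3 ≤ R) {s : State} (hE : s.reg (R + 1) = E)
    (hS : ∀ r < 3, (s.reg r).size ≤ S) :
    RunsTo (compareOutput R) s (4 * (E + 2) * (S + E + 3)) fun s' =>
      s'.reg 0 = if s.reg 2 + 1 ≤ (s.reg 0 - s.reg 1) * 2 ^ E then 1 else 0 := by
  have hlog {r : ℕ} (hr : r < 3) : logCost (s.reg r) ≤ S + 1 := Nat.succ_le_succ (hS r hr)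
  have hdiff : (s.reg 0 - s.reg 1).size ≤ S :=
    (Nat.size_le_size (Nat.sub_le _ _)).trans (hS 0 (by omega))
  have hw := size_mul_two_pow_le E hdiff
  have hden : (s.reg 2 + 1).size ≤ S + 2 :=
    size_add_le ((hS 2 (by omega)).trans S.le_succ) (by simp)
  suffices h : RunsTo (compareOutput R) s (2 * (S + 1) + (2 + (S + 3 +
      ((E + 1) * (E + 1) + E * (2 * (S + E + 1) + (E + 3)) +
        (2 * S + E + 4 + (S + 3 + 2)))))) fun s' =>
          s'.reg 0 = if s.reg 2 + 1 ≤ (s.reg 0 - s.reg 1) * 2 ^ E then 1 else 0 from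
    h.mono (by ring_nf; nlinarith [Nat.zero_le (S * E)]) fun _ => id
  refine (RunsTo.sub_of_logCost_le (by
    linarith [hlog (r := 0) (by omega), hlog (r := 1) (by omega)])).seq ?_
  rintro _ rfl
  refine RunsTo.const.seq ?_
  rintro _ rfl
  have hR0 : R ≠ 0 := by omega
  have h2R : 2 ≠ R := by omega
  refine (RunsTo.add_of_logCost_le (by
    simpa [hR0, h2R, logCost] using hS 2 (by omega))).seq ?_
  rintro _ rfl
  refine (RunsTo.loop_of_logCost_le
    (CompareInvariant R (s.reg 2 + 1) ((s.reg 0 - s.reg 1) * 2 ^ E))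
    (fun _ _ hI => hI.counter) (fun j hj => (logCost_le j).trans (Nat.succ_le_succ hj))
    (fun j hj s' hI => hI.step hw hj)
    ⟨by simp [hE], by simp, by simp [hR0, h2R], by simp⟩).seq ?_
  intro s₁ h₁
  have hnum : s₁.reg R = (s.reg 0 - s.reg 1) * 2 ^ E := by simpa using h₁.doubled
  refine (compareRegisters_runsTo h₁.other hnum (Nat.succ_le_succ hden)
    (Nat.succ_le_succ hw)).mono (by omega) fun _ => id

/-- If the term `chk` vanishes on the input, rejects; otherwise runs `A` on the list printed by `e`
and decides whether the output is at least `2⁻ᴱ`, where `E` is the value of the term `t`. -/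
def decideProg (R : ℕ) (chk t : ArithTerm) (e : Printer) (A : Prog) : Prog :=
  .seq (chk.compile (fun _ => 0) R) <|
    .ite R (.seq (transformInput R t e) (.seq A (compareOutput R))) (.const 0 0)

section DecideProg

variable {R : ℕ} {A : Prog}

theorem boundedBy_input {x : List ℕ} {B : ℕ} (hlen : x.length ≤ B) (hx : ∀ a ∈ x, a ≤ B) :
    BoundedBy B (x.getD · 0) fun _ => x.length :=
  ⟨getD_zero_le hx, fun _ => hlen⟩

theorem boundedBy_length_add_sum (x : List ℕ) :
    BoundedBy (x.length + x.sum) (x.getD · 0) fun _ => x.length :=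
  boundedBy_input (Nat.le_add_right _ _) fun a ha =>
    (List.single_le_sum (by simp) a ha).trans (Nat.le_add_left _ _)

theorem sizeLE_initState {x : List ℕ} {B : ℕ} (hlen : x.length ≤ B) (hx : ∀ a ∈ x, a ≤ B)
    (ω : ℕ → Bool) : SizeLE B (initState x ω) := by
  have hsize {a : ℕ} (ha : a ≤ B) : a.size ≤ B :=
    (Nat.size_le.2 Nat.lt_two_pow_self).trans ha
  constructor
  · intro r
    by_cases hr : r = 0 <;> simp [initState, hr, hsize hlen]
  · intro a i
    rcases eq_or_ne a 0 with rfl | ha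
    · rw [initState_mem_zero]
      exact hsize (getD_zero_le hx i)
    · simp [initState_mem_of_ne ha]

theorem decideProg_reject (hR : R ≠ 0) {chk : ArithTerm} (t : ArithTerm) (e : Printer) (A : Prog)
    {x : List ℕ} (hchk : chk.eval (x.getD · 0) (fun _ => x.length) = 0) (ω : ℕ → Bool) :
    ∃ T s, Exec (decideProg R chk t e A) (initState x ω) T s ∧ s.reg 0 = 0 := by
  obtain ⟨P, hP⟩ := chk.exists_hasCost
  obtain ⟨T, s, hs, -, -, hreg⟩ := hP (boundedBy_length_add_sum x)
    (fun _ => mem_Iio.2 hR.bot_lt) (loaded_initState x ω)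
  exact ⟨_, _, .seq hs (.iteFalse (hreg.trans hchk) (.const _ _ _)), by simp⟩

theorem exists_decideProg_runsTo (hR : 3 ≤ R) (hA : A.bound ≤ R) (chk t : ArithTerm) (e : Printer) :
    ∃ P : ℕ[X], ∀ B x ω T s, BoundedBy B (x.getD · 0) (fun _ => x.length) →
      chk.eval (x.getD · 0) (fun _ => x.length) ≠ 0 →
      Exec A (initState (e.out (x.getD · 0) fun _ => x.length) ω) T s →
      RunsTo (decideProg R chk t e A) (initState x ω) (P.eval B * (T + 1)) fun s' =>
        s'.reg 0 = if s.reg 2 + 1 ≤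
          (s.reg 0 - s.reg 1) * 2 ^ t.eval (x.getD · 0) (fun _ => x.length) then 1 else 0 := by
  have hR0 : R ≠ 0 := by omega
  obtain ⟨⟨P, hP⟩, ⟨V, hV⟩⟩ := And.intro chk.exists_hasCost chk.exists_eval_le
  obtain ⟨⟨Q, hQ⟩, ⟨E, hE⟩⟩ :=
    And.intro (exists_transformInput_runsTo hR0 t e) t.exists_eval_le
  obtain ⟨⟨L, hL⟩, ⟨W, hW⟩⟩ := And.intro e.exists_length_out_le e.exists_mem_out_le
  refine ⟨P + (V + 1) + (Q + (1 + 4 * (E + 2) * (L + W + E + 3))), fun B x ω T s hB hchk hs => ?_⟩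
  suffices h : RunsTo (decideProg R chk t e A) (initState x ω) (P.eval B + (V.eval B + 1 +
      (Q.eval B + (T + 4 * (E.eval B + 2) * (L.eval B + W.eval B + T + E.eval B + 3)))))
      fun s' => s'.reg 0 = if s.reg 2 + 1 ≤
        (s.reg 0 - s.reg 1) * 2 ^ t.eval (x.getD · 0) (fun _ => x.length) then 1 else 0 by
    refine h.mono ?_ fun _ => id
    simp only [eval_add, eval_mul, eval_one, eval_ofNat]
    nlinarith [Nat.zero_le (T * P.eval B), Nat.zero_le (T * V.eval B), Nat.zero_le (T * Q.eval B),
      Nat.zero_le ((E.eval B + 2) * (L.eval B + W.eval B + E.eval B + 2) * T)]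
  refine RunsTo.seq (hP hB (fun _ => mem_Iio.2 hR0.bot_lt) (loaded_initState x ω)) ?_
  rintro s₁ ⟨h₁, hreg⟩
  have hregV : s₁.reg R ≤ V.eval B := hreg.trans_le (hV B _ _ hB)
  refine (RunsTo.ite (fun _ => ?_) fun h => absurd (hreg.symm.trans h) hchk).mono
    (Nat.add_le_add_right (Nat.succ_le_succ hregV) _) fun _ => id
  refine (hQ B x ω s₁ hB h₁).seq ?_
  rintro s₂ ⟨h₂, ht⟩
  obtain ⟨s₃, he₃, h₃, hreg₃⟩ := hs.exists_of_agreeOn hA h₂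
  have hA₃ : RunsTo A s₂ T (· = s₃) := ⟨T, s₃, he₃, le_rfl, rfl⟩
  refine hA₃.seq ?_
  rintro _ rfl
  have hsize := hs.sizeLE (sizeLE_initState ((hL B _ _ hB).trans (Nat.le_add_right _ (W.eval B)))
    (fun y hy => (hW B _ _ hB y hy).trans (Nat.le_add_left _ _)) ω)
  have hEB := hE B _ _ hB
  refine (compareOutput_runsTo hR ((hreg₃ (R + 1) (by omega)).trans ht) fun r hr => ?_).mono
    (by gcongr) fun s₄ h => ?_
  · rw [h₃.reg r (mem_Iio.2 (by omega))]
    exact hsize.reg r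
  · rw [h, h₃.reg 0 (mem_Iio.2 (by omega)), h₃.reg 1 (mem_Iio.2 (by omega)),
      h₃.reg 2 (mem_Iio.2 (by omega))]

end DecideProg

/-! ## Running times -/

theorem time_le_iff {p : Prog} {x : List ℕ} {ω : ℕ → Bool} {N : ℕ} :
    p.time x ω ≤ N ↔ ∃ T s, Exec p (initState x ω) T s ∧ T ≤ N := by
  constructor
  · intro h
    by_contra! hN
    have : ((N + 1 : ℕ) : ℕ∞) ≤ p.time x ω :=
      le_iInf₂ fun T ⟨s, hs⟩ => Nat.cast_le.2 (hN T s hs)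
    exact absurd (Nat.cast_le.1 (this.trans h)) N.not_succ_le_self
  · rintro ⟨T, s, hs, hT⟩
    exact (iInf₂_le T ⟨s, hs⟩).trans (Nat.cast_le.2 hT)

theorem worstTime_le_iff {p : Prog} {I : Set (List ℕ)} {N : ℕ∞} :
    p.worstTime I ≤ N ↔ ∀ x ∈ I, ∀ ω, p.time x ω ≤ N := by
  simp only [Prog.worstTime, iSup_le_iff]

theorem monotone_worstTime (p : Prog) : Monotone p.worstTime :=
  fun _ _ h => biSup_mono h

theorem toENNReal_le_ofReal_iff {a : ℕ∞} {y : ℝ} :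
    (a : ℝ≥0∞) ≤ ENNReal.ofReal y ↔ a ≤ ⌊y⌋₊ := by
  induction a with
  | top => simp
  | coe a =>
    rw [ENat.toENNReal_coe, Nat.cast_le]
    rcases eq_or_ne a 0 with rfl | ha
    · simp
    · rw [ENNReal.natCast_le_ofReal ha, Nat.le_floor_iff' ha]

theorem IsBigOExp.exists_forall_le {f : ℕ → ℕ∞} {t : ℝ} (h : IsBigOExp f t) (hf : Monotone f) :
    ∃ c : ℝ, 0 ≤ c ∧ ∀ n, f n ≤ ⌊c * 2 ^ (t * n)⌋₊ := by
  obtain ⟨c, n₀, hc⟩ := h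
  refine ⟨|c| * 2 ^ (t * n₀), by positivity, fun n => ?_⟩
  rw [← toENNReal_le_ofReal_iff]
  refine (ENat.toENNReal_le.2 (hf (Nat.le_add_right n n₀))).trans
    ((hc _ (Nat.le_add_left n₀ n)).trans (ENNReal.ofReal_le_ofReal ?_))
  rw [mul_assoc, ← Real.rpow_add two_pos, ← mul_add, Nat.cast_add, add_comm (n₀ : ℝ)]
  gcongr
  exact le_abs_self c

theorem exists_poly_le_pow (p : Polynomial ℕ) {r : ℝ} (hr : 1 < r) :
    ∃ c : ℝ, 0 ≤ c ∧ ∀ n : ℕ, ((p.eval n : ℕ) : ℝ) ≤ c * r ^ n := by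
  have : 0 < r := one_pos.trans hr
  induction p using Polynomial.induction_on' with
  | add p q hp hq =>
    obtain ⟨c, hc, h⟩ := hp
    obtain ⟨c', hc', h'⟩ := hq
    refine ⟨c + c', by positivity, fun n => ?_⟩
    rw [Polynomial.eval_add, Nat.cast_add, add_mul]
    exact add_le_add (h n) (h' n)
  | monomial k a =>
    obtain ⟨c, hc⟩ := (tendsto_pow_const_div_const_pow_of_one_lt k hr).bddAbove_range
    have hcn : ∀ n : ℕ, (n : ℝ) ^ k ≤ c * r ^ n := fun n => by
      have := hc ⟨n, rfl⟩
      rwa [div_le_iff₀ (by positivity)] at this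
    have hc0 : 0 ≤ c := by
      have := hc ⟨0, rfl⟩
      refine le_trans ?_ this
      positivity
    refine ⟨a * c, by positivity, fun n => ?_⟩
    rw [Polynomial.eval_monomial, Nat.cast_mul, Nat.cast_pow, mul_assoc]
    exact mul_le_mul_of_nonneg_left (hcn n) (by positivity)

theorem le_mul_two_pow_iff (a b c E : ℕ) :
    c + 1 ≤ (a - b) * 2 ^ E ↔ ((2 : ℝ) ^ E)⁻¹ ≤ ((a : ℝ) - b) / ((c : ℝ) + 1) := by
  have hc : (0 : ℝ) < (c : ℝ) + 1 := by positivity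
  have h2 : (0 : ℝ) < 2 ^ E := by positivity
  rw [le_div_iff₀ hc, inv_mul_le_iff₀ h2]
  rcases le_total b a with h | h
  · rw [← Nat.cast_sub h, mul_comm (2 ^ E : ℝ)]
    exact_mod_cast Iff.rfl
  · rw [Nat.sub_eq_zero_of_le h, zero_mul]
    have : (a : ℝ) - b ≤ 0 := by
      rw [sub_nonpos]; exact_mod_cast h
    constructor
    · intro h; omega
    · intro h
      nlinarith

theorem exists_two_pow_between {δ : ℝ} (h0 : 0 < δ) (h1 : δ < 1 / 2) (M : ℕ) :
    ∃ e : ℕ, 2 * δ⁻¹ ^ (M + 1) ≤ 2 ^ e ∧ (2 : ℝ) ^ e ≤ δ⁻¹ ^ (M + 3) := by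
  have hd : 2 ≤ δ⁻¹ := by
    rw [le_inv_comm₀ two_pos h0]; linarith
  have hp : 1 ≤ δ⁻¹ ^ (M + 1) := one_le_pow₀ (by linarith)
  obtain ⟨n, hn, hn'⟩ := exists_nat_pow_near (x := 2 * δ⁻¹ ^ (M + 1)) (y := 2) (by linarith)
    one_lt_two
  refine ⟨n + 1, hn'.le, ?_⟩
  rw [pow_succ, show M + 3 = M + 1 + 2 by rfl, pow_add _ (M + 1) 2]
  nlinarith [mul_le_mul hd hd (by norm_num) (by linarith)]

section Threshold

variable {δ : ℝ} {M e g : ℕ}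

theorem half_pow_le_threshold (h0 : 0 < δ) (he : (2 : ℝ) ^ e ≤ δ⁻¹ ^ (M + 3)) :
    δ ^ ((M + 3) * g) / 2 ≤ ((2 : ℝ) ^ (e * g))⁻¹ := by
  have h1 : δ ^ (M + 3) ≤ ((2 : ℝ) ^ e)⁻¹ := by
    rw [le_inv_comm₀ (by positivity) (by positivity), ← inv_pow]; exact he
  have h2 : δ ^ ((M + 3) * g) ≤ ((2 : ℝ) ^ (e * g))⁻¹ := by
    rw [pow_mul, pow_mul, ← inv_pow]
    exact pow_le_pow_left₀ (by positivity) h1 g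
  have : 0 < δ ^ ((M + 3) * g) := by positivity
  linarith

theorem threshold_le (h0 : 0 < δ) (h1 : δ < 1 / 2) (hg : 1 ≤ g)
    (he : 2 * δ⁻¹ ^ (M + 1) ≤ (2 : ℝ) ^ e) :
    ((2 : ℝ) ^ (e * g))⁻¹ ≤ δ ^ (M * g + 1) - δ ^ ((M + 3) * g) / 2 := by
  have h2 : ((2 : ℝ) ^ e)⁻¹ ≤ 2⁻¹ * δ ^ (M + 1) := by
    rw [inv_le_comm₀ (by positivity) (by positivity), mul_inv, inv_inv, ← inv_pow]
    exact he
  have hle : ∀ a b : ℕ, a ≤ b → δ ^ b ≤ δ ^ a := fun a b hab =>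
    pow_le_pow_of_le_one h0.le (by linarith) hab
  have h3 : ((2 : ℝ) ^ (e * g))⁻¹ ≤ 2⁻¹ * δ ^ (M * g + 1) := by
    calc ((2 : ℝ) ^ (e * g))⁻¹ = (((2 : ℝ) ^ e)⁻¹) ^ g := by rw [pow_mul, inv_pow]
      _ ≤ (2⁻¹ * δ ^ (M + 1)) ^ g := pow_le_pow_left₀ (by positivity) h2 g
      _ = 2⁻¹ ^ g * δ ^ ((M + 1) * g) := by rw [mul_pow, ← pow_mul]
      _ ≤ 2⁻¹ ^ 1 * δ ^ (M * g + 1) := by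
        refine mul_le_mul (pow_le_pow_of_le_one (by norm_num) (by norm_num) hg)
          (hle _ _ (by nlinarith)) (by positivity) (by positivity)
      _ = _ := by rw [pow_one]
  have h4 := hle (M * g + 1) ((M + 3) * g) (by nlinarith)
  linarith

end Threshold

theorem exists_mul_floor_le (Q : ℕ[X]) {t s c : ℝ} (ht : 0 < t) (hc : 0 ≤ c) {M : ℕ} (hM : 1 ≤ M)
    (hs : t * (M + 3) < s * M) (g₀ : ℕ) : ∃ c' : ℝ, ∀ n : ℕ,
      ((Q.eval n * (⌊c * 2 ^ (t * ((M + 3) * (g₀ + n / M + 1) : ℕ))⌋₊ + 1) : ℕ) : ℝ) ≤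
        c' * 2 ^ (s * n) := by
  have hM0 : (0 : ℝ) < M := by exact_mod_cast hM
  set u : ℝ := t * (M + 3) / M with hu
  set b : ℝ := t * ((M + 3) * (g₀ + 1)) with hb
  have hus : u < s := by rwa [hu, div_lt_iff₀ hM0]
  obtain ⟨q, hq, hQ⟩ := exists_poly_le_pow Q (r := 2 ^ (s - u))
    (Real.one_lt_rpow one_lt_two (sub_pos.2 hus))
  refine ⟨q * (c * 2 ^ b + 1), fun n => ?_⟩
  have hexp : t * ((M + 3) * (g₀ + n / M + 1) : ℕ) ≤ b + u * n :=
    calc t * (((M + 3) * (g₀ + n / M + 1) : ℕ) : ℝ)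
        = t * ((M + 3) * (g₀ + (n / M : ℕ) + 1)) := by push_cast; rfl
      _ ≤ t * ((M + 3) * (g₀ + n / M + 1)) := by gcongr; exact Nat.cast_div_le
      _ = b + u * n := by rw [hu, hb]; ring
  have hfloor : (⌊c * 2 ^ (t * ((M + 3) * (g₀ + n / M + 1) : ℕ))⌋₊ : ℝ) + 1 ≤
      (c * 2 ^ b + 1) * 2 ^ (u * n) :=
    calc (⌊c * 2 ^ (t * ((M + 3) * (g₀ + n / M + 1) : ℕ))⌋₊ : ℝ) + 1
        ≤ c * 2 ^ (b + u * n) + 2 ^ (u * n) := by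
          refine add_le_add ((Nat.floor_le (by positivity)).trans ?_)
            (Real.one_le_rpow one_le_two (by positivity))
          gcongr
          exact one_le_two
      _ = (c * 2 ^ b + 1) * 2 ^ (u * n) := by rw [Real.rpow_add two_pos]; ring
  calc ((Q.eval n * (⌊c * 2 ^ (t * ((M + 3) * (g₀ + n / M + 1) : ℕ))⌋₊ + 1) : ℕ) : ℝ)
      ≤ (q * (2 ^ (s - u)) ^ n) * ((c * 2 ^ b + 1) * 2 ^ (u * n)) := by
        rw [Nat.cast_mul, Nat.cast_succ]
        exact mul_le_mul (hQ n) hfloor (by positivity) (by positivity)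
    _ = q * (c * 2 ^ b + 1) * (2 ^ ((s - u) * n) * 2 ^ (u * n)) := by
        rw [Real.rpow_mul two_pos.le (s - u), Real.rpow_natCast]; ring
    _ = q * (c * 2 ^ b + 1) * 2 ^ (s * n) := by
        rw [← Real.rpow_add two_pos, ← add_mul, sub_add_cancel]

/-! ## The reduction -/

section DecideProg

variable {R k : ℕ} {A : Prog} {chk : ArithTerm} {x : List ℕ}

theorem decideProg_outputsNat (hR : 3 ≤ R) (hA : A.bound ≤ R) (t : ArithTerm) (e : Printer)
    (hchk : chk.eval (x.getD · 0) (fun _ => x.length) ≠ 0) {ω : ℕ → Bool} {v : ℝ}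
    (h : A.OutputsReal (e.out (x.getD · 0) fun _ => x.length) ω v) :
    (decideProg R chk t e A).OutputsNat x ω
      (if ((2 : ℝ) ^ t.eval (x.getD · 0) fun _ => x.length)⁻¹ ≤ v then 1 else 0) := by
  obtain ⟨P, hP⟩ := exists_decideProg_runsTo hR hA chk t e
  obtain ⟨T, s, hs, rfl⟩ := h
  obtain ⟨T', s', hs', -, hreg⟩ := hP _ x ω T s (boundedBy_length_add_sum x) hchk hs
  refine ⟨T', s', hs', hreg.trans ?_⟩
  simp only [le_mul_two_pow_iff]

theorem decidesKSAT_decideProg (hR : 3 ≤ R) (hA : A.bound ≤ R) {t : ArithTerm} {e : Printer}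
    (hchk : ∀ x : List ℕ, chk.eval (x.getD · 0) (fun _ => x.length) ≠ 0 ↔ Valid k x)
    (hhalts : ∀ n, ∀ α ∈ kCNF k n, ∀ x, Presents x α → ∀ ω,
      A.Halts (e.out (x.getD · 0) fun _ => x.length) ω)
    (hout : ∀ n, ∀ α ∈ kCNF k n, ∀ x, Presents x α → 2 / 3 ≤ coinMeasure {ω | ∃ v,
      A.OutputsReal (e.out (x.getD · 0) fun _ => x.length) ω v ∧
        (((2 : ℝ) ^ t.eval (x.getD · 0) fun _ => x.length)⁻¹ ≤ v ↔ α.Satisfiable)}) :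
    DecidesKSAT k (decideProg R chk t e A) := by
  have hvalid {n α x} (hα : α ∈ kCNF k n) (hx : Presents x α) :
      chk.eval (x.getD · 0) (fun _ => x.length) ≠ 0 :=
    (hchk x).2 (valid_iff_exists_presents.2 ⟨n, α, hα, hx⟩)
  refine ⟨fun n α hα x hx ω => ?_, fun n α hα x hx => ⟨fun hsat => ?_, fun hsat => ?_⟩,
    fun x hx => ?_⟩
  · obtain ⟨T, s, hs⟩ := hhalts n α hα x hx ω
    obtain ⟨T', s', hs', -⟩ := decideProg_outputsNat hR hA t e (hvalid hα hx) ⟨T, s, hs, rfl⟩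
    exact ⟨T', s', hs'⟩
  · refine (hout n α hα x hx).trans (measure_mono fun ω ⟨v, hv, hiff⟩ => ?_)
    simpa only [if_pos (hiff.2 hsat), mem_ofPred_eq] using
      decideProg_outputsNat hR hA t e (hvalid hα hx) hv
  · refine (hout n α hα x hx).trans (measure_mono fun ω ⟨v, hv, hiff⟩ => ?_)
    simpa only [if_neg (hiff.not.2 hsat), mem_ofPred_eq] using
      decideProg_outputsNat hR hA t e (hvalid hα hx) hv
  · have hinvalid : chk.eval (x.getD · 0) (fun _ => x.length) = 0 := by
      by_contra h
      obtain ⟨n, α, hα, hp⟩ := valid_iff_exists_presents.1 ((hchk x).1 h)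
      exact hx n α hα hp
    have hempty : {ω | (decideProg R chk t e A).OutputsNat x ω 1} = ∅ := by
      refine eq_empty_of_forall_notMem fun ω ⟨T, s, hs, h1⟩ => ?_
      obtain ⟨T', s', hs', h0⟩ := decideProg_reject (by omega : R ≠ 0) t e A hinvalid ω
      rw [(hs.det hs').2, h0] at h1
      exact zero_ne_one h1
    rw [hempty, measure_empty]
    exact zero_le

theorem Presents.boundedBy {C n : ℕ} {α : CNF} (hx : Presents x α) (hα : α ∈ sparseCNF C k n) :
    BoundedBy ((C * (k + 1) + 2) * n + 1) (x.getD · 0) fun _ => x.length := by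
  have hcard : α.card * (k + 1) ≤ C * n * (k + 1) := Nat.mul_le_mul_right _ hα.2
  have hB : (C * (k + 1) + 2) * n = C * n * (k + 1) + 2 * n := by ring
  exact boundedBy_input ((hx.length_le hα.1).trans (by omega)) fun a ha =>
    (hx.le_of_mem hα.1 ha).trans (by omega)

theorem exists_worstTime_decideProg_le (hR : 3 ≤ R) (hA : A.bound ≤ R) (t : ArithTerm)
    (e : Printer) (C : ℕ)
    (hchk : ∀ x : List ℕ, chk.eval (x.getD · 0) (fun _ => x.length) ≠ 0 ↔ Valid k x) :
    ∃ Q : ℕ[X], ∀ n T : ℕ,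
      (∀ α ∈ sparseCNF C k n, ∀ x, Presents x α → ∀ ω,
        A.time (e.out (x.getD · 0) fun _ => x.length) ω ≤ T) →
      (decideProg R chk t e A).worstTime {x | ∃ α ∈ sparseCNF C k n, Presents x α} ≤
        (Q.eval n * (T + 1) : ℕ) := by
  obtain ⟨P, hP⟩ := exists_decideProg_runsTo hR hA chk t e
  refine ⟨P.comp (((C * (k + 1) + 2 : ℕ) : ℕ[X]) * X + 1), fun n T hT => worstTime_le_iff.2 ?_⟩
  rintro x ⟨α, hα, hx⟩ ω
  obtain ⟨T', s, hs, hT'⟩ := time_le_iff.1 (hT α hα x hx ω)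
  obtain ⟨T'', s'', hs'', hT'', -⟩ := hP _ x ω T' s (hx.boundedBy hα)
    ((hchk x).2 (valid_iff_exists_presents.2 ⟨n, α, hα.1, hx⟩)) hs
  refine time_le_iff.2 ⟨T'', s'', hs'', hT''.trans ?_⟩
  simp only [eval_comp, eval_add, eval_mul, eval_X, eval_one, eval_natCast, Nat.cast_id]
  gcongr

end DecideProg

/-- The network whose integral decides whether the formula listed by `x` is satisfiable. It lies
in the input class of index `(M + 3) * scale (e₀ + d + 5) C M x`; the summand `3` of `M + 3` makes
room for the constant overheads, and `K` is the factor in the bound for the widths. -/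
noncomputable def formulaNet (δ : ℝ) (d C M e₀ K : ℕ) (x : List ℕ) : Network d 1 :=
  satNet δ d (K * (M + 3) * scale (e₀ + d + 5) C M x) (M * scale (e₀ + d + 5) C M x) e₀
    (x.count 0) fun c => (clauseList x c).toFinset

section FormulaNet

variable {x : List ℕ} {α : CNF} {k n d C wr Lr M e₀ K : ℕ} {δ : ℝ} {θ : Finset ℝ}

theorem Printer.out_network_scaleTerm (hC : 1 ≤ C) (hM : 1 ≤ M) :
    (Printer.network θ δ d e₀ M (K * (M + 3)) (ArithTerm.scaleTerm (e₀ + d + 5) C M)).out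
      (x.getD · 0) (fun _ => x.length) = (formulaNet δ d C M e₀ K x).encode θ :=
  Printer.out_network (fun _ hσ => ArithTerm.eval_scaleTerm hC hM hσ) rfl

theorem le_scale (hC : 1 ≤ C) (hM : 1 ≤ M) (g₀ : ℕ) (x : List ℕ) : g₀ ≤ scale g₀ C M x :=
  (admissible_scale hC hM g₀ x).le

theorem two_mul_le_width (hK : 2 ≤ K) (M g : ℕ) : 2 * (M * g) + 6 * g ≤ K * (M + 3) * g :=
  calc 2 * (M * g) + 6 * g = 2 * (M + 3) * g := by ring
    _ ≤ K * (M + 3) * g := by gcongr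

theorem formulaNet_mem_inputClass (hα : α ∈ kCNF k n) (hx : Presents x α)
    (hθ : curveWeights δ ⊆ θ) (hd : 1 ≤ d) (hk : 1 ≤ k) (hC : 1 ≤ C) (hwr : 1 ≤ wr)
    (hLr : 1 ≤ Lr) (hM : 1 ≤ M) :
    formulaNet δ d C M e₀ (max 2 (C * wr * k)) x ∈
      inputClass d k C wr Lr θ ((M + 3) * scale (e₀ + d + 5) C M x) \
        inputClass d k C wr Lr θ ((M + 3) * scale (e₀ + d + 5) C M x - 1) := by
  obtain ⟨hg, hcount, -⟩ := admissible_scale hC hM (e₀ + d + 5) x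
  rw [formulaNet]
  generalize scale (e₀ + d + 5) C M x = g at hg hcount ⊢
  have hn : (M + 3) * g = M * g + 3 * g := add_mul ..
  have hwidth := two_mul_le_width (le_max_left 2 (C * wr * k)) M g
  have hCK : C ≤ max 2 (C * wr * k) :=
    le_max_of_le_right ((Nat.le_mul_of_pos_right C hwr).trans (Nat.le_mul_of_pos_right _ hk))
  refine satNet_mem_inputClass hθ hd (by omega) (mul_assoc ..) (by omega) ?_ ?_ (by omega)
  · rw [hx.count_zero hα]
    exact hα.1.card_pos
  · calc x.count 0 ≤ C * M * g := hcount
      _ ≤ max 2 (C * wr * k) * (M + 3) * g := by gcongr; omega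

theorem code_le_of_mem_clauseList (hC : 1 ≤ C) (hM : 1 ≤ M) (g₀ : ℕ) {c : ℕ} {l : Literal}
    (hl : l ∈ clauseList x c) : l.code ≤ 2 * (M * scale g₀ C M x) + 1 := by
  obtain ⟨i, hi, -, -, rfl⟩ := mem_clauseList.1 hl
  rw [code_decodeLit, ← mul_assoc, List.getD_eq_getElem _ _ hi]
  exact (admissible_scale hC hM g₀ x).entry_le _ (List.getElem_mem hi)

theorem fst_mem_Icc_of_mem_clauseList (hα : α ∈ kCNF k n) (hx : Presents x α) (hC : 1 ≤ C)
    (hM : 1 ≤ M) (g₀ : ℕ) {c : ℕ} (hc : c < x.count 0) {l : Literal}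
    (hl : l ∈ (clauseList x c).toFinset) : l.1 ∈ Icc 1 (M * scale g₀ C M x) := by
  have hmem : (clauseList x c).toFinset ∈ α := hx.formula_eq hα ▸
    Finset.mem_image_of_mem (fun c => (clauseList x c).toFinset) (Finset.mem_range.2 hc)
  have hcode := code_le_of_mem_clauseList hC hM g₀ (List.mem_toFinset.1 hl)
  rw [Literal.code] at hcode
  exact ⟨((hα.2 _ hmem).2.2 l hl).1, by omega⟩

theorem integral_formulaNet_eq_zero (hα : α ∈ kCNF k n) (hx : Presents x α) (h0 : 0 ≤ δ)
    (hd : 1 ≤ d) (hC : 1 ≤ C) (hM : 1 ≤ M) (hK : 2 ≤ K) (hun : ¬ α.Satisfiable) :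
    ∫ y in Icc (0 : Fin d → ℝ) 1, (formulaNet δ d C M e₀ K x).realize y 0 = 0 := by
  have hwidth := two_mul_le_width hK M (scale (e₀ + d + 5) C M x)
  have hg := le_scale hC hM (e₀ + d + 5) x
  refine integral_satNet_eq_zero hd (by omega) h0
    (fun c hc l hl => fst_mem_Icc_of_mem_clauseList hα hx hC hM _ hc hl) ?_
  rwa [← formula, hx.formula_eq hα]

theorem le_integral_formulaNet (hα : α ∈ kCNF k n) (hx : Presents x α) (h0 : 0 < δ)
    (h1 : δ < 1 / 2) (he : 1 ≤ δ⁻¹ ^ e₀ * (1 - 2 * δ)) (hd : 1 ≤ d) (hC : 1 ≤ C) (hM : 1 ≤ M)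
    (hK : 2 ≤ K) (hsat : α.Satisfiable) : δ ^ (M * scale (e₀ + d + 5) C M x + 1) ≤
      ∫ y in Icc (0 : Fin d → ℝ) 1, (formulaNet δ d C M e₀ K x).realize y 0 := by
  have hwidth := two_mul_le_width hK M (scale (e₀ + d + 5) C M x)
  have hg := le_scale hC hM (e₀ + d + 5) x
  refine le_integral_satNet hd (by omega) h0 h1 he
    (fun c hc l hl => fst_mem_Icc_of_mem_clauseList hα hx hC hM _ hc hl) (fun c _ l hl => ?_) ?_
  · have := code_le_of_mem_clauseList hC hM (e₀ + d + 5) (List.mem_toFinset.1 hl)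
    rw [litNeuron]
    omega
  · rwa [← formula, hx.formula_eq hα]

theorem threshold_le_iff_satisfiable {e : ℕ} {v : ℝ} (hα : α ∈ kCNF k n) (hx : Presents x α)
    (h0 : 0 < δ) (h1 : δ < 1 / 2) (he₀ : 1 ≤ δ⁻¹ ^ e₀ * (1 - 2 * δ))
    (he : 2 * δ⁻¹ ^ (M + 1) ≤ 2 ^ e ∧ (2 : ℝ) ^ e ≤ δ⁻¹ ^ (M + 3)) (hd : 1 ≤ d) (hC : 1 ≤ C)
    (hM : 1 ≤ M) (hK : 2 ≤ K)
    (hv : |v - ∫ y in Icc (0 : Fin d → ℝ) 1, (formulaNet δ d C M e₀ K x).realize y 0| <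
      δ ^ ((M + 3) * scale (e₀ + d + 5) C M x) / 2) :
    ((2 : ℝ) ^ (e * scale (e₀ + d + 5) C M x))⁻¹ ≤ v ↔ α.Satisfiable := by
  rw [abs_lt] at hv
  by_cases hsat : α.Satisfiable
  · have hg : 1 ≤ scale (e₀ + d + 5) C M x := le_trans (by omega) (le_scale hC hM _ x)
    refine iff_of_true ?_ hsat
    linarith [le_integral_formulaNet hα hx h0 h1 he₀ hd hC hM hK hsat, threshold_le h0 h1 hg he.1]
  · refine iff_of_false (not_le.2 ?_) hsat
    rw [integral_formulaNet_eq_zero hα hx h0.le hd hC hM hK hsat] at hv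
    linarith [half_pow_le_threshold (g := scale (e₀ + d + 5) C M x) h0 he.2]

theorem Presents.scale_le (hx : Presents x α) (hα : α ∈ sparseCNF C k n) (hM : 1 ≤ M)
    (g₀ : ℕ) : scale g₀ C M x ≤ g₀ + n / M + 1 := by
  have hn : n ≤ M * (g₀ + n / M + 1) := by
    have := Nat.lt_mul_div_succ n hM
    have : M * (n / M + 1) ≤ M * (g₀ + n / M + 1) := Nat.mul_le_mul_left _ (by omega)
    omega
  refine Nat.sInf_le ⟨le_self_add.trans (add_assoc ..).ge, ?_, fun a ha => ?_⟩
  · rw [hx.count_zero hα.1, mul_assoc]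
    exact hα.2.trans (Nat.mul_le_mul_left _ hn)
  · have := hx.le_of_mem hα.1 ha
    rw [mul_assoc]
    omega

end FormulaNet

theorem exists_one_le_inv_pow_mul {δ : ℝ} (h0 : 0 < δ) (h1 : δ < 1 / 2) :
    ∃ e₀ : ℕ, 1 ≤ δ⁻¹ ^ e₀ * (1 - 2 * δ) := by
  have hpos : 0 < 1 - 2 * δ := by linarith
  obtain ⟨e₀, he⟩ := pow_unbounded_of_one_lt (1 - 2 * δ)⁻¹ ((one_lt_inv₀ h0).2 (by linarith))
  exact ⟨e₀, ((inv_lt_iff_one_lt_mul₀ hpos).1 he).le⟩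

theorem exists_mul_add_three_lt {t s : ℝ} (ht : 0 < t) (hs : t < s) :
    ∃ M : ℕ, 1 ≤ M ∧ t * (M + 3) < s * M := by
  obtain ⟨M, hM⟩ := exists_nat_gt (3 * t / (s - t))
  rw [div_lt_iff₀ (sub_pos.2 hs)] at hM
  refine ⟨M, Nat.one_le_iff_ne_zero.2 ?_, by linarith⟩
  rintro rfl
  rw [Nat.cast_zero, zero_mul] at hM
  linarith

/-- The program that decides whether the formula listed by the input is satisfiable, by running
the integration program `A` on `formulaNet` and comparing its output with `2 ^ (-e * scale)`. -/
noncomputable def satProg (δ : ℝ) (θ : Finset ℝ) (d k C M e₀ e K : ℕ) (A : Prog) : Prog :=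
  decideProg (A.bound + 3) (.checkTerm k) (.smul e (.scaleTerm (e₀ + d + 5) C M))
    (.network θ δ d e₀ M (K * (M + 3)) (.scaleTerm (e₀ + d + 5) C M)) A

section SatProg

variable {d k C wr Lr M e₀ e : ℕ} {δ : ℝ} {θ : Finset ℝ} {A : Prog}

theorem checkTerm_eval_ne_zero_iff (x : List ℕ) :
    (ArithTerm.checkTerm k).eval (x.getD · 0) (fun _ => x.length) ≠ 0 ↔ Valid k x :=
  ArithTerm.checkTerm_holds rfl k

theorem decidesKSAT_satProg (hd : 1 ≤ d) (hk : 1 ≤ k) (hC : 1 ≤ C) (hwr : 1 ≤ wr)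
    (hLr : 1 ≤ Lr) (hδ₀ : 0 < δ) (hδ : δ < 1 / 2) (hθ : curveWeights δ ⊆ θ)
    (hA : ∀ n : ℕ, 1 ≤ n →
      ∀ Φ ∈ inputClass d k C wr Lr θ n \ inputClass d k C wr Lr θ (n - 1),
        2 / 3 ≤ coinMeasure {ω | ∃ v : ℝ, A.OutputsReal (Φ.encode θ) ω v ∧
          |v - ∫ x in Icc (0 : Fin d → ℝ) 1, Φ.realize x 0| < δ ^ n / 2})
    (hhalts : ∀ n, ∀ Φ ∈ inputClass d k C wr Lr θ n, ∀ ω, A.Halts (Φ.encode θ) ω)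
    (hM : 1 ≤ M) (he₀ : 1 ≤ δ⁻¹ ^ e₀ * (1 - 2 * δ))
    (he : 2 * δ⁻¹ ^ (M + 1) ≤ 2 ^ e ∧ (2 : ℝ) ^ e ≤ δ⁻¹ ^ (M + 3)) :
    DecidesKSAT k (satProg δ θ d k C M e₀ e (max 2 (C * wr * k)) A) := by
  refine decidesKSAT_decideProg (Nat.le_add_left _ _) (Nat.le_add_right _ _)
    checkTerm_eval_ne_zero_iff (fun n α hα x hx ω => ?_) (fun n α hα x hx => ?_)
  · rw [Printer.out_network_scaleTerm hC hM]
    exact hhalts _ _ (formulaNet_mem_inputClass hα hx hθ hd hk hC hwr hLr hM).1 ω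
  · have hpos : 0 < (M + 3) * scale (e₀ + d + 5) C M x :=
      Nat.mul_pos (by omega) (lt_of_lt_of_le (by omega) (le_scale hC hM _ x))
    refine (hA _ hpos _ (formulaNet_mem_inputClass hα hx hθ hd hk hC hwr hLr hM)).trans
      (measure_mono ?_)
    rintro ω ⟨v, hv, herr⟩
    rw [mem_ofPred_eq, Printer.out_network_scaleTerm hC hM, ArithTerm.eval_smul,
      ArithTerm.eval_scaleTerm hC hM rfl]
    exact ⟨v, hv,
      threshold_le_iff_satisfiable hα hx hδ₀ hδ he₀ he hd hC hM (le_max_left _ _) herr⟩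

theorem isBigOExp_satProg (hd : 1 ≤ d) (hk : 1 ≤ k) (hC : 1 ≤ C) (hwr : 1 ≤ wr) (hLr : 1 ≤ Lr)
    (hθ : curveWeights δ ⊆ θ) {t s c : ℝ} (ht : 0 < t) (hc : 0 ≤ c)
    (hA : ∀ n : ℕ, ∀ Φ ∈ inputClass d k C wr Lr θ n, ∀ ω,
      A.time (Φ.encode θ) ω ≤ ⌊c * 2 ^ (t * n)⌋₊)
    (hM : 1 ≤ M) (hs : t * (M + 3) < s * M) :
    IsBigOExp (fun n => (satProg δ θ d k C M e₀ e (max 2 (C * wr * k)) A).worstTime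
      {x | ∃ α ∈ sparseCNF C k n, Presents x α}) s := by
  obtain ⟨Q, hQ⟩ := exists_worstTime_decideProg_le (Nat.le_add_left 3 A.bound)
    (Nat.le_add_right _ _) (.smul e (.scaleTerm (e₀ + d + 5) C M))
    (.network θ δ d e₀ M (max 2 (C * wr * k) * (M + 3)) (.scaleTerm (e₀ + d + 5) C M)) C
    (checkTerm_eval_ne_zero_iff (k := k))
  obtain ⟨c', hc'⟩ := exists_mul_floor_le Q ht hc hM hs (e₀ + d + 5)
  refine ⟨c', 0, fun n _ => toENNReal_le_ofReal_iff.2 ((hQ n _ fun α hα x hx ω => ?_).trans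
    (Nat.cast_le.2 (Nat.le_floor (hc' n))))⟩
  rw [Printer.out_network_scaleTerm hC hM]
  refine hA _ _ (monotone_inputClass ?_
    (formulaNet_mem_inputClass hα.1 hx hθ hd hk hC hwr hLr hM).1) ω
  exact Nat.mul_le_mul_left _ (hx.scale_le hα hM _)

end SatProg

end QuadHard

theorem theorem3p12_general
    (d k C wr Lr : ℕ) (hd : 1 ≤ d) (hk : 1 ≤ k) (hC : 1 ≤ C) (hwr : 1 ≤ wr) (hLr : 1 ≤ Lr)
    (δ : ℝ) (hδ₀ : 0 < δ) (hδ : δ < 1 / 2)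
    (θ : Finset ℝ) (hθ : QuadHard.curveWeights δ ⊆ θ)
    (A : QuadHard.Prog)
    (hA : ∀ n : ℕ, 1 ≤ n →
      ∀ Φ ∈ QuadHard.inputClass d k C wr Lr θ n \ QuadHard.inputClass d k C wr Lr θ (n - 1),
        2 / 3 ≤ QuadHard.coinMeasure {ω | ∃ v : ℝ, A.OutputsReal (Φ.encode θ) ω v ∧
          |v - ∫ x in Set.Icc (0 : Fin d → ℝ) 1, Φ.realize x 0| < δ ^ n / 2})
    (t : ℝ) (ht : 0 < t)
    (hT : QuadHard.IsBigOExp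
      (fun n => A.worstTime ((fun Φ => Φ.encode θ) '' QuadHard.inputClass d k C wr Lr θ n)) t) :
    QuadHard.sTilde C k ≤ t := by
  obtain ⟨c, hc, hcT⟩ := hT.exists_forall_le fun m n hmn =>
    QuadHard.monotone_worstTime A (Set.image_mono (QuadHard.monotone_inputClass hmn))
  have htime (n : ℕ) (Φ) (hΦ : Φ ∈ QuadHard.inputClass d k C wr Lr θ n) (ω : ℕ → Bool) :
      A.time (Φ.encode θ) ω ≤ ⌊c * 2 ^ (t * n)⌋₊ :=
    QuadHard.worstTime_le_iff.1 (hcT n) _ (Set.mem_image_of_mem _ hΦ) ω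
  have hhalts (n : ℕ) (Φ) (hΦ : Φ ∈ QuadHard.inputClass d k C wr Lr θ n) (ω : ℕ → Bool) :
      A.Halts (Φ.encode θ) ω :=
    let ⟨T, s, hs, _⟩ := QuadHard.time_le_iff.1 (htime n Φ hΦ ω)
    ⟨T, s, hs⟩
  obtain ⟨e₀, he₀⟩ := QuadHard.exists_one_le_inv_pow_mul hδ₀ hδ
  refine le_of_forall_gt_imp_ge_of_dense fun s hs => csInf_le ⟨0, fun u hu => hu.1.le⟩ ?_
  obtain ⟨M, hM, hMs⟩ := QuadHard.exists_mul_add_three_lt ht hs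
  obtain ⟨e, he⟩ := QuadHard.exists_two_pow_between hδ₀ hδ M
  exact ⟨ht.trans hs, QuadHard.satProg δ θ d k C M e₀ e (max 2 (C * wr * k)) A,
    QuadHard.decidesKSAT_satProg hd hk hC hwr hLr hδ₀ hδ hθ hA hhalts hM he₀ he,
    QuadHard.isBigOExp_satProg hd hk hC hwr hLr hθ ht hc htime hM hMs⟩

theorem theorem3p12
    (d k C wr Lr : ℕ) (hd : 1 ≤ d) (hk : 1 ≤ k) (hC : 1 ≤ C)
    (δ : ℝ) (hδ₀ : 0 < δ) (hδ : δ < 1 / 2)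
    (θr : Finset ℝ) (Ψ : QuadHard.Network 1 1) (hΨ : Ψ ∈ QuadHard.Network.netClass 1 wr Lr θr)
    (r : ℝ → ℝ) (hr_cont : Continuous r) (hr_range : ∀ x, r x ∈ Set.Icc (0 : ℝ) 1)
    (hr_zero : ∀ x, x ≤ 1 / 2 → r x = 0) (hr_one : ∀ x, 1 - δ ≤ x → r x = 1)
    (hrΨ : ∀ x : ℝ, Ψ.realize (fun _ => x) 0 = r x)
    (θ : Finset ℝ) (hθ : QuadHard.cnfWeights θr k ∪ QuadHard.curveWeights δ ⊆ θ)
    (A : QuadHard.Prog)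
    (hA : ∀ n : ℕ, 1 ≤ n →
      ∀ Φ ∈ QuadHard.inputClass d k C wr Lr θ n \ QuadHard.inputClass d k C wr Lr θ (n - 1),
        2 / 3 ≤ QuadHard.coinMeasure {ω | ∃ v : ℝ, A.OutputsReal (Φ.encode θ) ω v ∧
          |v - ∫ x in Set.Icc (0 : Fin d → ℝ) 1, Φ.realize x 0| < δ ^ n / 2})
    (t : ℝ) (ht : 0 < t)
    (hT : QuadHard.IsBigOExp
      (fun n => A.worstTime ((fun Φ => Φ.encode θ) '' QuadHard.inputClass d k C wr Lr θ n)) t) :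
    QuadHard.sTilde C k ≤ t :=
  theorem3p12_general d k C wr Lr hd hk hC (hΨ.2.1 1 Ψ.mem_widths).2 (Ψ.one_le_depth.trans hΨ.1)
    δ hδ₀ hδ θ (Finset.union_subset_right hθ) A hA t ht hT
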